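/- Let $p$ be an odd prime, let $G = D_p$ be the dihedral group of order $2p$, and let $k$ be a positive even integer. Then there is no finite $G$-CW complex $X$ with $X^G=\emptyset$ that is homotopy equivalent to the sphere $S^{2k}$, on which $G$ acts effectively and pseudofreely, and on which every element of $G$ induces the identity on the integral homology $H_*(X;\mathbb{Z})$. Here an action is called pseudofree if it is free outside of a discrete set of points. -/

import Mathlib

open Topology

universe u

/-- A `G`-CW structure, for a discrete group `G`, on a `G`-space `X` with a given CW structure:
for every `n` the set `cell n` of `n`-cells is a `G`-set (a disjoint union of orbits `G ⧸ H`) and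
the characteristic maps assemble to a `G`-equivariant map `cell n × Dⁿ → X`, where `G` acts
trivially on the disc `Dⁿ`. In other words, `X` is built from equivariant cells `(G ⧸ H) × Dⁿ`.
Discs are unit balls of `Fin n → ℝ` for the maximum norm, as in Mathlib's CW complexes. -/
class GCWComplex (G : Type*) [Group G] (X : Type u) [TopologicalSpace X] [MulAction G X]
    [CWComplex (Set.univ : Set X)] where
  [cellAction (n : ℕ) : MulAction G (RelCWComplex.cell (Set.univ : Set X) n)]
  map_smul (n : ℕ) (g : G) (i : RelCWComplex.cell (Set.univ : Set X) n) (x : Fin n → ℝ)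
    (hx : x ∈ Metric.closedBall (0 : Fin n → ℝ) 1) :
    RelCWComplex.map (C := (Set.univ : Set X)) n (g • i) x =
      g • RelCWComplex.map (C := (Set.univ : Set X)) n i x

/-- The set of points of `X` with non-trivial isotropy group. -/
def singularSet (G : Type*) [Group G] (X : Type*) [MulAction G X] : Set X :=
  {x | ∃ g : G, g ≠ 1 ∧ g • x = x}

/-- An action is pseudofree if it is free outside of a discrete set of points. -/
def IsPseudofree (G : Type*) [Group G] (X : Type*) [TopologicalSpace X] [MulAction G X] : Prop :=
  IsDiscrete (singularSet G X)

/-- Every element of `G` induces the identity on the integral singular homology of `X`, in every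
degree. -/
def ActsTriviallyOnHomology (G : Type*) [Group G] (X : Type u) [TopologicalSpace X]
    [MulAction G X] [ContinuousConstSMul G X] : Prop :=
  ∀ (g : G) (n : ℕ),
    ((AlgebraicTopology.singularHomologyFunctor (ModuleCat.{u} ℤ) n).obj
      (ModuleCat.of ℤ (ULift.{u} ℤ))).map
        (TopCat.ofHom ⟨fun x : X => g • x, continuous_const_smul g⟩) =
      CategoryTheory.CategoryStruct.id _

/-! Let `r` be a rotation of order `p` and `s` a reflection, so that `r s r = s`. The argument is
Tate cohomology of the cyclic group generated by `r`, written at the level of singular chains. It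
first yields a point fixed by `r`, and then shows that `s` fixes every such point. The point is then
fixed by all of `G`, against `X^G = ∅`.

Chains are augmented and indexed by the number of vertices: `Chain n` sits in degree `n - 1`, and
`Chain 0` is spanned by the empty simplex. A zigzag from an `r`-invariant cycle `a` is a sequence of
chains `c_0, c_1, ...` with `∂ c_0 = a` and `∂ c_(j+1) = T_j c_j`, where `T_j` is alternately `r -
1` and the norm `N = 1 + r + ... + r^(p-1)`. Each `T_j c_j` is a cycle, so extending a zigzag meets
an obstruction only in degree `2k`, the single degree in which `X` has reduced homology.

Zigzags that reach high degrees have a consequence at their start. Since the action is pseudofree,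
`r` moves every cell of positive dimension. Mayer-Vietoris along the skeleta then shows that
invariant cycles of high degree bound invariant chains (`exists_boundsInv_univ`). The sequence of
the `T_j` is exact modulo chains of fixed simplices (`exists_eq_periodicMap_add`), so one can
descend along the zigzag and obtain `a = N b + ∂ d` with `d` supported on fixed simplices
(`Zigzag.exists_eq_chainNorm_add`). The coefficient of `N b` at a fixed simplex is divisible by `p`.

If `r` had no fixed point, take `a` to be the empty simplex. In degree `2k` the obstruction `z = (r
- 1) c` satisfies `N z = 0`, while triviality on homology makes `N z` homologous to `p z`. As the
homology is torsion free, `z` bounds, the zigzag continues, and `1` would be divisible by `p`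
(`exists_fixed_of_actsTrivially`).

If `r x = x` but `s x ≠ x`, take `a = x - s x`, so that `s a = -a`. Now the obstruction is `w = N
c`. Reflecting the zigzag multiplies it by the sign `(-1)^k = 1`, and comparison with the original
zigzag gives a cycle `z` with `w + s w = N z`, whence `2 w` is homologous to `p z`. As `p` is odd,
`w` is then homologous to the norm of a cycle, which can be subtracted from `c`
(`Zigzag.exists_bd_chainNorm_eq`). Again the zigzag continues. The fixed set is discrete, so `∂ d =
0`, and the coefficient `1` of `a` at `x` would be divisible by `p`
(`false_of_actsTrivially_of_fixed`). -/

set_option linter.unusedSectionVars false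

/-! ### Affine chains, coning constructions, convex combinations. -/

noncomputable section

namespace SingularChains

/-! ### Affine chains -/

/-- Affine chains in `K`: formal combinations of `n`-tuples of vertices. -/
abbrev AffChain (n : ℕ) (K : Type*) := (Fin n → K) →₀ ℤ

variable {K K' K'' : Type*}

/-- The boundary of affine chains. -/
def affBd (n : ℕ) : AffChain (n + 1) K →ₗ[ℤ] AffChain n K :=
  Finsupp.linearCombination ℤ fun v =>
    ∑ i : Fin (n + 1), (-1 : ℤ) ^ (i : ℕ) • Finsupp.single (v ∘ i.succAbove) (1 : ℤ)

/-- The cone over an affine chain. -/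
def cone (b : K) (n : ℕ) : AffChain n K →ₗ[ℤ] AffChain (n + 1) K :=
  Finsupp.lmapDomain ℤ ℤ fun v => Fin.cons b v

/-- The image of an affine chain under a map of vertices. -/
def affMap (f : K → K') (n : ℕ) : AffChain n K →ₗ[ℤ] AffChain n K' :=
  Finsupp.lmapDomain ℤ ℤ fun v => f ∘ v

lemma affBd_single {n : ℕ} (v : Fin (n + 1) → K) (a : ℤ) :
    affBd n (Finsupp.single v a) =
      a • ∑ i : Fin (n + 1), (-1 : ℤ) ^ (i : ℕ) • Finsupp.single (v ∘ i.succAbove) (1 : ℤ) := by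
  simp [affBd]

@[simp] lemma cone_single (b : K) {n : ℕ} (v : Fin n → K) (a : ℤ) :
    cone b n (Finsupp.single v a) = Finsupp.single (Fin.cons b v) a := by
  simp [cone]

@[simp] lemma affMap_single (f : K → K') {n : ℕ} (v : Fin n → K) (a : ℤ) :
    affMap f n (Finsupp.single v a) = Finsupp.single (f ∘ v) a := by
  simp [affMap]

lemma affMap_affMap (f : K → K') (g : K' → K'') {n : ℕ} (c : AffChain n K) :
    affMap g n (affMap f n c) = affMap (g ∘ f) n c := by
  induction c using Finsupp.induction_linear with
  | zero => simp
  | add x y hx hy => simp only [map_add, hx, hy]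
  | single v a => simp [Function.comp_assoc]

lemma affBd_affMap (f : K → K') {n : ℕ} (c : AffChain (n + 1) K) :
    affBd n (affMap f _ c) = affMap f _ (affBd n c) := by
  induction c using Finsupp.induction_linear with
  | zero => simp
  | add x y hx hy => simp only [map_add, hx, hy]
  | single v a => simp [affBd_single, map_sum, Function.comp_assoc]

lemma affMap_cone (f : K → K') (b : K) {n : ℕ} (c : AffChain n K) :
    affMap f _ (cone b n c) = cone (f b) n (affMap f _ c) := by
  induction c using Finsupp.induction_linear with
  | zero => simp
  | add x y hx hy => simp only [map_add, hx, hy]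
  | single v a =>
    simp only [cone_single, affMap_single]
    congr 1
    funext i
    refine Fin.cases ?_ (fun i => ?_) i <;> simp

/-- The complex is augmented: a tuple of length zero has no boundary, so the second term of the cone
formula is absent here. -/
lemma affBd_cone_zero (b : K) (c : AffChain 0 K) : affBd 0 (cone b 0 c) = c := by
  induction c using Finsupp.induction_linear with
  | zero => simp
  | add x y hx hy => simp only [map_add, hx, hy]
  | single v a =>
    simp [affBd_single]

lemma affBd_cone_succ (b : K) {n : ℕ} (c : AffChain (n + 1) K) :
    affBd (n + 1) (cone b _ c) = c - cone b n (affBd n c) := by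
  induction c using Finsupp.induction_linear with
  | zero => simp
  | add x y hx hy => simp only [map_add, hx, hy]; abel
  | single v a =>
    have h0 : (Fin.cons b v : Fin (n + 2) → K) ∘ Fin.succAbove 0 = v := by
      funext i; simp
    have h1 : ∀ i : Fin (n + 1), (Fin.cons b v : Fin (n + 2) → K) ∘ Fin.succAbove i.succ =
        Fin.cons b (v ∘ i.succAbove) := by
      intro i
      funext j
      refine Fin.cases ?_ (fun j => ?_) j <;> simp
    rw [cone_single, affBd_single, affBd_single, Fin.sum_univ_succ, h0]
    simp only [h1, map_smul, map_sum, cone_single, Fin.val_zero, pow_zero, one_smul, Fin.val_succ,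
      pow_succ, mul_neg, mul_one, neg_smul, Finset.sum_neg_distrib, smul_add, smul_neg,
      Finsupp.smul_single, smul_eq_mul]
    simp [sub_eq_add_neg]

/-- Every tuple is the cone from its first vertex over its tail, so the cone formula and induction
replace the usual cancellation of pairs of faces. -/
lemma affBd_affBd : ∀ {n : ℕ} (c : AffChain (n + 2) K), affBd n (affBd (n + 1) c) = 0 := by
  intro n
  induction n with
  | zero =>
    intro c
    induction c using Finsupp.induction_linear with
    | zero => simp
    | add x y hx hy => simp only [map_add, hx, hy, add_zero]
    | single v a =>
      have h : Finsupp.single v a = cone (v 0) _ (Finsupp.single (Fin.tail v) a) := by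
        simp
      rw [h, affBd_cone_succ, map_sub, affBd_cone_zero, sub_self]
  | succ n ih =>
    intro c
    induction c using Finsupp.induction_linear with
    | zero => simp
    | add x y hx hy => simp only [map_add, hx, hy, add_zero]
    | single v a =>
      have h : Finsupp.single v a = cone (v 0) _ (Finsupp.single (Fin.tail v) a) := by
        simp
      rw [h, affBd_cone_succ, map_sub, affBd_cone_succ, ih, map_zero, sub_zero, sub_self]

/-! ### Homotopies by coning -/

/-- The chain homotopy to zero of an augmentation preserving chain map `φ`, obtained by coning off
inductively with cone points `b v`. -/
def coneHomotopy (φ : ∀ n, AffChain n K →ₗ[ℤ] AffChain n K') (b : ∀ n, (Fin (n + 1) → K) → K') :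
    ∀ n, AffChain n K →ₗ[ℤ] AffChain (n + 1) K'
  | 0 => 0
  | n + 1 => Finsupp.linearCombination ℤ fun v => cone (b _ v) _
      (φ (n + 1) (Finsupp.single v 1) - coneHomotopy φ b n (affBd n (Finsupp.single v 1)))

/-- By induction `φ v - h (∂ v)` is a cycle, so coning it off gives a chain whose boundary is that
cycle. The condition `h0` starts the induction: there is no room for a homotopy on empty tuples. -/
lemma affBd_coneHomotopy (φ : ∀ n, AffChain n K →ₗ[ℤ] AffChain n K') (b : ∀ n, (Fin (n + 1) → K) → K')
    (h0 : φ 0 = 0) (hφ : ∀ n (c : AffChain (n + 1) K), affBd n (φ (n + 1) c) = φ n (affBd n c)) :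
    ∀ n (c : AffChain (n + 1) K), affBd (n + 1) (coneHomotopy φ b (n + 1) c) +
      coneHomotopy φ b n (affBd n c) = φ (n + 1) c := by
  intro n
  induction n with
  | zero =>
    intro c
    induction c using Finsupp.induction_linear with
    | zero => simp
    | add x y hx hy => simp only [map_add] at *; rw [← hx, ← hy]; abel
    | single v a =>
      have h1 : Finsupp.single v a = a • Finsupp.single v (1 : ℤ) := by simp
      rw [h1]
      simp only [map_smul, ← smul_add]
      congr 1
      simp [coneHomotopy, affBd_cone_succ, hφ, h0]
  | succ n ih =>
    intro c
    induction c using Finsupp.induction_linear with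
    | zero => simp
    | add x y hx hy => simp only [map_add] at *; rw [← hx, ← hy]; abel
    | single v a =>
      have h1 : Finsupp.single v a = a • Finsupp.single v (1 : ℤ) := by simp
      rw [h1]
      simp only [map_smul, ← smul_add]
      congr 1
      have h2 := ih (affBd _ (Finsupp.single v 1))
      rw [affBd_affBd, map_zero, add_zero] at h2
      rw [coneHomotopy, Finsupp.linearCombination_single, one_smul, affBd_cone_succ, map_sub, hφ, h2,
        sub_self, map_zero, sub_zero, sub_add_cancel]

/-- Naturality of the construction under maps compatible with the cone points. It lets an operator
be defined on the tautological simplex and then transported to all singular simplices. -/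
lemma affMap_coneHomotopy {L L' : Type*} (φ : ∀ n, AffChain n K →ₗ[ℤ] AffChain n K')
    (b : ∀ n, (Fin (n + 1) → K) → K') (ψ : ∀ n, AffChain n L →ₗ[ℤ] AffChain n L')
    (d : ∀ n, (Fin (n + 1) → L) → L') (f : K → L) (g : K' → L')
    (hφ : ∀ n c, affMap g n (φ n c) = ψ n (affMap f n c))
    (hb : ∀ n v, g (b n v) = d n (f ∘ v)) :
    ∀ n c, affMap g _ (coneHomotopy φ b n c) = coneHomotopy ψ d n (affMap f _ c) := by
  intro n
  induction n with
  | zero => intro c; simp [coneHomotopy]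
  | succ n ih =>
    intro c
    induction c using Finsupp.induction_linear with
    | zero => simp
    | add x y hx hy => simp only [map_add, hx, hy]
    | single v a =>
      have h1 : Finsupp.single v a = a • Finsupp.single v (1 : ℤ) := by simp
      rw [h1]
      simp only [map_smul]
      congr 1
      rw [coneHomotopy, Finsupp.linearCombination_single, one_smul, affMap_cone, map_sub, hφ, hb, ih,
        affMap_single, coneHomotopy, Finsupp.linearCombination_single, one_smul, ← affBd_affMap,
        affMap_single]

/-- Subdivision of affine chains with respect to cone points `b v`. -/
def affSd (b : ∀ n, (Fin (n + 1) → K) → K) : ∀ n, AffChain n K →ₗ[ℤ] AffChain n K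
  | 0 => LinearMap.id
  | n + 1 => Finsupp.linearCombination ℤ fun v => cone (b _ v) _
      (affSd b n (affBd n (Finsupp.single v 1)))

lemma affSd_succ_single (b : ∀ n, (Fin (n + 1) → K) → K) {n : ℕ} (v : Fin (n + 1) → K) :
    affSd b (n + 1) (Finsupp.single v 1) =
      cone (b _ v) _ (affSd b n (affBd n (Finsupp.single v 1))) := by
  simp [affSd]

lemma affBd_affSd (b : ∀ n, (Fin (n + 1) → K) → K) :
    ∀ n (c : AffChain (n + 1) K), affBd n (affSd b (n + 1) c) = affSd b n (affBd n c) := by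
  intro n
  induction n with
  | zero =>
    intro c
    induction c using Finsupp.induction_linear with
    | zero => simp
    | add x y hx hy => simp only [map_add, hx, hy]
    | single v a =>
      have h1 : Finsupp.single v a = a • Finsupp.single v (1 : ℤ) := by simp
      rw [h1]
      simp only [map_smul]
      rw [affSd_succ_single, affBd_cone_zero]
  | succ n ih =>
    intro c
    induction c using Finsupp.induction_linear with
    | zero => simp
    | add x y hx hy => simp only [map_add, hx, hy]
    | single v a =>
      have h1 : Finsupp.single v a = a • Finsupp.single v (1 : ℤ) := by simp
      rw [h1]
      simp only [map_smul]
      rw [affSd_succ_single, affBd_cone_succ, ih, affBd_affBd, map_zero, map_zero, sub_zero]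

lemma affMap_affSd (b : ∀ n, (Fin (n + 1) → K) → K) (b' : ∀ n, (Fin (n + 1) → K') → K') (f : K → K')
    (hb : ∀ n v, f (b n v) = b' n (f ∘ v)) :
    ∀ n c, affMap f n (affSd b n c) = affSd b' n (affMap f n c) := by
  intro n
  induction n with
  | zero => intro c; simp [affSd]
  | succ n ih =>
    intro c
    induction c using Finsupp.induction_linear with
    | zero => simp
    | add x y hx hy => simp only [map_add, hx, hy]
    | single v a =>
      have h1 : Finsupp.single v a = a • Finsupp.single v (1 : ℤ) := by simp
      rw [h1]
      simp only [map_smul]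
      rw [affSd_succ_single, affMap_cone, ih, hb, ← affBd_affMap, affMap_single, affSd_succ_single]

/-! ### Convex combinations -/

/-- Spaces in which points can be mixed with the weights given by a point of a standard simplex. -/
class Mixable (K : Type*) [TopologicalSpace K] where
  mix : ∀ {m : ℕ}, stdSimplex ℝ (Fin m) → (Fin m → K) → K
  continuous_mix : ∀ {m : ℕ} (v : Fin m → K), Continuous fun t => mix t v
  mix_map : ∀ {m k : ℕ} (f : Fin m → Fin k) (t : stdSimplex ℝ (Fin m)) (v : Fin k → K),
    mix (stdSimplex.map f t) v = mix t (v ∘ f)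

export Mixable (mix continuous_mix mix_map)

lemma sum_stdSimplex_map {m k : ℕ} (f : Fin m → Fin k) (t : stdSimplex ℝ (Fin m))
    {E : Type*} [AddCommGroup E] [Module ℝ E] (v : Fin k → E) :
    ∑ j, stdSimplex.map f t j • v j = ∑ i, t i • v (f i) := by
  have h : ∀ j, stdSimplex.map f t j = ∑ i, if f i = j then t i else 0 := by
    intro j
    have := congrFun (stdSimplex.map_coe f t) j
    rw [FunOnFinite.linearMap_apply_apply] at this
    rw [← Finset.sum_filter]
    exact this
  simp only [h, Finset.sum_smul]
  rw [Finset.sum_comm]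
  refine Finset.sum_congr rfl fun i _ => ?_
  rw [Finset.sum_eq_single (f i)]
  · simp
  · intro j _ hj; simp [Ne.symm hj]
  · simp

/-- Mixing points of a convex set. -/
@[reducible] def mixableOfConvex {E : Type*} [AddCommGroup E] [Module ℝ E] [TopologicalSpace E]
    [ContinuousAdd E] [ContinuousSMul ℝ E] {s : Set E} (hs : Convex ℝ s) : Mixable s where
  mix t v := ⟨∑ i, t i • (v i : E), hs.sum_mem (fun i _ => stdSimplex.zero_le t i)
    (stdSimplex.sum_eq_one t) fun i _ => (v i).2⟩
  continuous_mix v := by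
    refine Continuous.subtype_mk (continuous_finsetSum _ fun i _ => ?_) _
    exact ((continuous_apply i).comp continuous_subtype_val).smul continuous_const
  mix_map f t v := by
    ext1
    exact sum_stdSimplex_map f t fun j => (v j : E)

instance (N : ℕ) : Mixable (stdSimplex ℝ (Fin N)) := mixableOfConvex (convex_stdSimplex ℝ _)

instance : Mixable unitInterval := mixableOfConvex (convex_Icc 0 1)

instance {K K' : Type*} [TopologicalSpace K] [TopologicalSpace K'] [Mixable K] [Mixable K'] :
    Mixable (K × K') where
  mix t v := (mix t (Prod.fst ∘ v), mix t (Prod.snd ∘ v))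
  continuous_mix v := (continuous_mix _).prodMk (continuous_mix _)
  mix_map f t v := by simp only [mix_map]; rfl

lemma coe_mix {N m : ℕ} (t : stdSimplex ℝ (Fin m)) (v : Fin m → stdSimplex ℝ (Fin N)) :
    ((mix t v : stdSimplex ℝ (Fin N)) : Fin N → ℝ) = ∑ i, t i • (v i : Fin N → ℝ) := rfl

lemma mix_apply {N m : ℕ} (t : stdSimplex ℝ (Fin m)) (v : Fin m → stdSimplex ℝ (Fin N)) (j : Fin N) :
    mix t v j = ∑ i, t i * v i j := by
  simpa using congrFun (coe_mix t v) j

lemma mix_vertex {N : ℕ} (t : stdSimplex ℝ (Fin N)) :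
    mix t (fun i => stdSimplex.vertex (S := ℝ) i) = t := by
  ext j
  have := mix_apply t (fun i => stdSimplex.vertex (S := ℝ) i) j
  simp only [stdSimplex.vertex_coe] at this
  change mix t (fun i => stdSimplex.vertex (S := ℝ) i) j = t j
  rw [this, Finset.sum_eq_single j]
  · simp
  · intro i _ hi
    simp [hi.symm]
  · simp

lemma mix_mix {N m k : ℕ} (s : stdSimplex ℝ (Fin k)) (w : Fin k → stdSimplex ℝ (Fin m))
    (v : Fin m → stdSimplex ℝ (Fin N)) :
    mix (mix s w) v = mix s fun i => mix (w i) v := by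
  ext j
  simp only [mix_apply, Finset.sum_mul, Finset.mul_sum]
  rw [Finset.sum_comm]
  simp only [mul_assoc]

lemma dist_mix_le {N m : ℕ} (x : stdSimplex ℝ (Fin N)) (t : stdSimplex ℝ (Fin m))
    (v : Fin m → stdSimplex ℝ (Fin N)) : dist x (mix t v) ≤ ∑ i, t i * dist x (v i) := by
  have h1 : (x : Fin N → ℝ) - ((mix t v : stdSimplex ℝ (Fin N)) : Fin N → ℝ) =
      ∑ i, t i • ((x : Fin N → ℝ) - (v i : Fin N → ℝ)) := by
    rw [coe_mix]
    simp only [smul_sub, Finset.sum_sub_distrib, ← Finset.sum_smul, stdSimplex.sum_eq_one, one_smul]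
  rw [Subtype.dist_eq, dist_eq_norm]
  have h2 : ‖(x : Fin N → ℝ) - ((mix t v : stdSimplex ℝ (Fin N)) : Fin N → ℝ)‖ ≤
      ∑ i, ‖t i • ((x : Fin N → ℝ) - (v i : Fin N → ℝ))‖ := h1 ▸ norm_sum_le _ _
  refine h2.trans (le_of_eq (Finset.sum_congr rfl fun i _ => ?_))
  rw [norm_smul, Real.norm_of_nonneg (stdSimplex.zero_le t i), Subtype.dist_eq, dist_eq_norm]
  rfl

end SingularChains

end

/-! ### Singular chains, barycentric subdivision and prisms. -/

noncomputable section

namespace SingularChains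

variable {K K' : Type*} [TopologicalSpace K] [Mixable K] [TopologicalSpace K'] [Mixable K']
variable {X Y Z : Type*} [TopologicalSpace X] [TopologicalSpace Y] [TopologicalSpace Z]

/-- Singular simplices with `n` vertices. -/
abbrev Simp (n : ℕ) (X : Type*) [TopologicalSpace X] := C(stdSimplex ℝ (Fin n), X)

/-- Singular chains on simplices with `n` vertices. -/
abbrev Chain (n : ℕ) (X : Type*) [TopologicalSpace X] := Simp n X →₀ ℤ

/-- The inclusion of the `i`-th face of a standard simplex. -/
def faceMap {n : ℕ} (i : Fin (n + 1)) : C(stdSimplex ℝ (Fin n), stdSimplex ℝ (Fin (n + 1))) :=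
  ⟨stdSimplex.map i.succAbove, stdSimplex.continuous_map _⟩

/-- The boundary of singular chains. -/
def bd (n : ℕ) : Chain (n + 1) X →ₗ[ℤ] Chain n X :=
  Finsupp.linearCombination ℤ fun σ =>
    ∑ i : Fin (n + 1), (-1 : ℤ) ^ (i : ℕ) • Finsupp.single (σ.comp (faceMap i)) (1 : ℤ)

lemma bd_single {n : ℕ} (σ : Simp (n + 1) X) (a : ℤ) :
    bd n (Finsupp.single σ a) =
      a • ∑ i : Fin (n + 1), (-1 : ℤ) ^ (i : ℕ) • Finsupp.single (σ.comp (faceMap i)) (1 : ℤ) := by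
  simp [bd]

lemma single_eq_smul {α : Type*} (x : α) (a : ℤ) :
    Finsupp.single x a = a • Finsupp.single x (1 : ℤ) := by simp

/-- The affine singular simplex with given vertices. -/
def aff {n : ℕ} (v : Fin n → K) : C(stdSimplex ℝ (Fin n), K) := ⟨fun t => mix t v, continuous_mix v⟩

/-- The image of affine chains of `K` under a continuous map. -/
def push (F : C(K, X)) (n : ℕ) : AffChain n K →ₗ[ℤ] Chain n X :=
  Finsupp.lmapDomain ℤ ℤ fun v => F.comp (aff v)

/-- The image of singular chains under a continuous map. -/
def chainMap (f : C(X, Y)) (n : ℕ) : Chain n X →ₗ[ℤ] Chain n Y :=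
  Finsupp.lmapDomain ℤ ℤ fun σ => f.comp σ

@[simp] lemma push_single (F : C(K, X)) {n : ℕ} (v : Fin n → K) (a : ℤ) :
    push F n (Finsupp.single v a) = Finsupp.single (F.comp (aff v)) a := by
  simp [push]

@[simp] lemma chainMap_single (f : C(X, Y)) {n : ℕ} (σ : Simp n X) (a : ℤ) :
    chainMap f n (Finsupp.single σ a) = Finsupp.single (f.comp σ) a := by
  simp [chainMap]

lemma chainMap_id (n : ℕ) (c : Chain n X) : chainMap (ContinuousMap.id X) n c = c := by
  induction c using Finsupp.induction_linear with
  | zero => simp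
  | add x y hx hy => simp only [map_add, hx, hy]
  | single v a => simp

lemma chainMap_comp (f : C(X, Y)) (g : C(Y, Z)) (n : ℕ) (c : Chain n X) :
    chainMap (g.comp f) n c = chainMap g n (chainMap f n c) := by
  induction c using Finsupp.induction_linear with
  | zero => simp
  | add x y hx hy => simp only [map_add, hx, hy]
  | single v a => simp [ContinuousMap.comp_assoc]

lemma bd_chainMap (f : C(X, Y)) (n : ℕ) (c : Chain (n + 1) X) :
    bd n (chainMap f _ c) = chainMap f _ (bd n c) := by
  induction c using Finsupp.induction_linear with
  | zero => simp
  | add x y hx hy => simp only [map_add, hx, hy]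
  | single v a => simp [bd_single, map_sum, ContinuousMap.comp_assoc]

lemma chainMap_push (F : C(K, X)) (f : C(X, Y)) (n : ℕ) (c : AffChain n K) :
    chainMap f n (push F n c) = push (f.comp F) n c := by
  induction c using Finsupp.induction_linear with
  | zero => simp
  | add x y hx hy => simp only [map_add, hx, hy]
  | single v a => simp [ContinuousMap.comp_assoc]

lemma aff_comp_faceMap {n : ℕ} (v : Fin (n + 1) → K) (i : Fin (n + 1)) :
    (aff v).comp (faceMap i) = aff (v ∘ i.succAbove) := by
  ext1 t
  exact mix_map _ _ _

lemma bd_push (F : C(K, X)) (n : ℕ) (c : AffChain (n + 1) K) :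
    bd n (push F _ c) = push F _ (affBd n c) := by
  induction c using Finsupp.induction_linear with
  | zero => simp
  | add x y hx hy => simp only [map_add, hx, hy]
  | single v a =>
    simp [bd_single, affBd_single, map_sum, ContinuousMap.comp_assoc, aff_comp_faceMap]

/-- The tuple of vertices of the standard simplex. -/
def vertices (n : ℕ) : Fin n → stdSimplex ℝ (Fin n) := fun i => stdSimplex.vertex i

lemma aff_vertices (n : ℕ) : aff (vertices n) = ContinuousMap.id _ := by
  ext1 t
  exact mix_vertex t

/-- Every singular simplex is its own push-forward of the tautological affine simplex. Identities
for affine chains pass to singular chains in this way. -/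
lemma push_vertices {n : ℕ} (σ : Simp n X) (a : ℤ) :
    push σ n (Finsupp.single (vertices n) a) = Finsupp.single σ a := by
  simp [aff_vertices]

lemma bd_single_eq_push {n : ℕ} (σ : Simp (n + 1) X) :
    bd n (Finsupp.single σ 1) = push σ n (affBd n (Finsupp.single (vertices (n + 1)) 1)) := by
  rw [← push_vertices, bd_push]

lemma bd_bd (n : ℕ) (c : Chain (n + 2) X) : bd n (bd (n + 1) c) = 0 := by
  induction c using Finsupp.induction_linear with
  | zero => simp
  | add x y hx hy => simp only [map_add, hx, hy, add_zero]
  | single σ a =>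
    rw [← push_vertices, bd_push, bd_push, affBd_affBd, map_zero]

/-- The hypothesis `hf` says that `f` is affine, so that composing with `f` and moving the vertices
by `f` agree. -/
lemma push_affMap (F : C(K', X)) (f : C(K, K'))
    (hf : ∀ {m : ℕ} (t : stdSimplex ℝ (Fin m)) (v : Fin m → K), f (mix t v) = mix t (f ∘ v))
    (n : ℕ) (c : AffChain n K) : push F n (affMap f n c) = push (F.comp f) n c := by
  induction c using Finsupp.induction_linear with
  | zero => simp
  | add x y hx hy => simp only [map_add, hx, hy]
  | single v a =>
    simp only [affMap_single, push_single, ContinuousMap.comp_assoc]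
    congr 2
    ext1 t
    exact (hf t v).symm

lemma aff_mix {N n m : ℕ} (v : Fin n → stdSimplex ℝ (Fin N)) (t : stdSimplex ℝ (Fin m))
    (w : Fin m → stdSimplex ℝ (Fin n)) : aff v (mix t w) = mix t (aff v ∘ w) :=
  mix_mix t w v

lemma aff_comp_vertices {N n : ℕ} (v : Fin n → stdSimplex ℝ (Fin N)) : aff v ∘ vertices n = v := by
  funext i
  ext j
  change mix (stdSimplex.vertex (S := ℝ) i) v j = v i j
  rw [mix_apply, Finset.sum_eq_single i]
  · simp
  · intro k _ hk; simp [hk]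
  · simp

/-! ### Operators induced by operators on affine chains -/

/-- The barycenter of a tuple of points in a standard simplex. -/
def bary {N : ℕ} (n : ℕ) (v : Fin (n + 1) → stdSimplex ℝ (Fin N)) : stdSimplex ℝ (Fin N) :=
  mix stdSimplex.barycenter v

/-- Barycentric subdivision of singular chains. -/
def sd (n : ℕ) : Chain n X →ₗ[ℤ] Chain n X :=
  Finsupp.linearCombination ℤ fun σ => push σ n (affSd bary n (Finsupp.single (vertices n) 1))

lemma sd_single {n : ℕ} (σ : Simp n X) :
    sd n (Finsupp.single σ 1) = push σ n (affSd bary n (Finsupp.single (vertices n) 1)) := by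
  simp [sd]

/-- The operator `sd` is defined through the tautological simplex only. Since `affSd` commutes with
affine maps, it is given by the same formula on all affine chains, in particular on the faces
occurring in a boundary. -/
lemma sd_push {N : ℕ} (F : C(stdSimplex ℝ (Fin N), X)) (n : ℕ) (c : AffChain n _) :
    sd n (push F n c) = push F n (affSd bary n c) := by
  induction c using Finsupp.induction_linear with
  | zero => simp
  | add x y hx hy => simp only [map_add, hx, hy]
  | single v a =>
    rw [single_eq_smul]
    simp only [map_smul]
    rw [push_single, sd_single, ← push_affMap F (aff v) (aff_mix v),
      affMap_affSd bary bary (aff v) (fun n w => aff_mix v _ w), affMap_single, aff_comp_vertices]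

lemma bd_sd (n : ℕ) (c : Chain (n + 1) X) : bd n (sd (n + 1) c) = sd n (bd n c) := by
  induction c using Finsupp.induction_linear with
  | zero => simp
  | add x y hx hy => simp only [map_add, hx, hy]
  | single σ a =>
    rw [single_eq_smul]
    simp only [map_smul]
    rw [sd_single, bd_push, affBd_affSd, bd_single_eq_push, sd_push]

lemma sd_chainMap (f : C(X, Y)) (n : ℕ) (c : Chain n X) :
    sd n (chainMap f n c) = chainMap f n (sd n c) := by
  induction c using Finsupp.induction_linear with
  | zero => simp
  | add x y hx hy => simp only [map_add, hx, hy]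
  | single σ a =>
    rw [single_eq_smul]
    simp only [map_smul]
    rw [chainMap_single, sd_single, sd_single, chainMap_push]

/-- The affine homotopy from the identity to the subdivision. -/
def affSdHomotopy {N : ℕ} : ∀ n, AffChain n (stdSimplex ℝ (Fin N)) →ₗ[ℤ]
    AffChain (n + 1) (stdSimplex ℝ (Fin N)) :=
  coneHomotopy (fun n => LinearMap.id - affSd bary n) bary

/-- The chain homotopy from the identity to the subdivision. -/
def sdHomotopy (n : ℕ) : Chain n X →ₗ[ℤ] Chain (n + 1) X :=
  Finsupp.linearCombination ℤ fun σ =>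
    push σ (n + 1) (affSdHomotopy n (Finsupp.single (vertices n) 1))

lemma sdHomotopy_single {n : ℕ} (σ : Simp n X) : sdHomotopy n (Finsupp.single σ 1) =
    push σ (n + 1) (affSdHomotopy n (Finsupp.single (vertices n) 1)) := by
  simp [sdHomotopy]

lemma sdHomotopy_push {N : ℕ} (F : C(stdSimplex ℝ (Fin N), X)) (n : ℕ) (c : AffChain n _) :
    sdHomotopy n (push F n c) = push F _ (affSdHomotopy n c) := by
  induction c using Finsupp.induction_linear with
  | zero => simp
  | add x y hx hy => simp only [map_add, hx, hy]
  | single v a =>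
    rw [single_eq_smul]
    simp only [map_smul]
    rw [push_single, sdHomotopy_single, ← push_affMap F (aff v) (aff_mix v), affSdHomotopy,
      affMap_coneHomotopy _ _ _ _ (aff v) (aff v) _ (fun n w => aff_mix v _ w), affMap_single,
      aff_comp_vertices]
    · rfl
    · intro n c
      simp only [LinearMap.sub_apply, LinearMap.id_apply, map_sub]
      rw [affMap_affSd bary bary (aff v) (fun n w => aff_mix v _ w)]

lemma bd_sdHomotopy (n : ℕ) (c : Chain (n + 1) X) :
    bd (n + 1) (sdHomotopy (n + 1) c) + sdHomotopy n (bd n c) = c - sd (n + 1) c := by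
  induction c using Finsupp.induction_linear with
  | zero => simp
  | add x y hx hy => simp only [map_add] at *; rw [add_sub_add_comm, ← hx, ← hy]; abel
  | single σ a =>
    rw [single_eq_smul]
    simp only [map_smul, ← smul_add, ← smul_sub]
    congr 1
    rw [sdHomotopy_single, bd_push, bd_single_eq_push, sdHomotopy_push, ← map_add, affSdHomotopy,
      affBd_coneHomotopy, sd_single, LinearMap.sub_apply, map_sub, LinearMap.id_apply, push_vertices]
    · ext1 v
      simp [affSd]
    · intro n c
      simp only [LinearMap.sub_apply, LinearMap.id_apply, map_sub, affBd_affSd]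

lemma sdHomotopy_chainMap (f : C(X, Y)) (n : ℕ) (c : Chain n X) :
    sdHomotopy n (chainMap f n c) = chainMap f _ (sdHomotopy n c) := by
  induction c using Finsupp.induction_linear with
  | zero => simp
  | add x y hx hy => simp only [map_add, hx, hy]
  | single σ a =>
    rw [single_eq_smul]
    simp only [map_smul]
    rw [chainMap_single, sdHomotopy_single, sdHomotopy_single, chainMap_push]

/-! ### The prism operator -/

/-- The affine chain homotopy between the bottom and the top of a prism. -/
def affPrism {N : ℕ} : ∀ n, AffChain n (stdSimplex ℝ (Fin N)) →ₗ[ℤ]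
    AffChain (n + 1) (stdSimplex ℝ (Fin N) × unitInterval) :=
  coneHomotopy (fun n => affMap (fun x => (x, 1)) n - affMap (fun x => (x, 0)) n)
    fun _ v => (v 0, 0)

/-- The chain homotopy induced by a homotopy. -/
def prism (H : C(X × unitInterval, Y)) (n : ℕ) : Chain n X →ₗ[ℤ] Chain (n + 1) Y :=
  Finsupp.linearCombination ℤ fun σ =>
    push (H.comp (σ.prodMap (ContinuousMap.id _))) (n + 1)
      (affPrism n (Finsupp.single (vertices n) 1))

lemma prism_single (H : C(X × unitInterval, Y)) {n : ℕ} (σ : Simp n X) :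
    prism H n (Finsupp.single σ 1) = push (H.comp (σ.prodMap (ContinuousMap.id _))) (n + 1)
      (affPrism n (Finsupp.single (vertices n) 1)) := by
  simp [prism]

lemma prism_push {N : ℕ} (H : C(X × unitInterval, Y)) (F : C(stdSimplex ℝ (Fin N), X)) (n : ℕ)
    (c : AffChain n _) : prism H n (push F n c) =
      push (H.comp (F.prodMap (ContinuousMap.id _))) _ (affPrism n c) := by
  induction c using Finsupp.induction_linear with
  | zero => simp
  | add x y hx hy => simp only [map_add, hx, hy]
  | single v a =>
    rw [single_eq_smul]
    simp only [map_smul]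
    have h : H.comp ((F.comp (aff v)).prodMap (ContinuousMap.id unitInterval)) =
        (H.comp (F.prodMap (ContinuousMap.id _))).comp ((aff v).prodMap (ContinuousMap.id _)) := rfl
    rw [push_single, prism_single, h, ← push_affMap, affPrism,
      affMap_coneHomotopy _ _ _ _ (aff v) ((aff v).prodMap (ContinuousMap.id _)),
      affMap_single, aff_comp_vertices]
    · rfl
    · intro n c
      simp only [LinearMap.sub_apply, map_sub, affMap_affMap]
      rfl
    · intro n w
      rfl
    · intro m t w
      exact Prod.ext (aff_mix v t _) rfl

lemma push_affMap_mk {N n : ℕ} (H : C(X × unitInterval, Y)) (F : C(stdSimplex ℝ (Fin N), X))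
    (s : unitInterval) (c : AffChain n (stdSimplex ℝ (Fin N))) :
    push (H.comp (F.prodMap (ContinuousMap.id _))) n (affMap (fun x => (x, s)) n c) =
      chainMap (H.comp ((ContinuousMap.id X).prodMk (ContinuousMap.const X s))) n (push F n c) := by
  rw [chainMap_push]
  refine (push_affMap _ ((ContinuousMap.id _).prodMk (ContinuousMap.const _ s)) ?_ n c).trans rfl
  intro m t v
  refine Prod.ext rfl (Subtype.ext ?_)
  change (s : ℝ) = ∑ i, t i • (s : ℝ)
  rw [← Finset.sum_smul, stdSimplex.sum_eq_one, one_smul]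

lemma bd_prism (H : C(X × unitInterval, Y)) (n : ℕ) (c : Chain (n + 1) X) :
    bd (n + 1) (prism H (n + 1) c) + prism H n (bd n c) =
      chainMap (H.comp ((ContinuousMap.id X).prodMk (ContinuousMap.const X 1))) _ c -
      chainMap (H.comp ((ContinuousMap.id X).prodMk (ContinuousMap.const X 0))) _ c := by
  induction c using Finsupp.induction_linear with
  | zero => simp
  | add x y hx hy => simp only [map_add] at *; rw [add_sub_add_comm, ← hx, ← hy]; abel
  | single σ a =>
    rw [single_eq_smul]
    simp only [map_smul, ← smul_add, ← smul_sub]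
    congr 1
    rw [prism_single, bd_push, bd_single_eq_push, prism_push, ← map_add, affPrism,
      affBd_coneHomotopy, LinearMap.sub_apply, map_sub, push_affMap_mk, push_affMap_mk,
      push_vertices]
    -- There is only one empty tuple, so top and bottom of the prism coincide on tuples of length
    -- zero.
    · rw [sub_eq_zero]
      unfold affMap
      congr 1
      funext v
      exact Subsingleton.elim _ _
    · intro n c
      simp only [LinearMap.sub_apply, map_sub, affBd_affMap]

lemma prism_natural {X' Y' : Type*} [TopologicalSpace X'] [TopologicalSpace Y']
    (H : C(X × unitInterval, Y)) (H' : C(X' × unitInterval, Y')) (f : C(X, X')) (g : C(Y, Y'))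
    (h : ∀ x t, H' (f x, t) = g (H (x, t))) (n : ℕ) (c : Chain n X) :
    prism H' n (chainMap f n c) = chainMap g _ (prism H n c) := by
  induction c using Finsupp.induction_linear with
  | zero => simp
  | add x y hx hy => simp only [map_add, hx, hy]
  | single σ a =>
    rw [single_eq_smul]
    simp only [map_smul]
    rw [chainMap_single, prism_single, prism_single, chainMap_push]
    congr 3
    ext1 x
    exact h _ _

end SingularChains

end

/-! ### Supports of chains and small simplices. -/

noncomputable section

namespace SingularChains

variable {X Y Z : Type*} [TopologicalSpace X] [TopologicalSpace Y] [TopologicalSpace Z]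

/-! ### Chains in a subset -/

/-- Reduction to generators. With `p = ⊥` and a difference of two maps as `L`, it also proves
equalities on chains with restricted support. -/
lemma map_mem_of_mem_supported {α M : Type*} [AddCommGroup M] {S : Set α} (L : (α →₀ ℤ) →ₗ[ℤ] M)
    {p : Submodule ℤ M} (h : ∀ a ∈ S, L (Finsupp.single a 1) ∈ p) {c : α →₀ ℤ}
    (hc : c ∈ Finsupp.supported ℤ ℤ S) : L c ∈ p := by
  rw [Finsupp.supported_eq_span_single] at hc
  have h2 : Submodule.span ℤ ((fun i => Finsupp.single i (1 : ℤ)) '' S) ≤ p.comap L := by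
    rw [Submodule.span_le]
    rintro _ ⟨a, ha, rfl⟩
    exact h a ha
  exact h2 hc

/-- The submodule of the chains all of whose simplices lie in `A`. -/
def chainsIn (A : Set X) (n : ℕ) : Submodule ℤ (Chain n X) :=
  Finsupp.supported ℤ ℤ {σ | ∀ t, σ t ∈ A}

lemma single_mem_chainsIn {A : Set X} {n : ℕ} {σ : Simp n X} (h : ∀ t, σ t ∈ A) (a : ℤ) :
    Finsupp.single σ a ∈ chainsIn A n :=
  Finsupp.single_mem_supported ℤ a h

lemma chainsIn_mono {A B : Set X} (h : A ⊆ B) (n : ℕ) : chainsIn A n ≤ chainsIn B n :=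
  Finsupp.supported_mono fun _ hσ t => h (hσ t)

lemma mem_chainsIn_univ {n : ℕ} (c : Chain n X) : c ∈ chainsIn Set.univ n := by
  simp [chainsIn]

lemma chainsIn_inter (A B : Set X) (n : ℕ) : chainsIn (A ∩ B) n = chainsIn A n ⊓ chainsIn B n := by
  rw [chainsIn, chainsIn, chainsIn, ← Finsupp.supported_inter]
  congr 1
  ext σ
  simp [forall_and]

lemma push_mem_chainsIn {K : Type*} [TopologicalSpace K] [Mixable K] {F : C(K, X)} {A : Set X}
    (h : ∀ x, F x ∈ A) (n : ℕ) (c : AffChain n K) : push F n c ∈ chainsIn A n :=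
  map_mem_of_mem_supported (S := Set.univ) (push F n)
    (fun v _ => by rw [push_single]; exact single_mem_chainsIn (fun t => h _) _) (by simp)

lemma bd_mem_chainsIn {A : Set X} {n : ℕ} {c : Chain (n + 1) X} (hc : c ∈ chainsIn A _) :
    bd n c ∈ chainsIn A n :=
  map_mem_of_mem_supported (bd n)
    (fun σ hσ => by rw [bd_single_eq_push]; exact push_mem_chainsIn hσ _ _) hc

lemma sd_mem_chainsIn {A : Set X} {n : ℕ} {c : Chain n X} (hc : c ∈ chainsIn A _) :
    sd n c ∈ chainsIn A n :=
  map_mem_of_mem_supported (sd n)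
    (fun σ hσ => by rw [sd_single]; exact push_mem_chainsIn hσ _ _) hc

lemma sdHomotopy_mem_chainsIn {A : Set X} {n : ℕ} {c : Chain n X} (hc : c ∈ chainsIn A _) :
    sdHomotopy n c ∈ chainsIn A (n + 1) :=
  map_mem_of_mem_supported (sdHomotopy n)
    (fun σ hσ => by rw [sdHomotopy_single]; exact push_mem_chainsIn hσ _ _) hc

lemma chainMap_mem_chainsIn {A : Set X} {B : Set Y} {f : C(X, Y)} (hf : Set.MapsTo f A B) {n : ℕ}
    {c : Chain n X} (hc : c ∈ chainsIn A n) : chainMap f n c ∈ chainsIn B n :=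
  map_mem_of_mem_supported (chainMap f n)
    (fun σ hσ => by rw [chainMap_single]; exact single_mem_chainsIn (fun t => hf (hσ t)) _) hc

/-! ### Small simplices -/

section Small

variable {N : ℕ}

/-- The first property, that subdivision stays inside every ball containing the original vertices,
is what bounds the distance from the new barycenter to the vertices of the subdivided faces. The
ratio involves a fixed `M` instead of `n` so that the bound for faces can be reused unchanged in the
induction. -/
lemma affSd_single_mem_supported (M : ℕ) : ∀ (n : ℕ), n ≤ M + 1 →
    ∀ (v : Fin n → stdSimplex ℝ (Fin N)), affSd bary n (Finsupp.single v 1) ∈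
      Finsupp.supported ℤ ℤ {w : Fin n → stdSimplex ℝ (Fin N) |
        (∀ x s, (∀ i, dist x (v i) ≤ s) → ∀ j, dist x (w j) ≤ s) ∧
        ∀ d, 0 ≤ d → (∀ i j, dist (v i) (v j) ≤ d) →
          ∀ i j, dist (w i) (w j) ≤ M / (M + 1) * d} := by
  intro n
  induction n with
  | zero =>
    intro _ v
    refine Finsupp.single_mem_supported ℤ _ ⟨fun x s h => h, fun d _ _ i => i.elim0⟩
  | succ n ih =>
    intro hn v
    rw [affSd_succ_single]
    -- All barycentric weights are `1 / (n + 1)` and the summand of the vertex `v l` itself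
    -- vanishes, which leaves `n / (n + 1) * d`.
    have hb : ∀ l d, 0 ≤ d → (∀ i j, dist (v i) (v j) ≤ d) →
        dist (bary n v) (v l) ≤ M / (M + 1) * d := by
      intro l d hd h
      rw [dist_comm]
      refine (dist_mix_le _ _ _).trans ?_
      have h1 : ∀ i, (stdSimplex.barycenter : stdSimplex ℝ (Fin (n + 1))) i * dist (v l) (v i) ≤
          if i = l then 0 else (n + 1 : ℝ)⁻¹ * d := by
        intro i
        split_ifs with hi
        · simp [hi]
        · rw [show (stdSimplex.barycenter : stdSimplex ℝ (Fin (n + 1))) i = (n + 1 : ℝ)⁻¹ from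
            (stdSimplex.barycenter_apply i).trans (by simp)]
          exact mul_le_mul_of_nonneg_left (h _ _) (by positivity)
      refine (Finset.sum_le_sum fun i _ => h1 i).trans ?_
      rw [Finset.sum_ite, Finset.sum_const_zero, zero_add, Finset.sum_const, Finset.filter_ne',
        Finset.card_erase_of_mem (Finset.mem_univ _), Finset.card_univ, Fintype.card_fin,
        Nat.add_sub_cancel, nsmul_eq_mul, ← mul_assoc]
      refine mul_le_mul_of_nonneg_right ?_ hd
      have h3 : (n : ℝ) ≤ M := by exact_mod_cast Nat.le_of_succ_le_succ hn
      rw [← div_eq_mul_inv, div_le_div_iff₀ (by positivity) (by positivity)]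
      nlinarith
    have hb' : ∀ x s, (∀ i, dist x (v i) ≤ s) → dist x (bary n v) ≤ s := by
      intro x s h
      refine (dist_mix_le _ _ _).trans ?_
      refine (Finset.sum_le_sum fun i _ =>
        mul_le_mul_of_nonneg_left (h i) (stdSimplex.zero_le _ i)).trans ?_
      rw [← Finset.sum_mul, stdSimplex.sum_eq_one, one_mul]
    set T : Set (Fin n → stdSimplex ℝ (Fin N)) := {w |
        (∀ x s, (∀ i, dist x (v i) ≤ s) → ∀ j, dist x (w j) ≤ s) ∧
        ∀ d, 0 ≤ d → (∀ i j, dist (v i) (v j) ≤ d) →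
          ∀ i j, dist (w i) (w j) ≤ M / (M + 1) * d}
    have h1 : affSd bary n (affBd n (Finsupp.single v 1)) ∈ Finsupp.supported ℤ ℤ T := by
      rw [affBd_single]
      simp only [map_smul, map_sum]
      refine Submodule.smul_mem _ _ (Submodule.sum_mem _ fun i _ => Submodule.smul_mem _ _ ?_)
      refine Finsupp.supported_mono ?_ (ih (by omega) (v ∘ i.succAbove))
      rintro w ⟨hw1, hw2⟩
      exact ⟨fun x s h => hw1 x s fun j => h _, fun d hd h => hw2 d hd fun i j => h _ _⟩
    refine map_mem_of_mem_supported (cone (bary n v) n) ?_ h1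
    rintro w ⟨hw1, hw2⟩
    rw [cone_single]
    refine Finsupp.single_mem_supported ℤ _ ⟨fun x s h j => ?_, fun d hd h i j => ?_⟩
    · refine Fin.cases ?_ (fun j => ?_) j
      · exact hb' x s h
      · exact hw1 x s h j
    · have h0 : 0 ≤ (M : ℝ) / (M + 1) * d := by positivity
      refine Fin.cases ?_ (fun i => ?_) i <;> refine Fin.cases ?_ (fun j => ?_) j
      · simpa using h0
      · exact hw1 _ _ (fun l => hb l d hd h) j
      · rw [dist_comm]
        exact hw1 _ _ (fun l => hb l d hd h) i
      · exact hw2 d hd h i j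

/-- The ratio `n / (n + 1)` for simplices with `n` vertices is not sharp. Only that it is less than
one matters. -/
lemma affSd_iterate_single_mem_supported {n : ℕ} (v : Fin n → stdSimplex ℝ (Fin N)) {d : ℝ}
    (hd : 0 ≤ d) (hv : ∀ i j, dist (v i) (v j) ≤ d) (m : ℕ) :
    (affSd bary n)^[m] (Finsupp.single v 1) ∈ Finsupp.supported ℤ ℤ
      {w : Fin n → stdSimplex ℝ (Fin N) | ∀ i j, dist (w i) (w j) ≤ ((n : ℝ) / (n + 1)) ^ m * d} := by
  induction m with
  | zero => exact Finsupp.single_mem_supported ℤ _ (by simpa using hv)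
  | succ m ih =>
    rw [Function.iterate_succ_apply']
    refine map_mem_of_mem_supported (affSd bary n) (fun w hw => ?_) ih
    refine Finsupp.supported_mono ?_ (affSd_single_mem_supported n n (by omega) w)
    rintro z ⟨-, hz⟩ i j
    rw [pow_succ', mul_assoc]
    exact hz _ (by positivity) hw i j

lemma sd_iterate_push (F : C(stdSimplex ℝ (Fin N), X)) (n m : ℕ) (c : AffChain n _) :
    (sd n)^[m] (push F n c) = push F n ((affSd bary n)^[m] c) := by
  induction m with
  | zero => rfl
  | succ m ih => rw [Function.iterate_succ_apply', ih, sd_push, Function.iterate_succ_apply']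

/-- Chains that are sums of a chain in `A` and a chain in `B`. -/
def smallChains (A B : Set X) (n : ℕ) : Submodule ℤ (Chain n X) :=
  Finsupp.supported ℤ ℤ ({σ | ∀ t, σ t ∈ A} ∪ {σ | ∀ t, σ t ∈ B})

lemma sd_iterate_single_mem_smallChains {n : ℕ} (σ : Simp n X) {A B : Set X} (hA : IsOpen A)
    (hB : IsOpen B) (hσ : ∀ t, σ t ∈ A ∪ B) :
    ∀ᶠ m in Filter.atTop, (sd n)^[m] (Finsupp.single σ 1) ∈ smallChains A B n := by
  -- A Lebesgue number of the cover of the standard simplex by the preimages of `A` and `B`. Once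
  -- all edges of the subdivision are shorter than `δ`, each small simplex lies in the ball about
  -- its first vertex.
  obtain ⟨δ, hδ, hball⟩ := lebesgue_number_lemma_of_metric (s := (Set.univ : Set (stdSimplex ℝ (Fin n))))
    (c := fun b : Bool => σ ⁻¹' (if b then A else B)) isCompact_univ
    (fun b => by
      cases b
      · exact hB.preimage σ.continuous
      · exact hA.preimage σ.continuous)
    (fun t _ => by
      rcases hσ t with h | h
      · exact Set.mem_iUnion.2 ⟨true, h⟩
      · exact Set.mem_iUnion.2 ⟨false, h⟩)
  obtain ⟨d, hd0, hd⟩ : ∃ d : ℝ, 0 ≤ d ∧ ∀ i j, dist (vertices n i) (vertices n j) ≤ d := by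
    refine ⟨Metric.diam (Set.univ : Set (stdSimplex ℝ (Fin n))), Metric.diam_nonneg, fun i j => ?_⟩
    exact Metric.dist_le_diam_of_mem isCompact_univ.isBounded (Set.mem_univ _) (Set.mem_univ _)
  have hlim : Filter.Tendsto (fun m : ℕ => ((n : ℝ) / (n + 1)) ^ m * d) Filter.atTop (nhds (0 * d)) := by
    refine (tendsto_pow_atTop_nhds_zero_of_lt_one (by positivity) ?_).mul_const d
    rw [div_lt_one (by positivity)]
    linarith
  rw [zero_mul] at hlim
  filter_upwards [hlim.eventually (gt_mem_nhds hδ)] with m hm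
  rw [← push_vertices, sd_iterate_push]
  refine map_mem_of_mem_supported (push σ n) (fun w hw => ?_)
    (affSd_iterate_single_mem_supported (vertices n) hd0 hd m)
  rw [push_single]
  refine Finsupp.single_mem_supported ℤ _ ?_
  have key : ∀ (j : Fin n) t, dist (aff w t) (w j) < δ := by
    intro j t
    refine lt_of_le_of_lt ?_ hm
    rw [dist_comm]
    refine (dist_mix_le _ _ _).trans ?_
    refine (Finset.sum_le_sum fun i _ =>
      mul_le_mul_of_nonneg_left (hw j i) (stdSimplex.zero_le _ i)).trans ?_
    rw [← Finset.sum_mul, stdSimplex.sum_eq_one, one_mul]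
  -- The empty simplex has no first vertex, but it lies in every set.
  rcases n with _ | n
  · left
    intro t
    exact absurd t.2 (by simp [stdSimplex])
  · obtain ⟨b, hb⟩ := hball (w 0) (Set.mem_univ _)
    cases b
    · right
      exact fun t => hb (key 0 t)
    · left
      exact fun t => hb (key 0 t)

lemma iterate_map_add {M : Type*} [AddCommGroup M] (L : M →ₗ[ℤ] M) (m : ℕ) (x y : M) :
    L^[m] (x + y) = L^[m] x + L^[m] y := by
  simp only [← Module.End.pow_apply, map_add]

lemma iterate_map_smul {M : Type*} [AddCommGroup M] (L : M →ₗ[ℤ] M) (m : ℕ) (a : ℤ) (x : M) :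
    L^[m] (a • x) = a • L^[m] x := by
  simp only [← Module.End.pow_apply, map_smul]

/-- Subdivision does not leave `Y`, so for a subset that need not be open the relatively open pieces
`Y ∩ A` and `Y ∩ B` suffice. Stating the result for all large `m` allows one `m` to serve several
chains. -/
lemma sd_iterate_mem_smallChains {n : ℕ} {Y A B : Set X} (hA : IsOpen A)
    (hB : IsOpen B) (hY : Y ⊆ A ∪ B) {c : Chain n X} (hc : c ∈ chainsIn Y n) :
    ∀ᶠ m in Filter.atTop, (sd n)^[m] c ∈ smallChains (Y ∩ A) (Y ∩ B) n := by
  have h1 : ∀ᶠ m in Filter.atTop, (sd n)^[m] c ∈ smallChains A B n := by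
    rw [chainsIn, Finsupp.supported_eq_span_single] at hc
    induction hc using Submodule.span_induction with
    | mem x hx =>
      obtain ⟨σ, hσ, rfl⟩ := hx
      exact sd_iterate_single_mem_smallChains σ hA hB fun t => hY (hσ t)
    | zero =>
      refine Filter.Eventually.of_forall fun m => ?_
      rw [← Module.End.pow_apply, map_zero]
      exact Submodule.zero_mem _
    | add x y _ _ hx hy =>
      filter_upwards [hx, hy] with m h1 h2
      rw [iterate_map_add]
      exact Submodule.add_mem _ h1 h2
    | smul a x _ hx =>
      filter_upwards [hx] with m h1
      rw [iterate_map_smul]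
      exact Submodule.smul_mem _ _ h1
  filter_upwards [h1] with m hm
  have h2 : (sd n)^[m] c ∈ chainsIn Y n := by
    clear hm h1
    induction m with
    | zero => exact hc
    | succ m ih => rw [Function.iterate_succ_apply']; exact sd_mem_chainsIn ih
  have h3 : (sd n)^[m] c ∈ smallChains A B n ⊓ chainsIn Y n := ⟨hm, h2⟩
  rw [smallChains, chainsIn, ← Finsupp.supported_inter] at h3
  refine Finsupp.supported_mono ?_ h3
  rintro σ ⟨hσ | hσ, hσ'⟩
  · exact Or.inl fun t => ⟨hσ' t, hσ t⟩
  · exact Or.inr fun t => ⟨hσ' t, hσ t⟩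

end Small

end SingularChains

end

/-! ### Homology of invariant chains: Mayer-Vietoris and homotopy invariance. -/

noncomputable section

namespace SingularChains

variable {X Y Z : Type*} [TopologicalSpace X] [TopologicalSpace Y] [TopologicalSpace Z]

/-! ### Invariant cycles and boundaries -/

/-- Cycles of the augmented singular chain complex. -/
def IsCycle : ∀ {n : ℕ}, Chain n X → Prop
  | 0, _ => True
  | n + 1, c => bd n c = 0

lemma isCycle_bd {n : ℕ} (c : Chain (n + 1) X) : IsCycle (bd n c) := by
  cases n with
  | zero => trivial
  | succ n => exact bd_bd n c

/-- The `r`-invariant chains in `A`. -/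
def invIn (r : C(X, X)) (A : Set X) (n : ℕ) : Submodule ℤ (Chain n X) :=
  chainsIn A n ⊓ LinearMap.eqLocus (chainMap r n) LinearMap.id

lemma mem_invIn {r : C(X, X)} {A : Set X} {n : ℕ} {c : Chain n X} :
    c ∈ invIn r A n ↔ c ∈ chainsIn A n ∧ chainMap r n c = c := Iff.rfl

lemma invIn_mono (r : C(X, X)) {A B : Set X} (h : A ⊆ B) (n : ℕ) : invIn r A n ≤ invIn r B n :=
  inf_le_inf_right _ (chainsIn_mono h n)

lemma bd_mem_invIn {r : C(X, X)} {A : Set X} {n : ℕ} {c : Chain (n + 1) X}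
    (hc : c ∈ invIn r A (n + 1)) : bd n c ∈ invIn r A n :=
  mem_invIn.2 ⟨bd_mem_chainsIn hc.1, by
    rw [← bd_chainMap, (mem_invIn.1 hc).2]⟩

lemma sd_mem_invIn {r : C(X, X)} {A : Set X} {n : ℕ} {c : Chain n X}
    (hc : c ∈ invIn r A n) : sd n c ∈ invIn r A n :=
  mem_invIn.2 ⟨sd_mem_chainsIn hc.1, by
    rw [← sd_chainMap, (mem_invIn.1 hc).2]⟩

lemma sdHomotopy_mem_invIn {r : C(X, X)} {A : Set X} {n : ℕ} {c : Chain n X}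
    (hc : c ∈ invIn r A n) : sdHomotopy n c ∈ invIn r A (n + 1) :=
  mem_invIn.2 ⟨sdHomotopy_mem_chainsIn hc.1, by
    rw [← sdHomotopy_chainMap, (mem_invIn.1 hc).2]⟩

lemma sd_iterate_mem_invIn {r : C(X, X)} {A : Set X} {n : ℕ} {c : Chain n X}
    (hc : c ∈ invIn r A n) (m : ℕ) : (sd n)^[m] c ∈ invIn r A n := by
  induction m with
  | zero => exact hc
  | succ m ih => rw [Function.iterate_succ_apply']; exact sd_mem_invIn ih

lemma bd_sd_iterate (n m : ℕ) (c : Chain (n + 1) X) :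
    bd n ((sd (n + 1))^[m] c) = (sd n)^[m] (bd n c) := by
  induction m with
  | zero => rfl
  | succ m ih => rw [Function.iterate_succ_apply', bd_sd, ih, Function.iterate_succ_apply']

/-- The homotopies of the successive subdivisions telescope. They remain invariant because
`sdHomotopy` is natural. -/
lemma exists_bd_eq_sub_sd_iterate {r : C(X, X)} {A : Set X} {n : ℕ} {c : Chain (n + 1) X}
    (hc : c ∈ invIn r A (n + 1)) (hcyc : bd n c = 0) (m : ℕ) :
    ∃ e ∈ invIn r A (n + 2), bd (n + 1) e = c - (sd (n + 1))^[m] c := by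
  induction m with
  | zero => exact ⟨0, Submodule.zero_mem _, by simp⟩
  | succ m ih =>
    obtain ⟨e, he, hbe⟩ := ih
    refine ⟨e + sdHomotopy (n + 1) ((sd (n + 1))^[m] c),
      Submodule.add_mem _ he (sdHomotopy_mem_invIn (sd_iterate_mem_invIn hc m)), ?_⟩
    have h := bd_sdHomotopy n ((sd (n + 1))^[m] c)
    rw [bd_sd_iterate, hcyc, ← Module.End.pow_apply (sd n), map_zero, map_zero, add_zero] at h
    rw [map_add, hbe, h, Function.iterate_succ_apply']
    abel

/-- Every `r`-invariant cycle `c` in `A` on simplices with `n` vertices such that `q • c` is the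
boundary of an invariant chain in `A` is itself the boundary of an invariant chain in `A`. -/
def BoundsInv (r : C(X, X)) (q : ℤ) (A : Set X) (n : ℕ) : Prop :=
  ∀ c ∈ invIn r A n, IsCycle c → (∃ e ∈ invIn r A (n + 1), bd n e = q • c) →
    ∃ e ∈ invIn r A (n + 1), bd n e = c

lemma BoundsInv.exists_bd {r : C(X, X)} {A : Set X} {n : ℕ} (h : BoundsInv r 0 A n)
    {c : Chain n X} (hc : c ∈ invIn r A n) (hcyc : IsCycle c) :
    ∃ e ∈ invIn r A (n + 1), bd n e = c :=
  h c hc hcyc ⟨0, Submodule.zero_mem _, by simp⟩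

lemma BoundsInv.of_zero {r : C(X, X)} {A : Set X} {n : ℕ} (h : BoundsInv r 0 A n) (q : ℤ) :
    BoundsInv r q A n := fun _ hc hcyc _ => h.exists_bd hc hcyc

/-- The part of `c` on simplices inside `A` is invariant because `A` is, and hence so is the rest,
which lies in `B`. Invariance of one of the two sets is enough. -/
lemma exists_add_eq_of_mem_smallChains {r : C(X, X)} {A B Y : Set X} (hA : r ⁻¹' A = A) {n : ℕ}
    {c : Chain n X} (hc : c ∈ invIn r Y n) (hsmall : c ∈ smallChains A B n) :
    ∃ u ∈ invIn r A n, ∃ v ∈ invIn r B n, u + v = c := by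
  classical
  let P : Simp n X → Prop := fun σ => ∀ t, σ t ∈ A
  have hP : ∀ σ, P (r.comp σ) ↔ P σ := fun σ => forall_congr' fun t => by
    conv_rhs => rw [← hA]
    rfl
  have hfilter : ∀ c : Chain n X, chainMap r n (c.filter P) = (chainMap r n c).filter P := by
    intro c
    induction c using Finsupp.induction_linear with
    | zero => rw [Finsupp.filter_zero, map_zero, Finsupp.filter_zero]
    | add x y hx hy => rw [Finsupp.filter_add, map_add, map_add, Finsupp.filter_add, hx, hy]
    | single σ a =>
      by_cases h : P σ
      · rw [Finsupp.filter_single_of_pos _ h, chainMap_single,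
          Finsupp.filter_single_of_pos _ ((hP σ).2 h)]
      · rw [Finsupp.filter_single_of_neg _ h, chainMap_single,
          Finsupp.filter_single_of_neg _ (mt (hP σ).1 h), map_zero]
  have h1 : chainMap r n (c.filter P) = c.filter P := by rw [hfilter, (mem_invIn.1 hc).2]
  refine ⟨c.filter P, ⟨?_, h1⟩, c.filter fun σ => ¬ P σ,
    mem_invIn.2 ⟨?_, ?_⟩, Finsupp.filter_add_filter_not _ _⟩
  · change _ ∈ Finsupp.supported ℤ ℤ _
    rw [Finsupp.mem_supported, Finsupp.support_filter]
    intro σ hσ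
    exact (Finset.mem_filter.1 hσ).2
  · change _ ∈ Finsupp.supported ℤ ℤ _
    rw [Finsupp.mem_supported, Finsupp.support_filter]
    intro σ hσ
    obtain ⟨h2, h3⟩ := Finset.mem_filter.1 hσ
    exact (((Finsupp.mem_supported ℤ c).1 hsmall) h2).resolve_left h3
  · have h4 : (c.filter fun σ => ¬ P σ) = c - c.filter P := by
      rw [eq_sub_iff_add_eq, add_comm, Finsupp.filter_add_filter_not]
    rw [h4, map_sub, h1, (mem_invIn.1 hc).2]

/-- A Mayer-Vietoris argument for a relatively open cover. -/
lemma BoundsInv.mayerVietoris {r : C(X, X)} {q : ℤ} {S A B : Set X} {n : ℕ} (hA : IsOpen A)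
    (hB : IsOpen B) (hS : S ⊆ A ∪ B) (hrA : r ⁻¹' (S ∩ A) = S ∩ A)
    (hbA : BoundsInv r 0 (S ∩ A) (n + 1)) (hbB : BoundsInv r 0 (S ∩ B) (n + 1))
    (hbAB : BoundsInv r q ((S ∩ A) ∩ (S ∩ B)) n) : BoundsInv r q S (n + 1) := by
  rintro c hc hcyc ⟨e, he, hbe⟩
  -- The cycle and the chain bounding its `q`-fold must be subdivided equally often for their
  -- relation to persist.
  obtain ⟨m, hm1, hm2⟩ := ((sd_iterate_mem_smallChains hA hB hS hc.1).and
    (sd_iterate_mem_smallChains hA hB hS he.1)).exists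
  obtain ⟨u, hu, v, hv, huv⟩ :=
    exists_add_eq_of_mem_smallChains hrA (sd_iterate_mem_invIn hc m) hm1
  obtain ⟨e1, he1, e2, he2, he12⟩ :=
    exists_add_eq_of_mem_smallChains hrA (sd_iterate_mem_invIn he m) hm2
  obtain ⟨d, hd, hbd⟩ := exists_bd_eq_sub_sd_iterate hc hcyc m
  have hinter : ∀ {k : ℕ} {x : Chain k X}, x ∈ invIn r (S ∩ A) k → x ∈ invIn r (S ∩ B) k →
      x ∈ invIn r ((S ∩ A) ∩ (S ∩ B)) k := fun h1 h2 =>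
    ⟨by rw [chainsIn_inter]; exact ⟨h1.1, h2.1⟩, h1.2⟩
  have h0 : bd n u + bd n v = 0 := by
    rw [← map_add, huv, bd_sd_iterate, show bd n c = 0 from hcyc, ← Module.End.pow_apply, map_zero]
  have hq : bd (n + 1) e1 + bd (n + 1) e2 = q • u + q • v := by
    rw [← map_add, he12, bd_sd_iterate, hbe, ← smul_add, huv, iterate_map_smul]
  have hu' : bd n u ∈ invIn r ((S ∩ A) ∩ (S ∩ B)) n := by
    refine hinter (bd_mem_invIn hu) ?_
    rw [eq_neg_of_add_eq_zero_left h0]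
    exact Submodule.neg_mem _ (bd_mem_invIn hv)
  -- The torsion relation descends to the intersection: `q u - ∂ e1 = ∂ e2 - q v` lies in both
  -- pieces and has boundary `q ∂ u`.
  obtain ⟨w, hw, hbw⟩ := hbAB _ hu' (isCycle_bd u) ⟨q • u - bd (n + 1) e1, by
    refine hinter (Submodule.sub_mem _ (Submodule.smul_mem _ _ hu) (bd_mem_invIn he1)) ?_
    have h3 : q • u - bd (n + 1) e1 = bd (n + 1) e2 - q • v := by
      rw [sub_eq_sub_iff_add_eq_add, ← hq]; abel
    rw [h3]
    exact Submodule.sub_mem _ (bd_mem_invIn he2) (Submodule.smul_mem _ _ hv), by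
    rw [map_sub, map_smul, bd_bd, sub_zero]⟩
  have hwA : w ∈ invIn r (S ∩ A) (n + 1) := invIn_mono r Set.inter_subset_left _ hw
  have hwB : w ∈ invIn r (S ∩ B) (n + 1) := invIn_mono r Set.inter_subset_right _ hw
  -- Correcting by `w` turns the two halves into cycles `u - w` and `v + w` with unchanged sum, each
  -- of which bounds in its own piece.
  obtain ⟨f1, hf1, hbf1⟩ := hbA.exists_bd (c := u - w) (Submodule.sub_mem _ hu hwA)
    (by change bd n _ = 0; rw [map_sub, hbw, sub_self])
  obtain ⟨f2, hf2, hbf2⟩ := hbB.exists_bd (c := v + w) (Submodule.add_mem _ hv hwB)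
    (by change bd n _ = 0; rw [map_add, hbw, add_comm, h0])
  refine ⟨d + f1 + f2, Submodule.add_mem _ (Submodule.add_mem _ hd
    (invIn_mono r Set.inter_subset_left _ hf1)) (invIn_mono r Set.inter_subset_left _ hf2), ?_⟩
  rw [map_add, map_add, hbd, hbf1, hbf2, ← huv]
  abel

lemma subsingleton_simp_zero : Subsingleton (Simp 0 X) :=
  ⟨fun σ τ => ContinuousMap.ext fun t => absurd t.2 (by simp [stdSimplex])⟩

/-- The empty simplex. -/
def emptySimp (X : Type*) [TopologicalSpace X] : Simp 0 X :=
  have : IsEmpty (stdSimplex ℝ (Fin 0)) := ⟨fun t => absurd t.2 (by simp [stdSimplex])⟩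
  ⟨isEmptyElim, continuous_of_discreteTopology⟩

lemma chainMap_zero_eq (f : C(X, X)) (c : Chain 0 X) : chainMap f 0 c = c := by
  induction c using Finsupp.induction_linear with
  | zero => simp
  | add x y hx hy => simp only [map_add, hx, hy]
  | single σ a =>
    rw [chainMap_single]
    congr 1
    exact subsingleton_simp_zero.elim _ _

lemma chainMap_mem_invIn {r : C(X, X)} {s : C(Y, Y)} {f : C(X, Y)} {A : Set X} {B : Set Y}
    (hf : Set.MapsTo f A B) (hrs : f.comp r = s.comp f) {n : ℕ} {c : Chain n X}
    (hc : c ∈ invIn r A n) : chainMap f n c ∈ invIn s B n :=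
  mem_invIn.2 ⟨chainMap_mem_chainsIn hf hc.1, by
    rw [← chainMap_comp, ← hrs, chainMap_comp, (mem_invIn.1 hc).2]⟩

lemma isCycle_chainMap (f : C(X, Y)) {n : ℕ} {c : Chain n X} (h : IsCycle c) :
    IsCycle (chainMap f n c) := by
  cases n with
  | zero => trivial
  | succ n =>
    change bd n _ = 0
    rw [bd_chainMap, show bd n c = 0 from h, map_zero]

/-- Equivariant homotopy invariance. -/
lemma BoundsInv.of_homotopy {r : C(X, X)} {s : C(Y, Y)} {q : ℤ} {n : ℕ} (f : C(X, Y)) (g : C(Y, X))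
    (H : C(X × unitInterval, X)) (hf : f.comp r = s.comp f) (hg : g.comp s = r.comp g)
    (hr : ∀ x t, H (r x, t) = r (H (x, t))) (h0 : ∀ x, H (x, 0) = x) (h1 : ∀ x, H (x, 1) = g (f x))
    (h : BoundsInv s q Set.univ n) : BoundsInv r q Set.univ n := by
  rintro c hc hcyc ⟨e, he, hbe⟩
  obtain ⟨d, hd, hbd⟩ := h (chainMap f n c) (chainMap_mem_invIn (Set.mapsTo_univ _ _) hf hc)
    (isCycle_chainMap f hcyc) ⟨chainMap f _ e, chainMap_mem_invIn (Set.mapsTo_univ _ _) hf he, by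
      rw [bd_chainMap, hbe, map_smul]⟩
  have hgd : chainMap g _ d ∈ invIn r Set.univ (n + 1) :=
    chainMap_mem_invIn (Set.mapsTo_univ _ _) hg hd
  cases n with
  | zero =>
    -- Every map acts as the identity on multiples of the empty simplex, so no prism is needed.
    refine ⟨chainMap g _ d, hgd, ?_⟩
    rw [bd_chainMap, hbd, ← chainMap_comp, chainMap_zero_eq]
  | succ n =>
    refine ⟨chainMap g _ d - prism H _ c, Submodule.sub_mem _ hgd
      (mem_invIn.2 ⟨mem_chainsIn_univ _, ?_⟩), ?_⟩
    · rw [← prism_natural H H r r hr, (mem_invIn.1 hc).2]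
    · have h2 := bd_prism H n c
      rw [show bd n c = 0 from hcyc, map_zero, add_zero] at h2
      have e0 : H.comp ((ContinuousMap.id X).prodMk (ContinuousMap.const X 0)) =
          ContinuousMap.id X := ContinuousMap.ext h0
      have e1 : H.comp ((ContinuousMap.id X).prodMk (ContinuousMap.const X 1)) =
          g.comp f := ContinuousMap.ext h1
      rw [map_sub, h2, bd_chainMap, hbd, e0, e1, chainMap_comp, chainMap_id]
      abel

/-! ### Passing to subspaces -/

/-- The inclusion of a subspace. -/
def incl (A : Set X) : C(A, X) := ⟨Subtype.val, continuous_subtype_val⟩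

/-- The restriction of a self-map to an invariant subspace. -/
def restrictSelf (r : C(X, X)) {A : Set X} (h : Set.MapsTo r A A) : C(A, A) :=
  ⟨h.restrict r A A, r.continuous.restrict h⟩

lemma chainMap_incl_injective (A : Set X) (n : ℕ) : Function.Injective (chainMap (incl A) n) := by
  refine Finsupp.mapDomain_injective fun σ τ h => ?_
  ext1 t
  exact Subtype.ext (congrArg (fun f : Simp n X => f t) h)

lemma exists_chainMap_incl_eq {A : Set X} {n : ℕ} {c : Chain n X} (hc : c ∈ chainsIn A n) :
    ∃ d, chainMap (incl A) n d = c := by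
  have h := map_mem_of_mem_supported (LinearMap.id : Chain n X →ₗ[ℤ] _)
    (p := LinearMap.range (chainMap (incl A) n)) (fun σ hσ => ?_) hc
  · exact h
  · refine ⟨Finsupp.single ⟨fun t => ⟨σ t, hσ t⟩, σ.continuous.subtype_mk _⟩ 1, ?_⟩
    rw [chainMap_single]
    rfl

lemma chainMap_incl_mem_invIn {r : C(X, X)} {A : Set X} (h : Set.MapsTo r A A) {n : ℕ}
    {d : Chain n A} :
    chainMap (incl A) n d ∈ invIn r A n ↔ d ∈ invIn (restrictSelf r h) Set.univ n := by
  have h1 : chainMap r n (chainMap (incl A) n d) =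
      chainMap (incl A) n (chainMap (restrictSelf r h) n d) := by
    rw [← chainMap_comp, ← chainMap_comp]
    rfl
  rw [mem_invIn, mem_invIn, h1, (chainMap_incl_injective A n).eq_iff]
  exact and_congr_left fun _ => ⟨fun _ => mem_chainsIn_univ _, fun h2 =>
    chainMap_mem_chainsIn (fun x _ => x.2) h2⟩

lemma isCycle_chainMap_incl {A : Set X} {n : ℕ} {d : Chain n A} :
    IsCycle (chainMap (incl A) n d) ↔ IsCycle d := by
  cases n with
  | zero => exact Iff.rfl
  | succ n =>
    change bd n _ = 0 ↔ bd n _ = 0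
    rw [bd_chainMap, map_eq_zero_iff _ (chainMap_incl_injective A n)]

lemma boundsInv_restrictSelf {r : C(X, X)} {A : Set X} (h : Set.MapsTo r A A) {q : ℤ} {n : ℕ} :
    BoundsInv (restrictSelf r h) q Set.univ n ↔ BoundsInv r q A n := by
  constructor
  · rintro hb c hc hcyc ⟨e, he, hbe⟩
    obtain ⟨c, rfl⟩ := exists_chainMap_incl_eq hc.1
    obtain ⟨e, rfl⟩ := exists_chainMap_incl_eq he.1
    obtain ⟨d, hd, hbd⟩ := hb c ((chainMap_incl_mem_invIn h).1 hc) (isCycle_chainMap_incl.1 hcyc)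
      ⟨e, (chainMap_incl_mem_invIn h).1 he, chainMap_incl_injective A n (by
        rw [← bd_chainMap, hbe, map_smul])⟩
    exact ⟨_, (chainMap_incl_mem_invIn h).2 hd, by rw [bd_chainMap, hbd]⟩
  · rintro hb c hc hcyc ⟨e, he, hbe⟩
    obtain ⟨d, hd, hbd⟩ := hb _ ((chainMap_incl_mem_invIn h).2 hc) (isCycle_chainMap_incl.2 hcyc)
      ⟨_, (chainMap_incl_mem_invIn h).2 he, by rw [bd_chainMap, hbe, map_smul]⟩
    obtain ⟨d, rfl⟩ := exists_chainMap_incl_eq hd.1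
    exact ⟨d, (chainMap_incl_mem_invIn h).1 hd, chainMap_incl_injective A n (by
      rw [← bd_chainMap, hbd])⟩

/-- Equivariant homotopy invariance for subsets. -/
lemma BoundsInv.of_homotopyOn {r : C(X, X)} {s : C(Y, Y)} {A : Set X} {B : Set Y}
    (hA : Set.MapsTo r A A) (hB : Set.MapsTo s B B) {q : ℤ} {n : ℕ}
    (f : C(A, B)) (g : C(B, A)) (H : C(A × unitInterval, A))
    (hf : ∀ x : A, (f ⟨r x, hA x.2⟩ : Y) = s (f x)) (hg : ∀ y : B, (g ⟨s y, hB y.2⟩ : X) = r (g y))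
    (hr : ∀ (x : A) t, (H (⟨r x, hA x.2⟩, t) : X) = r (H (x, t)))
    (h0 : ∀ x, H (x, 0) = x) (h1 : ∀ x, H (x, 1) = g (f x)) (h : BoundsInv s q B n) :
    BoundsInv r q A n := by
  rw [← boundsInv_restrictSelf hA]
  rw [← boundsInv_restrictSelf hB] at h
  refine h.of_homotopy f g H ?_ ?_ (fun x t => ?_) h0 h1
  · ext1 x
    exact Subtype.ext (hf x)
  · ext1 x
    exact Subtype.ext (hg x)
  · exact Subtype.ext (hr x t)

end SingularChains

end

/-! ### Reduced homology of discrete sets, star-shaped sets and spheres. -/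

noncomputable section

namespace SingularChains

variable {X Y Z : Type*} [TopologicalSpace X] [TopologicalSpace Y] [TopologicalSpace Z]

/-! ### Constant simplices -/

/-- The linear map replacing simplices by constant simplices at their first vertex. -/
def constMap (n m : ℕ) : Chain (n + 1) X →ₗ[ℤ] Chain m X :=
  Finsupp.lmapDomain ℤ ℤ fun σ => ContinuousMap.const _ (σ (stdSimplex.vertex 0))

@[simp] lemma constMap_single {n : ℕ} (m : ℕ) (σ : Simp (n + 1) X) (a : ℤ) :
    constMap n m (Finsupp.single σ a) =
      Finsupp.single (ContinuousMap.const _ (σ (stdSimplex.vertex 0))) a := by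
  simp [constMap]

/-- All simplices in `A` are constant. -/
def AllConst (A : Set X) : Prop :=
  ∀ (n : ℕ) (σ : Simp n X), (∀ t, σ t ∈ A) → ∀ s t, σ s = σ t

lemma AllConst.eq_const {A : Set X} (h : AllConst A) {n : ℕ} {σ : Simp (n + 1) X}
    (hσ : ∀ t, σ t ∈ A) : σ = ContinuousMap.const _ (σ (stdSimplex.vertex 0)) := by
  ext1 t
  exact h _ σ hσ t _

lemma constMap_self {A : Set X} (h : AllConst A) {n : ℕ} {c : Chain (n + 1) X}
    (hc : c ∈ chainsIn A (n + 1)) : constMap n (n + 1) c = c := by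
  have := map_mem_of_mem_supported (constMap n (n + 1) - LinearMap.id) (p := ⊥) (fun σ hσ => ?_) hc
  · exact sub_eq_zero.1 this
  · rw [LinearMap.sub_apply, LinearMap.id_apply, constMap_single, ← h.eq_const hσ, sub_self]
    exact Submodule.zero_mem _

lemma constMap_constMap (n m l : ℕ) (c : Chain (n + 1) X) :
    constMap m l (constMap n (m + 1) c) = constMap n l c := by
  induction c using Finsupp.induction_linear with
  | zero => simp
  | add x y hx hy => simp only [map_add, hx, hy]
  | single σ a => simp

/-- The `n + 1` faces of a constant simplex coincide and carry alternating signs, so they cancel or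
leave a single one. -/
lemma bd_eq_of_allConst {A : Set X} (h : AllConst A) {n : ℕ} {c : Chain (n + 1) X}
    (hc : c ∈ chainsIn A (n + 1)) : bd n c = if Even n then constMap n n c else 0 := by
  have := map_mem_of_mem_supported
    (bd n - if Even n then constMap n n else 0) (p := ⊥) (fun σ hσ => ?_) hc
  · rw [Submodule.mem_bot, LinearMap.sub_apply, sub_eq_zero] at this
    rw [this]
    split_ifs <;> rfl
  · have h1 : ∀ i : Fin (n + 1), σ.comp (faceMap i) =
        ContinuousMap.const _ (σ (stdSimplex.vertex 0)) := fun i => by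
      ext1 t
      exact h _ σ hσ _ _
    have h2 := neg_one_geom_sum (R := ℤ) (n := n + 1)
    rw [Finset.sum_range] at h2
    rw [LinearMap.sub_apply, bd_single]
    simp only [h1, ← Finset.sum_smul, h2, Nat.even_add_one]
    by_cases hn : Even n
    · simp [hn]
    · simp [hn]

lemma chainMap_constMap (f : C(X, Y)) (n m : ℕ) (c : Chain (n + 1) X) :
    chainMap f m (constMap n m c) = constMap n m (chainMap f _ c) := by
  induction c using Finsupp.induction_linear with
  | zero => simp
  | add x y hx hy => simp only [map_add, hx, hy]
  | single σ a => simp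

lemma constMap_mem_chainsIn {A : Set X} {n : ℕ} (m : ℕ) {c : Chain (n + 1) X}
    (hc : c ∈ chainsIn A _) : constMap n m c ∈ chainsIn A m :=
  map_mem_of_mem_supported (constMap n m)
    (fun σ hσ => by
      rw [constMap_single]
      exact single_mem_chainsIn (σ := ContinuousMap.const _ _) (fun t => hσ _) _) hc

/-- On constant simplices the boundary is alternately the identity and zero. For even `n` the cycle
bounds its own copy with one more vertex; for odd `n` its boundary is a copy of itself, so it
vanishes. Starting at two vertices avoids degree zero, where a discrete set may have reduced
homology. -/
lemma BoundsInv.of_allConst {A : Set X} (h : AllConst A) (r : C(X, X)) (q : ℤ) (n : ℕ) :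
    BoundsInv r q A (n + 2) := by
  rintro c hc hcyc -
  by_cases hn : Even n
  · have h1 := constMap_mem_chainsIn (n + 3) hc.1
    refine ⟨constMap _ (n + 3) c, mem_invIn.2 ⟨h1, ?_⟩, ?_⟩
    · rw [chainMap_constMap, (mem_invIn.1 hc).2]
    · rw [bd_eq_of_allConst h h1, constMap_constMap, constMap_self h hc.1, if_pos (by simpa [Nat.even_add])]
  · refine ⟨0, Submodule.zero_mem _, ?_⟩
    have h1 : bd (n + 1) c = 0 := hcyc
    rw [bd_eq_of_allConst h hc.1, if_pos (by simpa [Nat.even_add_one] using hn)] at h1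
    rw [map_zero, ← constMap_self h hc.1, ← constMap_constMap _ n, h1, map_zero]

lemma BoundsInv.of_nonempty {A : Set X} (hA : A.Nonempty) (q : ℤ) :
    BoundsInv (ContinuousMap.id X) q A 0 := by
  obtain ⟨x, hx⟩ := hA
  rintro c - - -
  refine ⟨Finsupp.single (ContinuousMap.const _ x) (c (emptySimp X)),
    mem_invIn.2 ⟨single_mem_chainsIn (fun _ => hx) _, chainMap_id _ _⟩, ?_⟩
  ext σ
  rw [bd_single, subsingleton_simp_zero.elim σ (emptySimp X)]
  have : ContinuousMap.const (stdSimplex ℝ (Fin 0)) x = emptySimp X :=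
    subsingleton_simp_zero.elim _ _
  simp [this]

lemma boundsInv_punit (n : ℕ) : BoundsInv (ContinuousMap.id PUnit.{1}) 0 Set.univ n := by
  rcases n with _ | _ | n
  · exact .of_nonempty Set.univ_nonempty 0
  · rintro c hc hcyc -
    refine ⟨0, Submodule.zero_mem _, ?_⟩
    have hs : Subsingleton (Simp 1 PUnit.{1}) := ⟨fun σ τ => ContinuousMap.ext fun t => rfl⟩
    have h1 : bd 0 c = 0 := hcyc
    have h2 : c = Finsupp.single (ContinuousMap.const _ PUnit.unit)
        (c (ContinuousMap.const _ PUnit.unit)) := by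
      ext σ
      rw [hs.elim σ (ContinuousMap.const _ PUnit.unit), Finsupp.single_eq_same]
    rw [h2, bd_single] at h1
    have h3 := DFunLike.congr_fun h1 (emptySimp PUnit.{1})
    have : ContinuousMap.const (stdSimplex ℝ (Fin 0)) PUnit.unit = emptySimp PUnit.{1} :=
      subsingleton_simp_zero.elim _ _
    have h4 : c (ContinuousMap.const _ PUnit.unit) = 0 := by simpa [this] using h3
    rw [h2, h4]
    simp
  · exact .of_allConst (fun _ _ _ _ _ => rfl) _ _ n

/-! ### Euclidean spaces -/

lemma BoundsInv.of_starConvex {E : Type*} [AddCommGroup E] [Module ℝ E] [TopologicalSpace E]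
    [ContinuousAdd E] [ContinuousSMul ℝ E] {A : Set E} {x : E} (hA : StarConvex ℝ x A)
    (hx : x ∈ A) (q : ℤ) (n : ℕ) : BoundsInv (ContinuousMap.id E) q A n := by
  refine BoundsInv.of_zero ?_ q
  rw [← boundsInv_restrictSelf (fun y hy => hy)]
  refine BoundsInv.of_homotopy (ContinuousMap.const _ PUnit.unit) (ContinuousMap.const _ ⟨x, hx⟩)
    ⟨fun p => ⟨(p.2 : ℝ) • x + (1 - p.2 : ℝ) • (p.1 : E), hA p.1.2 p.2.2.1 (by linarith [p.2.2.2])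
      (by ring)⟩, ?_⟩ rfl rfl (fun y t => rfl) ?_ ?_ (boundsInv_punit n)
  · refine Continuous.subtype_mk ?_ _
    fun_prop
  · intro y
    ext1
    simp
  · intro y
    ext1
    simp

lemma eq_zero_of_mem_chainsIn_empty {n : ℕ} {c : Chain (n + 1) X} (hc : c ∈ chainsIn ∅ (n + 1)) :
    c = 0 := by
  have h : {σ : Simp (n + 1) X | ∀ t, σ t ∈ (∅ : Set X)} = ∅ := by
    ext σ
    simp only [Set.mem_ofPred_eq, Set.mem_empty_iff_false, iff_false, not_forall]
    exact ⟨stdSimplex.vertex 0, not_false⟩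
  rw [chainsIn, h, Finsupp.supported_empty] at hc
  exact hc

lemma boundsInv_empty {r : C(X, X)} (q : ℤ) (n : ℕ) : BoundsInv r q ∅ (n + 1) := by
  rintro c hc - -
  exact ⟨0, Submodule.zero_mem _, by rw [eq_zero_of_mem_chainsIn_empty hc.1, map_zero]⟩

/-- The homology of the complement of the origin in a Euclidean space. -/
lemma boundsInv_compl_zero (q : ℤ) : ∀ (m n : ℕ), (n = m → q ≠ 0) →
    BoundsInv (ContinuousMap.id (Fin m → ℝ)) q {0}ᶜ n := by
  intro m
  induction m with
  | zero =>
    intro n hn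
    have h : ({0}ᶜ : Set (Fin 0 → ℝ)) = ∅ := by
      ext x
      simpa using Subsingleton.elim x 0
    rw [h]
    rcases n with _ | n
    -- The reduced homology of the empty set is one copy of the integers in degree `-1`; being
    -- torsion free, it has no class killed by `q ≠ 0`.
    · rintro c hc - ⟨e, he, hbe⟩
      refine ⟨0, Submodule.zero_mem _, ?_⟩
      rw [eq_zero_of_mem_chainsIn_empty he.1, map_zero] at hbe
      rw [map_zero, (smul_eq_zero.1 hbe.symm).resolve_left (hn rfl)]
    · exact boundsInv_empty q n
  | succ m ih =>
    intro n hn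
    rcases n with _ | n
    · exact .of_nonempty ⟨fun _ => 1, by simp [funext_iff]⟩ q
    -- For `s = 1` and `s = -1` these are the complements of the two closed halves of the first
    -- coordinate axis. They cover the punctured space, and each is star-shaped about a point on the
    -- removed axis's opposite half.
    have hopen : ∀ s : ℝ, IsOpen {x : Fin (m + 1) → ℝ | ¬ (Fin.tail x = 0 ∧ 0 ≤ s * x 0)} := by
      intro s
      have h1 : IsClosed {x : Fin (m + 1) → ℝ | Fin.tail x = 0 ∧ 0 ≤ s * x 0} := by
        change IsClosed ({x : Fin (m + 1) → ℝ | Fin.tail x = 0} ∩ {x | 0 ≤ s * x 0})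
        refine IsClosed.inter (isClosed_eq ?_ continuous_const) (isClosed_le continuous_const ?_)
        · exact continuous_pi fun i => continuous_apply _
        · fun_prop
      exact h1.isOpen_compl
    have hinter : ∀ s : ℝ, ({0}ᶜ ∩ {x : Fin (m + 1) → ℝ | ¬ (Fin.tail x = 0 ∧ 0 ≤ s * x 0)}) =
        {x : Fin (m + 1) → ℝ | ¬ (Fin.tail x = 0 ∧ 0 ≤ s * x 0)} := by
      intro s
      refine Set.inter_eq_right.2 fun x hx h0 => hx ?_
      rw [Set.mem_singleton_iff] at h0
      subst h0
      exact ⟨rfl, by simp⟩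
    have hstar : ∀ s : ℝ, s * s = 1 →
        BoundsInv (ContinuousMap.id (Fin (m + 1) → ℝ)) 0
          {x : Fin (m + 1) → ℝ | ¬ (Fin.tail x = 0 ∧ 0 ≤ s * x 0)} (n + 1) := by
      intro s hs
      refine .of_starConvex (x := Fin.cons (-s) 0) ?_ ?_ _ _
      · rintro x hx a b ha hb hab ⟨h1, h2⟩
        have h3 : b • Fin.tail x = 0 := by
          rw [← h1]
          funext i
          simp [Fin.tail]
        simp only [Pi.add_apply, Pi.smul_apply, Fin.cons_zero, smul_eq_mul] at h2
        rcases smul_eq_zero.1 h3 with h4 | h4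
        · subst h4
          nlinarith
        · have h5 : ¬ 0 ≤ s * x 0 := fun h => hx ⟨h4, h⟩
          push Not at h5
          have h6 : s * (a * -s + b * x 0) = -a + b * (s * x 0) := by linear_combination -a * hs
          have h7 := mul_nonneg hb (neg_nonneg.2 h5.le)
          have h8 : a = 0 := by linarith
          have h9 : b = 1 := by linarith
          rw [h6, h8, h9] at h2
          linarith
      · rintro ⟨-, h⟩
        simp only [Fin.cons_zero] at h
        nlinarith
    refine BoundsInv.mayerVietoris (hopen 1) (hopen (-1)) ?_ rfl ?_ ?_ ?_
    · intro x hx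
      by_contra hcon
      simp only [Set.mem_union, Set.mem_ofPred_eq, not_or, not_not] at hcon
      refine hx (funext fun i => ?_)
      refine Fin.cases ?_ (fun i => ?_) i
      · simp only [Pi.zero_apply]
        linarith [hcon.1.2, hcon.2.2]
      · exact congrFun hcon.1.1 i
    · rw [hinter]
      exact hstar 1 (by norm_num)
    · rw [hinter]
      exact hstar (-1) (by norm_num)
    -- The intersection is the complement of the whole axis, which retracts onto the punctured space
    -- of one dimension less.
    · have hAB : ({x : Fin (m + 1) → ℝ | ¬ (Fin.tail x = 0 ∧ 0 ≤ 1 * x 0)} ∩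
          {x : Fin (m + 1) → ℝ | ¬ (Fin.tail x = 0 ∧ 0 ≤ (-1) * x 0)}) =
          {x : Fin (m + 1) → ℝ | Fin.tail x ≠ 0} := by
        ext x
        simp only [Set.mem_inter_iff, Set.mem_ofPred_eq, ne_eq]
        refine ⟨fun h h0 => ?_, fun h => ⟨fun h' => h h'.1, fun h' => h h'.1⟩⟩
        rcases le_total 0 (x 0) with h1 | h1
        · exact h.1 ⟨h0, by linarith⟩
        · exact h.2 ⟨h0, by linarith⟩
      rw [hinter, hinter, hAB]
      refine BoundsInv.of_homotopyOn (fun y hy => hy) (fun y hy => hy)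
        ⟨fun x => ⟨Fin.tail (x : Fin (m + 1) → ℝ), x.2⟩, ?_⟩
        ⟨fun y => ⟨Fin.cons 0 (y : Fin m → ℝ), by
          change Fin.tail _ ≠ 0
          rw [Fin.tail_cons]
          exact y.2⟩, ?_⟩
        ⟨fun p => ⟨Fin.cons ((1 - p.2 : ℝ) * (p.1 : Fin (m + 1) → ℝ) 0)
          (Fin.tail (p.1 : Fin (m + 1) → ℝ)), by
            change Fin.tail _ ≠ 0
            rw [Fin.tail_cons]
            exact p.1.2⟩, ?_⟩
        (fun _ => rfl) (fun _ => rfl) (fun _ _ => rfl) ?_ ?_ (ih n fun h => hn (by omega))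
      · refine Continuous.subtype_mk (continuous_pi fun i => ?_) _
        exact (continuous_apply (Fin.succ i)).comp continuous_subtype_val
      · refine Continuous.subtype_mk (continuous_pi fun i => ?_) _
        refine Fin.cases ?_ (fun i => ?_) i
        · exact continuous_const
        · exact (continuous_apply i).comp continuous_subtype_val
      · refine Continuous.subtype_mk (continuous_pi fun i => ?_) _
        refine Fin.cases ?_ (fun i => ?_) i
        · simp only [Fin.cons_zero]
          exact (continuous_const.sub (continuous_subtype_val.comp continuous_snd)).mul
            ((continuous_apply 0).comp (continuous_subtype_val.comp continuous_fst))
        · simp only [Fin.cons_succ]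
          exact (continuous_apply (Fin.succ i)).comp (continuous_subtype_val.comp continuous_fst)
      · intro x
        ext1
        simp [Fin.cons_self_tail]
      · intro x
        ext1
        simp

/-- Only one of the two composites of a homotopy equivalence is needed: a space dominated by the
punctured space inherits the vanishing of its homology. -/
lemma exists_retraction_sphere (m : ℕ) :
    ∃ (g : C(({0}ᶜ : Set (Fin m → ℝ)), Metric.sphere (0 : EuclideanSpace ℝ (Fin m)) 1))
      (f : C(Metric.sphere (0 : EuclideanSpace ℝ (Fin m)) 1, ({0}ᶜ : Set (Fin m → ℝ)))),
      ∀ x, g (f x) = x := by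
  have hne : ∀ y : ({0}ᶜ : Set (Fin m → ℝ)), ‖WithLp.toLp 2 (y : Fin m → ℝ)‖ ≠ 0 := by
    intro y
    rw [norm_ne_zero_iff]
    intro h0
    exact y.2 ((WithLp.toLp_eq_zero 2).1 h0)
  have hc : Continuous fun y : ({0}ᶜ : Set (Fin m → ℝ)) => WithLp.toLp 2 (y : Fin m → ℝ) :=
    (PiLp.continuous_toLp 2 _).comp continuous_subtype_val
  have hg : ∀ y : ({0}ᶜ : Set (Fin m → ℝ)), ‖WithLp.toLp 2 (y : Fin m → ℝ)‖⁻¹ •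
      WithLp.toLp 2 (y : Fin m → ℝ) ∈ Metric.sphere (0 : EuclideanSpace ℝ (Fin m)) 1 := by
    intro y
    simp [norm_smul, hne y]
  have hf : ∀ x : Metric.sphere (0 : EuclideanSpace ℝ (Fin m)) 1,
      WithLp.ofLp (x : EuclideanSpace ℝ (Fin m)) ∈ ({0}ᶜ : Set (Fin m → ℝ)) := by
    intro x h0
    have h2 := x.2
    rw [(WithLp.ofLp_eq_zero 2).1 h0] at h2
    simp at h2
  have hgc : Continuous fun y : ({0}ᶜ : Set (Fin m → ℝ)) => ‖WithLp.toLp 2 (y : Fin m → ℝ)‖⁻¹ •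
      WithLp.toLp 2 (y : Fin m → ℝ) := (hc.norm.inv₀ hne).smul hc
  have hfc : Continuous fun x : Metric.sphere (0 : EuclideanSpace ℝ (Fin m)) 1 =>
      WithLp.ofLp (x : EuclideanSpace ℝ (Fin m)) :=
    (PiLp.continuous_ofLp 2 _).comp continuous_subtype_val
  refine ⟨⟨fun y => ⟨_, hg y⟩, hgc.subtype_mk hg⟩, ⟨fun x => ⟨_, hf x⟩, hfc.subtype_mk hf⟩, ?_⟩
  intro x
  ext1
  simp

/-- The homology of spaces homotopy equivalent to spheres. -/
lemma boundsInv_of_homotopyEquiv_sphere (m : ℕ)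
    (h : ContinuousMap.HomotopyEquiv X (Metric.sphere (0 : EuclideanSpace ℝ (Fin m)) 1))
    (q : ℤ) (n : ℕ) (hn : n = m → q ≠ 0) : BoundsInv (ContinuousMap.id X) q Set.univ n := by
  have h1 := boundsInv_compl_zero q m n hn
  rw [← boundsInv_restrictSelf (fun y hy => hy)] at h1
  obtain ⟨H⟩ := h.left_inv.symm
  obtain ⟨g, f, hgf⟩ := exists_retraction_sphere m
  refine BoundsInv.of_homotopy (f.comp h.toFun) (h.invFun.comp g)
    ⟨fun p => H (p.2, p.1), H.continuous.comp continuous_swap⟩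
    (ContinuousMap.ext fun _ => rfl) (ContinuousMap.ext fun _ => rfl) (fun _ _ => rfl)
    (fun x => H.apply_zero x) (fun x => ?_) h1
  refine (H.apply_one x).trans ?_
  change h.invFun (h.toFun x) = h.invFun (g (f (h.toFun x)))
  rw [hgf]

end SingularChains

end

/-! ### Permutation modules over a cyclic group of prime order. -/

noncomputable section

namespace SingularChains

/-! ### Free orbits of a periodic map -/

section FreeOrbits

variable {α : Type*} {g : α → α} {p : ℕ}

/-- A periodic map of prime period has a set meeting each non-trivial orbit exactly once. -/
lemma exists_fundamental_set (hp : p.Prime) (hg : g^[p] = id) :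
    ∃ D : Set α, ∀ a, g a ≠ a → ∃! j, j < p ∧ g^[j] a ∈ D := by
  let s : Setoid α :=
    { r := fun a b => ∃ j, g^[j] a = b
      iseqv := by
        refine ⟨fun a => ⟨0, rfl⟩, ?_, ?_⟩
        · rintro a b ⟨j, rfl⟩
          refine ⟨(p - 1) * j, ?_⟩
          rw [← Function.iterate_add_apply]
          have : (p - 1) * j + j = p * j := by
            have := hp.pos
            obtain ⟨q, rfl⟩ : ∃ q, p = q + 1 := ⟨p - 1, by omega⟩
            simp; ring
          rw [this, Function.iterate_mul, hg]
          simp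
        · rintro a b c ⟨j, rfl⟩ ⟨k, rfl⟩
          exact ⟨k + j, Function.iterate_add_apply _ _ _ _⟩ }
  refine ⟨{a | (Quotient.mk s a).out = a}, fun a ha => ?_⟩
  have hmin : Function.minimalPeriod g a = p := by
    have h1 : Function.minimalPeriod g a ∣ p :=
      Function.IsPeriodicPt.minimalPeriod_dvd (congrFun hg a)
    refine ((Nat.dvd_prime hp).1 h1).resolve_left fun h2 => ha ?_
    exact Function.minimalPeriod_eq_one_iff_isFixedPt.1 h2
  have hmk : ∀ j, Quotient.mk s (g^[j] a) = Quotient.mk s a := fun j =>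
    (Quotient.sound (s := s) (show ∃ k, g^[k] a = g^[j] a from ⟨j, rfl⟩)).symm
  obtain ⟨j, hj⟩ : ∃ j, g^[j] a = (Quotient.mk s a).out :=
    Quotient.exact (s := s) (Quotient.out_eq _).symm
  refine ⟨j % p, ⟨Nat.mod_lt _ hp.pos, ?_⟩, ?_⟩
  · change (Quotient.mk s _).out = _
    rw [hmk, ← hj, ← hmin, Function.iterate_mod_minimalPeriod_eq]
  · rintro k ⟨hk, hkD⟩
    change (Quotient.mk s _).out = _ at hkD
    rw [hmk, ← hj] at hkD
    refine Function.iterate_injOn_Iio_minimalPeriod (f := g) (x := a) (by simpa [hmin] using hk)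
      (by simpa [hmin] using Nat.mod_lt _ hp.pos) ?_
    change g^[k] a = g^[j % p] a
    rw [← hkD, ← hmin, Function.iterate_mod_minimalPeriod_eq]

lemma lmapDomain_pow_single (j : ℕ) (a : α) (n : ℤ) :
    ((Finsupp.lmapDomain ℤ ℤ g : Module.End ℤ (α →₀ ℤ)) ^ j) (Finsupp.single a n) =
      Finsupp.single (g^[j] a) n := by
  induction j with
  | zero => simp
  | succ j ih => rw [pow_succ', Module.End.mul_apply, ih, Function.iterate_succ_apply']; simp

/-- Restriction of a finitely supported function to a set as a linear map. -/
def restrictTo (D : Set α) : Module.End ℤ (α →₀ ℤ) := by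
  classical exact (Finsupp.supported ℤ ℤ D).subtype ∘ₗ Finsupp.restrictDom ℤ ℤ D

lemma restrictTo_apply_of_mem {D : Set α} {a : α} (h : a ∈ D) (c : α →₀ ℤ) :
    restrictTo D c a = c a := by
  classical
  simp [restrictTo, Finsupp.restrictDom_apply, h]

lemma restrictTo_apply_of_notMem {D : Set α} {a : α} (h : a ∉ D) (c : α →₀ ℤ) :
    restrictTo D c a = 0 := by
  classical
  simp [restrictTo, Finsupp.restrictDom_apply, h]

lemma restrictTo_mem (D : Set α) (c : α →₀ ℤ) : restrictTo D c ∈ Finsupp.supported ℤ ℤ D := by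
  unfold restrictTo
  exact Subtype.property _

lemma restrictTo_single_of_mem {D : Set α} {a : α} (h : a ∈ D) (n : ℤ) :
    restrictTo D (Finsupp.single a n) = Finsupp.single a n := by
  ext b
  by_cases hb : b ∈ D
  · rw [restrictTo_apply_of_mem hb]
  · rw [restrictTo_apply_of_notMem hb, Finsupp.single_eq_of_ne (by rintro rfl; exact hb h)]

lemma restrictTo_single_of_notMem {D : Set α} {a : α} (h : a ∉ D) (n : ℤ) :
    restrictTo D (Finsupp.single a n) = 0 := by
  ext b
  by_cases hb : b ∈ D
  · rw [restrictTo_apply_of_mem hb, Finsupp.single_eq_of_ne (by rintro rfl; exact h hb)]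
    rfl
  · rw [restrictTo_apply_of_notMem hb]
    rfl

lemma sub_restrictTo_mem_compl (D : Set α) (c : α →₀ ℤ) :
    c - restrictTo D c ∈ Finsupp.supported ℤ ℤ Dᶜ := by
  rw [Finsupp.mem_supported']
  intro a ha
  rw [Finsupp.sub_apply, restrictTo_apply_of_mem (by simpa using ha), sub_self]

/-- The norm element `1 + R + ⋯ + R ^ (p - 1)`. -/
def normEnd {M : Type*} [AddCommGroup M] (p : ℕ) (R : Module.End ℤ M) : Module.End ℤ M :=
  ∑ j ∈ Finset.range p, R ^ j

/-- The exponents run through `1, ..., p` instead of `0, ..., p - 1`, and `R ^ p = 1` identifies the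
two ends. -/
lemma sum_pow_sub {M : Type*} [AddCommGroup M] (R : Module.End ℤ M) (hR : R ^ p = 1) :
    ∑ j ∈ Finset.range p, R ^ (p - j) = normEnd p R := by
  rcases p with _ | p
  · rfl
  · rw [normEnd, ← Finset.sum_range_reflect, Finset.sum_range_succ, Finset.sum_range_succ' (R ^ ·)]
    simp only [add_tsub_cancel_right, Nat.sub_self, Nat.sub_zero, pow_zero, hR]
    congr 1
    refine Finset.sum_congr rfl fun j hj => ?_
    congr 1
    have := Finset.mem_range.1 hj
    omega

variable {S D : Set α}

/-- Each basis element of `S` has exactly one translate in `D`. Moving it there, cutting down to `D`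
and moving back therefore recovers it in exactly one summand. -/
lemma sum_restrictTo_eq (hg : g^[p] = id)
    (hD : ∀ a ∈ S, ∃! j, j < p ∧ g^[j] a ∈ D) {c : α →₀ ℤ} (hc : c ∈ Finsupp.supported ℤ ℤ S) :
    ∑ j ∈ Finset.range p, ((Finsupp.lmapDomain ℤ ℤ g : Module.End ℤ (α →₀ ℤ)) ^ (p - j))
      (restrictTo D (((Finsupp.lmapDomain ℤ ℤ g : Module.End ℤ (α →₀ ℤ)) ^ j) c)) = c := by
  set R : Module.End ℤ (α →₀ ℤ) := Finsupp.lmapDomain ℤ ℤ g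
  have := map_mem_of_mem_supported
    (∑ j ∈ Finset.range p, (R ^ (p - j)) * restrictTo D * (R ^ j) - 1) (p := ⊥) (fun a ha => ?_) hc
  · rw [Submodule.mem_bot, LinearMap.sub_apply, sub_eq_zero, LinearMap.sum_apply] at this
    exact this
  · obtain ⟨j, ⟨hj, hjD⟩, huniq⟩ := hD a ha
    rw [Submodule.mem_bot, LinearMap.sub_apply, sub_eq_zero, LinearMap.sum_apply,
      Finset.sum_eq_single j]
    · simp only [Module.End.mul_apply, R, lmapDomain_pow_single]
      rw [restrictTo_single_of_mem hjD, lmapDomain_pow_single, ← Function.iterate_add_apply,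
        Nat.sub_add_cancel hj.le, hg]
      rfl
    · intro k hk hkj
      simp only [Module.End.mul_apply, R, lmapDomain_pow_single]
      rw [restrictTo_single_of_notMem, map_zero]
      intro h
      exact hkj (huniq k ⟨by simpa using hk, h⟩)
    · intro h
      exact absurd (Finset.mem_range.2 hj) h

lemma lmapDomain_pow_eq_one (hg : g^[p] = id) :
    (Finsupp.lmapDomain ℤ ℤ g : Module.End ℤ (α →₀ ℤ)) ^ p = 1 := by
  ext1 a
  ext1
  simp [lmapDomain_pow_single, hg]

/-- An invariant chain on a free part is a norm. -/
lemma normEnd_restrictTo (hg : g^[p] = id) (hD : ∀ a ∈ S, ∃! j, j < p ∧ g^[j] a ∈ D)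
    {c : α →₀ ℤ} (hc : c ∈ Finsupp.supported ℤ ℤ S) (hinv : Finsupp.lmapDomain ℤ ℤ g c = c) :
    normEnd p (Finsupp.lmapDomain ℤ ℤ g) (restrictTo D c) = c := by
  set R : Module.End ℤ (α →₀ ℤ) := Finsupp.lmapDomain ℤ ℤ g
  have hpow : ∀ j : ℕ, (R ^ j) c = c := by
    intro j
    induction j with
    | zero => rfl
    | succ j ih => rw [pow_succ', Module.End.mul_apply, ih, hinv]
  rw [← sum_pow_sub R (lmapDomain_pow_eq_one hg), LinearMap.sum_apply]
  conv_rhs => rw [← sum_restrictTo_eq hg hD hc]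
  refine Finset.sum_congr rfl fun j _ => ?_
  change _ = (R ^ (p - j)) (restrictTo D ((R ^ j) c))
  rw [hpow]

/-- A chain of norm zero on a free part is of the form `R d - d`. -/
lemma exists_sub_eq_of_normEnd_eq_zero (hg : g^[p] = id)
    (hD : ∀ a ∈ S, ∃! j, j < p ∧ g^[j] a ∈ D) {c : α →₀ ℤ} (hc : c ∈ Finsupp.supported ℤ ℤ S)
    (h0 : normEnd p (Finsupp.lmapDomain ℤ ℤ g) c = 0) :
    ∃ d, Finsupp.lmapDomain ℤ ℤ g d - d = c := by
  set R : Module.End ℤ (α →₀ ℤ) := Finsupp.lmapDomain ℤ ℤ g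
  -- With `x_j` the part of `R ^ j c` in `D`, one has `c = ∑ R ^ (p - j) x_j`, and `∑ x_j = 0`
  -- because the norm of `c` vanishes. Hence `c = ∑ (R ^ (p - j) - 1) x_j`, and every summand is
  -- divisible by `R - 1` through a geometric sum.
  refine ⟨∑ j ∈ Finset.range p, (∑ i ∈ Finset.range (p - j), R ^ i) (restrictTo D ((R ^ j) c)), ?_⟩
  have h1 : ∑ j ∈ Finset.range p, restrictTo D ((R ^ j) c) = 0 := by
    rw [← map_sum, ← LinearMap.sum_apply]
    change restrictTo D (normEnd p R c) = 0
    rw [h0, map_zero]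
  have h2 : ∀ (k : ℕ) (x : α →₀ ℤ), (R ^ k) x - x =
      (R - 1) ((∑ i ∈ Finset.range k, R ^ i) x) := by
    intro k x
    rw [← Module.End.mul_apply, mul_geom_sum]
    rfl
  change (R - 1) _ = c
  rw [map_sum]
  simp only [← h2]
  rw [Finset.sum_sub_distrib, h1, sub_zero]
  exact sum_restrictTo_eq hg hD hc

end FreeOrbits

end SingularChains

end

/-! ### Norms of singular chains and freely permuted pieces. -/

noncomputable section

namespace SingularChains

variable {X Y Z : Type*} [TopologicalSpace X] [TopologicalSpace Y] [TopologicalSpace Z]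

/-! ### Norms of chains -/

lemma bd_chainMap_pow (r : C(X, X)) (n j : ℕ) (c : Chain (n + 1) X) :
    bd n (((chainMap r (n + 1) : Module.End ℤ (Chain (n + 1) X)) ^ j) c) =
      ((chainMap r n : Module.End ℤ (Chain n X)) ^ j) (bd n c) := by
  induction j with
  | zero => rfl
  | succ j ih =>
    rw [pow_succ', pow_succ', Module.End.mul_apply, Module.End.mul_apply, bd_chainMap, ih]

/-- The norm of singular chains with respect to a self-map of period `p`. -/
def chainNorm (p : ℕ) (r : C(X, X)) (n : ℕ) : Module.End ℤ (Chain n X) :=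
  normEnd p (chainMap r n : Module.End ℤ (Chain n X))

lemma bd_chainNorm (p : ℕ) (r : C(X, X)) (n : ℕ) (c : Chain (n + 1) X) :
    bd n (chainNorm p r (n + 1) c) = chainNorm p r n (bd n c) := by
  simp only [chainNorm, normEnd, LinearMap.sum_apply, map_sum, bd_chainMap_pow]

lemma iterate_comp_eq_id {p : ℕ} {r : C(X, X)} (hr : r^[p] = id) (n : ℕ) :
    (fun σ : Simp n X => r.comp σ)^[p] = id := by
  funext σ
  ext1 t
  have h : ∀ j, ((fun σ : Simp n X => r.comp σ)^[j] σ) t = r^[j] (σ t) := by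
    intro j
    induction j with
    | zero => rfl
    | succ j ih => rw [Function.iterate_succ_apply', Function.iterate_succ_apply', ← ih]; rfl
  rw [h, hr]
  rfl

lemma iterate_comp_apply (r : C(X, X)) {n : ℕ} (σ : Simp n X) (j : ℕ) (t) :
    ((fun σ : Simp n X => r.comp σ)^[j] σ) t = r^[j] (σ t) := by
  induction j with
  | zero => rfl
  | succ j ih => rw [Function.iterate_succ_apply', Function.iterate_succ_apply', ← ih]; rfl

lemma chainMap_pow_eq_one {p : ℕ} {r : C(X, X)} (hr : r^[p] = id) (n : ℕ) :
    (chainMap r n : Module.End ℤ (Chain n X)) ^ p = 1 :=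
  lmapDomain_pow_eq_one (iterate_comp_eq_id hr n)

lemma mul_normEnd {M : Type*} [AddCommGroup M] {p : ℕ} {R : Module.End ℤ M} (hR : R ^ p = 1) :
    R * normEnd p R = normEnd p R := by
  have := mul_geom_sum R p
  rwa [hR, sub_self, sub_mul, one_mul, sub_eq_zero] at this

lemma normEnd_mul {M : Type*} [AddCommGroup M] {p : ℕ} {R : Module.End ℤ M} (hR : R ^ p = 1) :
    normEnd p R * R = normEnd p R := by
  have := geom_sum_mul R p
  rwa [hR, sub_self, mul_sub, mul_one, sub_eq_zero] at this

lemma chainMap_chainNorm {p : ℕ} {r : C(X, X)} (hr : r^[p] = id) (n : ℕ) (c : Chain n X) :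
    chainMap r n (chainNorm p r n c) = chainNorm p r n c :=
  LinearMap.congr_fun (mul_normEnd (chainMap_pow_eq_one hr n)) c

lemma chainNorm_chainMap {p : ℕ} {r : C(X, X)} (hr : r^[p] = id) (n : ℕ) (c : Chain n X) :
    chainNorm p r n (chainMap r n c) = chainNorm p r n c :=
  LinearMap.congr_fun (normEnd_mul (chainMap_pow_eq_one hr n)) c

lemma chainNorm_mem_chainsIn {p : ℕ} {r : C(X, X)} {A : Set X} (hA : Set.MapsTo r A A) {n : ℕ}
    {c : Chain n X} (hc : c ∈ chainsIn A n) : chainNorm p r n c ∈ chainsIn A n := by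
  rw [chainNorm, normEnd, LinearMap.sum_apply]
  refine Submodule.sum_mem _ fun j hj => ?_
  clear hj
  induction j with
  | zero => exact hc
  | succ j ih => rw [pow_succ', Module.End.mul_apply]; exact chainMap_mem_chainsIn hA ih

lemma chainNorm_mem_invIn {p : ℕ} {r : C(X, X)} (hr : r^[p] = id) {A : Set X}
    (hA : Set.MapsTo r A A) {n : ℕ} {c : Chain n X} (hc : c ∈ chainsIn A n) :
    chainNorm p r n c ∈ invIn r A n :=
  mem_invIn.2 ⟨chainNorm_mem_chainsIn hA hc, chainMap_chainNorm hr n c⟩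

/-- The proper translates of `D` miss `D`, so cutting the norm down to `D` leaves only its first
summand. In particular the norm is injective on chains supported on `D`. -/
lemma restrictTo_chainNorm {p : ℕ} (hp : 0 < p) {r : C(X, X)} {n : ℕ} {D : Set (Simp n X)}
    (hD : ∀ σ ∈ D, ∀ j, 0 < j → j < p → (fun σ : Simp n X => r.comp σ)^[j] σ ∉ D) {c : Chain n X}
    (hc : c ∈ Finsupp.supported ℤ ℤ D) : restrictTo D (chainNorm p r n c) = c := by
  have := map_mem_of_mem_supported (restrictTo D * chainNorm p r n - 1) (p := ⊥)
    (fun σ hσ => ?_) hc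
  · exact sub_eq_zero.1 this
  · rw [Submodule.mem_bot, LinearMap.sub_apply, sub_eq_zero, Module.End.mul_apply, chainNorm,
      normEnd, LinearMap.sum_apply, map_sum, Finset.sum_eq_single 0]
    · simp [restrictTo_single_of_mem hσ]
    · intro j hj hj0
      change restrictTo D (((Finsupp.lmapDomain ℤ ℤ _ : Module.End ℤ (Simp n X →₀ ℤ)) ^ j) _) = 0
      rw [lmapDomain_pow_single, restrictTo_single_of_notMem]
      exact hD σ hσ j (Nat.pos_of_ne_zero hj0) (Finset.mem_range.1 hj)
    · intro h
      exact absurd (Finset.mem_range.2 hp) h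

/-- Invariant cycles in a set which is a disjoint union of translates of `B`. -/
lemma BoundsInv.of_free {p : ℕ} (hp : 0 < p) {r : C(X, X)} (hr : r^[p] = id) {A B : Set X}
    (hA : Set.MapsTo r A A) (hBA : B ⊆ A) {n : ℕ}
    (hD : ∀ (m : ℕ) (σ : Simp (m + 1) X), (∀ t, σ t ∈ A) → ∃! j, j < p ∧ ∀ t, r^[j] (σ t) ∈ B)
    (h : BoundsInv (ContinuousMap.id X) 0 B (n + 2)) : BoundsInv r 0 A (n + 2) := by
  rintro c hc hcyc -
  let S : ∀ m : ℕ, Set (Simp (m + 1) X) := fun m => {σ | ∀ t, σ t ∈ A}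
  let D : ∀ m : ℕ, Set (Simp (m + 1) X) := fun m => {σ | ∀ t, σ t ∈ B}
  have hSD : ∀ m, ∀ σ ∈ S m, ∃! j, j < p ∧ (fun σ : Simp (m + 1) X => r.comp σ)^[j] σ ∈ D m := by
    intro m σ hσ
    obtain ⟨j, ⟨hj, hjB⟩, huniq⟩ := hD m σ hσ
    refine ⟨j, ⟨hj, fun t => ?_⟩, ?_⟩
    · rw [iterate_comp_apply]
      exact hjB t
    · rintro k ⟨hk, hkB⟩
      refine huniq k ⟨hk, fun t => ?_⟩
      rw [← iterate_comp_apply]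
      exact hkB t
  have hN : chainNorm p r _ (restrictTo (D _) c) = c :=
    normEnd_restrictTo (iterate_comp_eq_id hr _) (hSD _) hc.1 (mem_invIn.1 hc).2
  have hc0 : restrictTo (D _) c ∈ chainsIn B (n + 2) := restrictTo_mem _ _
  -- The norm of this boundary is the boundary of `c`, which is zero, and the norm is injective on
  -- chains in `B`.
  have hcyc0 : bd (n + 1) (restrictTo (D _) c) = 0 := by
    rw [← restrictTo_chainNorm (D := D n) hp (r := r) ?_ (bd_mem_chainsIn hc0), ← bd_chainNorm, hN,
      show bd (n + 1) c = 0 from hcyc, map_zero]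
    intro σ hσ j hj hjp hjD
    obtain ⟨k, -, huniq⟩ := hSD n σ fun t => hBA (hσ t)
    exact hj.ne ((huniq 0 ⟨hp, hσ⟩).trans (huniq j ⟨hjp, hjD⟩).symm)
  obtain ⟨e, he, hbe⟩ := h.exists_bd (c := restrictTo (D _) c)
    (mem_invIn.2 ⟨hc0, chainMap_id _ _⟩) hcyc0
  exact ⟨chainNorm p r _ e, chainNorm_mem_invIn hr hA (chainsIn_mono hBA _ he.1), by
    rw [bd_chainNorm, hbe, hN]⟩

lemma preimage_eq_of_iterate_eq_id {α : Type*} {p : ℕ} (hp : 0 < p) {f : α → α} (hf : f^[p] = id)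
    {A : Set α} (hA : Set.MapsTo f A A) : f ⁻¹' A = A := by
  refine Set.Subset.antisymm (fun x hx => ?_) hA
  have h1 := hA.iterate (p - 1) hx
  rw [← Function.iterate_succ_apply, Nat.succ_eq_add_one, Nat.sub_add_cancel hp, hf] at h1
  exact h1

/-- Finite unions of relatively clopen sets. -/
lemma boundsInv_biUnion {ι : Type*} {n : ℕ} (E F : ι → Set X)
    (hF : ∀ i, IsClosed (F i)) (hEF : ∀ i, E i ⊆ F i) (hdisj : ∀ i j, i ≠ j → Disjoint (E i) (F j))
    (h : ∀ i, BoundsInv (ContinuousMap.id X) 0 (E i) (n + 2)) (T : Finset ι) :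
    BoundsInv (ContinuousMap.id X) 0 (⋃ i ∈ T, E i) (n + 2) := by
  classical
  induction T using Finset.induction_on with
  | empty => simpa using boundsInv_empty 0 _
  | insert a T ha ih =>
    have hcl : IsClosed (⋃ i ∈ T, F i) := T.finite_toSet.isClosed_biUnion fun i _ => hF i
    -- The closed sets `F i` separate the pieces: removing those of `T` isolates `E a`, and removing
    -- `F a` isolates the others, so both parts are relatively open.
    have hA : (⋃ i ∈ insert a T, E i) ∩ (⋃ i ∈ T, F i)ᶜ = E a := by
      ext x
      simp only [Set.mem_inter_iff, Set.mem_iUnion, Finset.mem_insert, exists_prop,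
        Set.mem_compl_iff, not_exists, not_and]
      constructor
      · rintro ⟨⟨i, rfl | hi, hx⟩, h2⟩
        · exact hx
        · exact absurd (hEF i hx) (h2 i hi)
      · intro hx
        refine ⟨⟨a, Or.inl rfl, hx⟩, fun i hi hxi => ?_⟩
        exact Set.disjoint_left.1 (hdisj a i (by rintro rfl; exact ha hi)) hx hxi
    have hB : (⋃ i ∈ insert a T, E i) ∩ (F a)ᶜ = ⋃ i ∈ T, E i := by
      ext x
      simp only [Set.mem_inter_iff, Set.mem_iUnion, Finset.mem_insert, exists_prop,
        Set.mem_compl_iff]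
      constructor
      · rintro ⟨⟨i, rfl | hi, hx⟩, h2⟩
        · exact absurd (hEF i hx) h2
        · exact ⟨i, hi, hx⟩
      · rintro ⟨i, hi, hx⟩
        exact ⟨⟨i, Or.inr hi, hx⟩, Set.disjoint_left.1 (hdisj i a (by rintro rfl; exact ha hi)) hx⟩
    have hAB : E a ∩ (⋃ i ∈ T, E i) = ∅ := by
      ext x
      simp only [Set.mem_inter_iff, Set.mem_iUnion, exists_prop, Set.mem_empty_iff_false, iff_false]
      rintro ⟨hx, i, hi, hxi⟩
      exact Set.disjoint_left.1 (hdisj a i (by rintro rfl; exact ha hi)) hx (hEF i hxi)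
    refine BoundsInv.mayerVietoris hcl.isOpen_compl (hF a).isOpen_compl ?_ rfl ?_ ?_ ?_
    · intro x hx
      by_contra hcon
      simp only [Set.mem_union, Set.mem_compl_iff, not_or, not_not, Set.mem_iUnion,
        exists_prop] at hcon
      simp only [Set.mem_iUnion, exists_prop] at hx
      obtain ⟨⟨i, hi, hxi⟩, hxa⟩ := hcon
      obtain ⟨j, -, hxj⟩ := hx
      by_cases hj : j = a
      · subst hj
        exact Set.disjoint_left.1 (hdisj j i (by rintro rfl; exact ha hi)) hxj hxi
      · exact Set.disjoint_left.1 (hdisj j a hj) hxj hxa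
    · rw [hA]
      exact h a
    · rw [hB]
      exact ih
    · rw [hA, hB, hAB]
      exact boundsInv_empty 0 n

end SingularChains

end

/-! ### Open cells, characteristic maps and cellular self-maps. -/

noncomputable section

namespace SingularChains

open RelCWComplex (cell openCell closedCell cellFrontier skeletonLT)

lemma boundsInv_ball_diff {m n : ℕ} (h : n ≠ m) :
    BoundsInv (ContinuousMap.id (Fin m → ℝ)) 0 (Metric.ball 0 1 \ {0}) n := by
  have hne : ∀ y : ({0}ᶜ : Set (Fin m → ℝ)), ‖(y : Fin m → ℝ)‖ ≠ 0 := fun y =>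
    norm_ne_zero_iff.2 y.2
  have hsub : Metric.ball (0 : Fin m → ℝ) 1 \ {0} ⊆ {0}ᶜ := fun x hx => hx.2
  -- Vectors are scaled along their rays to norm one half, and `s` interpolates linearly between the
  -- factor one and this scaling.
  have hg : ∀ y : ({0}ᶜ : Set (Fin m → ℝ)), (2⁻¹ * ‖(y : Fin m → ℝ)‖⁻¹) • (y : Fin m → ℝ) ∈
      Metric.ball (0 : Fin m → ℝ) 1 \ {0} := by
    intro y
    refine ⟨?_, ?_⟩
    · rw [mem_ball_zero_iff, norm_smul, Real.norm_of_nonneg (by positivity), mul_assoc,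
        inv_mul_cancel₀ (hne y)]
      norm_num
    · simp only [Set.mem_singleton_iff, smul_eq_zero, not_or]
      exact ⟨mul_ne_zero (by norm_num) (inv_ne_zero (hne y)), y.2⟩
  have hgc : Continuous fun y : ({0}ᶜ : Set (Fin m → ℝ)) =>
      (2⁻¹ * ‖(y : Fin m → ℝ)‖⁻¹) • (y : Fin m → ℝ) :=
    (continuous_const.mul (continuous_subtype_val.norm.inv₀ hne)).smul continuous_subtype_val
  let s : (Metric.ball (0 : Fin m → ℝ) 1 \ {0} : Set _) × unitInterval → ℝ := fun p =>
    (1 - p.2 : ℝ) + p.2 * (2⁻¹ * ‖(p.1 : Fin m → ℝ)‖⁻¹)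
  have hs : ∀ p, 0 < s p := by
    rintro ⟨x, t⟩
    have h1 : 0 < ‖(x : Fin m → ℝ)‖ := norm_pos_iff.2 x.2.2
    have h2 : (0 : ℝ) ≤ t := t.2.1
    have h3 : (0 : ℝ) ≤ 1 - t := by linarith [t.2.2]
    rcases h2.eq_or_lt with h4 | h4
    · simp [s, ← h4]
    · exact add_pos_of_nonneg_of_pos h3 (by positivity)
  have hH : ∀ p, s p • (p.1 : Fin m → ℝ) ∈ Metric.ball (0 : Fin m → ℝ) 1 \ {0} := by
    rintro ⟨x, t⟩
    have h1 : 0 < ‖(x : Fin m → ℝ)‖ := norm_pos_iff.2 x.2.2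
    have h5 : ‖(x : Fin m → ℝ)‖ < 1 := by simpa using x.2.1
    refine ⟨?_, ?_⟩
    · rw [mem_ball_zero_iff, norm_smul, Real.norm_of_nonneg (hs _).le]
      have : s (x, t) * ‖(x : Fin m → ℝ)‖ = (1 - t) * ‖(x : Fin m → ℝ)‖ + t * 2⁻¹ := by
        simp only [s]
        field_simp
      rw [this]
      have h2 : (0 : ℝ) ≤ t := t.2.1
      have h3 : (t : ℝ) ≤ 1 := t.2.2
      nlinarith
    · simp only [Set.mem_singleton_iff, smul_eq_zero, not_or]
      exact ⟨(hs _).ne', x.2.2⟩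
  have hsc : Continuous s := by
    refine (continuous_const.sub (continuous_subtype_val.comp continuous_snd)).add
      ((continuous_subtype_val.comp continuous_snd).mul (continuous_const.mul
        (Continuous.inv₀ (continuous_subtype_val.comp continuous_fst).norm fun p => ?_)))
    exact norm_ne_zero_iff.2 p.1.2.2
  have hHc : Continuous fun p : (Metric.ball (0 : Fin m → ℝ) 1 \ {0} : Set _) × unitInterval =>
      s p • (p.1 : Fin m → ℝ) := hsc.smul (continuous_subtype_val.comp continuous_fst)
  refine BoundsInv.of_homotopyOn (fun y hy => hy) (fun y hy => hy)
    ⟨Set.inclusion hsub, continuous_inclusion hsub⟩ ⟨fun y => ⟨_, hg y⟩, hgc.subtype_mk hg⟩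
    ⟨fun p => ⟨_, hH p⟩, hHc.subtype_mk hH⟩ (fun _ => rfl) (fun _ => rfl) (fun _ _ => rfl) ?_ ?_
    (boundsInv_compl_zero 0 m n fun h' => absurd h' h)
  · intro x
    ext1
    simp [s]
  · intro x
    ext1
    simp [s]

lemma boundsInv_ball (m n : ℕ) :
    BoundsInv (ContinuousMap.id (Fin m → ℝ)) 0 (Metric.ball 0 1) n :=
  .of_starConvex ((convex_ball 0 1).starConvex (Metric.mem_ball_self one_pos))
    (Metric.mem_ball_self one_pos) 0 n

variable {X : Type u} [TopologicalSpace X] [T2Space X] [CWComplex (Set.univ : Set X)]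

/-- The characteristic maps of a CW complex. -/
abbrev charMap (m : ℕ) (i : cell (Set.univ : Set X) m) : PartialEquiv (Fin m → ℝ) X :=
  RelCWComplex.map (C := (Set.univ : Set X)) m i

/-- The union of the open cells of dimension less than `m`. -/
abbrev skel (X : Type u) [TopologicalSpace X] [T2Space X] [CWComplex (Set.univ : Set X)] (m : ℕ) : Set X :=
  (skeletonLT (Set.univ : Set X) (m : ℕ∞) : Set X)

/-- A characteristic map restricts to a homeomorphism from the open ball onto the open cell, so the
homology of a piece can be computed in Euclidean space. -/
lemma boundsInv_image_charMap {m n : ℕ} (i : cell (Set.univ : Set X) m) {P : Set (Fin m → ℝ)}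
    (hP : P ⊆ Metric.ball 0 1) (h : BoundsInv (ContinuousMap.id (Fin m → ℝ)) 0 P n) :
    BoundsInv (ContinuousMap.id X) 0 (charMap m i '' P) n := by
  have hsrc : P ⊆ (charMap m i).source := by rwa [RelCWComplex.source_eq]
  have hf : ∀ x : (charMap m i '' P : Set X), (charMap m i).symm x ∈ P := by
    rintro ⟨_, y, hy, rfl⟩
    rwa [(charMap m i).left_inv (hsrc hy)]
  have hfc : Continuous fun x : (charMap m i '' P : Set X) => (charMap m i).symm x := by
    have h1 : ContinuousOn (charMap m i).symm (charMap m i '' P) := by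
      refine (RelCWComplex.continuousOn_symm m i).mono ?_
      rw [← (charMap m i).image_source_eq_target]
      exact Set.image_mono hsrc
    exact continuousOn_iff_continuous_domRestrict.1 h1
  have hg : ∀ y : P, charMap m i y ∈ charMap m i '' P := fun y => ⟨y, y.2, rfl⟩
  have hgc : Continuous fun y : P => charMap m i y :=
    continuousOn_iff_continuous_domRestrict.1 ((RelCWComplex.continuousOn m i).mono
      (hP.trans Metric.ball_subset_closedBall))
  refine BoundsInv.of_homotopyOn (fun y hy => hy) (fun y hy => hy)
    ⟨fun x => ⟨_, hf x⟩, hfc.subtype_mk hf⟩ ⟨fun y => ⟨_, hg y⟩, hgc.subtype_mk hg⟩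
    ⟨Prod.fst, continuous_fst⟩ (fun _ => rfl) (fun _ => rfl) (fun _ _ => rfl) (fun _ => rfl) ?_ h
  rintro ⟨_, y, hy, rfl⟩
  ext1
  change charMap m i y = charMap m i ((charMap m i).symm (charMap m i y))
  rw [(charMap m i).left_inv (hsrc hy)]

lemma mem_skel_succ {m : ℕ} {x : X} :
    x ∈ skel X (m + 1) ↔ x ∈ skel X m ∨ ∃ i : cell (Set.univ : Set X) m, x ∈ openCell m i := by
  simp only [skel, SetLike.mem_coe, CWComplex.mem_skeletonLT_iff, Nat.cast_lt]
  constructor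
  · rintro ⟨k, hk, j, hj⟩
    rcases Nat.lt_succ_iff_lt_or_eq.1 hk with h | rfl
    · exact Or.inl ⟨k, h, j, hj⟩
    · exact Or.inr ⟨j, hj⟩
  · rintro (⟨k, hk, j, hj⟩ | ⟨i, hi⟩)
    · exact ⟨k, hk.trans (Nat.lt_succ_self m), j, hj⟩
    · exact ⟨m, Nat.lt_succ_self m, i, hi⟩

lemma skel_subset_succ (m : ℕ) : skel X m ⊆ skel X (m + 1) := fun _ hx => mem_skel_succ.2 (Or.inl hx)

lemma notMem_skel_of_mem_openCell {m : ℕ} {i : cell (Set.univ : Set X) m} {x : X}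
    (h : x ∈ openCell m i) : x ∉ skel X m := fun h' =>
  Set.disjoint_left.1 (RelCWComplex.disjoint_skeletonLT_openCell le_rfl) h' h

lemma eq_of_mem_openCell {m : ℕ} {i j : cell (Set.univ : Set X) m} {x : X}
    (hi : x ∈ openCell m i) (hj : x ∈ openCell m j) : i = j := by
  by_contra h
  exact Set.disjoint_left.1 (RelCWComplex.disjoint_openCell_of_ne (by simpa using h)) hi hj

lemma mem_closedCell_iff {m : ℕ} {i : cell (Set.univ : Set X) m} {x : X} (hx : x ∉ skel X m) :
    x ∈ closedCell m i ↔ x ∈ openCell m i := by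
  refine ⟨fun h => ?_, fun h => RelCWComplex.openCell_subset_closedCell _ _ h⟩
  rw [← RelCWComplex.cellFrontier_union_openCell_eq_closedCell] at h
  exact h.resolve_left fun h' => hx (RelCWComplex.cellFrontier_subset_skeletonLT _ _ h')

lemma disjoint_openCell_closedCell {m : ℕ} {i j : cell (Set.univ : Set X) m} (h : i ≠ j) :
    Disjoint (openCell m i) (closedCell m j) :=
  Set.disjoint_left.2 fun _ hi hj => h (eq_of_mem_openCell hi
    ((mem_closedCell_iff (notMem_skel_of_mem_openCell hi)).1 hj))

lemma charMap_mem_skel {m : ℕ} (i : cell (Set.univ : Set X) m) {y : Fin m → ℝ} (hy : ‖y‖ = 1) :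
    charMap m i y ∈ skel X m :=
  RelCWComplex.cellFrontier_subset_skeletonLT m i ⟨y, by simpa using hy, rfl⟩

lemma charMap_mem_openCell {m : ℕ} (i : cell (Set.univ : Set X) m) {y : Fin m → ℝ} (hy : ‖y‖ < 1) :
    charMap m i y ∈ openCell m i := ⟨y, by simpa using hy, rfl⟩

lemma charMap_mem_skel_succ {m : ℕ} (i : cell (Set.univ : Set X) m) {y : Fin m → ℝ}
    (hy : ‖y‖ ≤ 1) : charMap m i y ∈ skel X (m + 1) := by
  rcases hy.lt_or_eq with h | h
  · exact mem_skel_succ.2 (Or.inr ⟨i, charMap_mem_openCell i h⟩)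
  · exact skel_subset_succ m (charMap_mem_skel i h)

lemma charMap_injOn {m : ℕ} (i : cell (Set.univ : Set X) m) :
    Set.InjOn (charMap m i) (Metric.ball 0 1) := by
  have := (charMap m i).injOn
  rwa [RelCWComplex.source_eq] at this

/-- The centers of the cells of dimension `m`. -/
def centers (X : Type u) [TopologicalSpace X] [CWComplex (Set.univ : Set X)] (m : ℕ) : Set X :=
  Set.range fun i : cell (Set.univ : Set X) m => charMap m i 0

lemma charMap_mem_centers {m : ℕ} {i : cell (Set.univ : Set X) m} {y : Fin m → ℝ} (hy : ‖y‖ ≤ 1) :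
    charMap m i y ∈ centers X m ↔ y = 0 := by
  constructor
  · rintro ⟨j, hj⟩
    have h0 : charMap m j 0 ∈ openCell m j := charMap_mem_openCell j (by simp)
    rcases hy.lt_or_eq with h | h
    · have h1 := charMap_mem_openCell i h
      change charMap m j 0 = _ at hj
      rw [← hj] at h1
      obtain rfl := eq_of_mem_openCell h0 h1
      exact (charMap_injOn j (by simp) (by simpa using h) hj).symm
    · have h1 := charMap_mem_skel i h
      change charMap m j 0 = _ at hj
      rw [← hj] at h1
      exact absurd h1 (notMem_skel_of_mem_openCell h0)
  · rintro rfl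
    exact ⟨i, rfl⟩

lemma notMem_centers_of_mem_skel {m : ℕ} {x : X} (hx : x ∈ skel X m) : x ∉ centers X m := by
  rintro ⟨i, rfl⟩
  exact notMem_skel_of_mem_openCell (charMap_mem_openCell i (by simp)) hx

/-! ### Cellular self-maps -/

/-- A self-map permuting the characteristic maps of a CW complex. -/
def PermutesCells (r : C(X, X)) (ρ : ∀ m, cell (Set.univ : Set X) m → cell (Set.univ : Set X) m) :
    Prop :=
  ∀ m i, ∀ x ∈ Metric.closedBall (0 : Fin m → ℝ) 1, charMap m (ρ m i) x = r (charMap m i x)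

variable {r : C(X, X)} {ρ : ∀ m, cell (Set.univ : Set X) m → cell (Set.univ : Set X) m}

lemma PermutesCells.mem_openCell (h : PermutesCells r ρ) {m : ℕ} {i : cell (Set.univ : Set X) m}
    {x : X} (hx : x ∈ openCell m i) : r x ∈ openCell m (ρ m i) := by
  obtain ⟨y, hy, rfl⟩ := hx
  exact ⟨y, hy, h m i y (Metric.ball_subset_closedBall hy)⟩

lemma PermutesCells.mapsTo_skel (h : PermutesCells r ρ) (m : ℕ) :
    Set.MapsTo r (skel X m) (skel X m) := by
  intro x hx
  simp only [skel, SetLike.mem_coe, CWComplex.mem_skeletonLT_iff] at hx ⊢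
  obtain ⟨k, hk, j, hj⟩ := hx
  exact ⟨k, hk, _, h.mem_openCell hj⟩

lemma PermutesCells.iterate_mem_openCell (h : PermutesCells r ρ) {m : ℕ}
    {i : cell (Set.univ : Set X) m} {x : X} (hx : x ∈ openCell m i) (j : ℕ) :
    r^[j] x ∈ openCell m ((ρ m)^[j] i) := by
  induction j with
  | zero => exact hx
  | succ j ih =>
    rw [Function.iterate_succ_apply', Function.iterate_succ_apply']
    exact h.mem_openCell ih

section Finite

variable [CWComplex.Finite (Set.univ : Set X)]

lemma isClosed_skel (m : ℕ) : IsClosed (skel X m) :=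
  RelCWComplex.Subcomplex.closed (skeletonLT (Set.univ : Set X) (m : ℕ∞))

lemma finite_cell (m : ℕ) : Finite (cell (Set.univ : Set X) m) :=
  RelCWComplex.FiniteType.finite_cell m

/-- Connected subsets of a union of open cells of a fixed dimension lie in one of them. -/
lemma exists_forall_mem_openCell {m n : ℕ} (σ : Simp (n + 1) X)
    (hσ : ∀ t, ∃ i : cell (Set.univ : Set X) m, σ t ∈ openCell m i) :
    ∃ i : cell (Set.univ : Set X) m, ∀ t, σ t ∈ openCell m i := by
  have := finite_cell (X := X) m
  -- Points of open `m`-cells avoid the cells of lower dimension, so along `σ` membership in a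
  -- closed cell is membership in its interior. The preimages of the open cells are thus closed, and
  -- also open as there are finitely many.
  have hmem : ∀ t i, σ t ∈ closedCell m i ↔ σ t ∈ openCell m i := fun t i => by
    obtain ⟨j, hj⟩ := hσ t
    exact mem_closedCell_iff (notMem_skel_of_mem_openCell hj)
  have hcl : ∀ i : cell (Set.univ : Set X) m, IsClosed {t | σ t ∈ openCell m i} := by
    intro i
    have : {t | σ t ∈ openCell m i} = σ ⁻¹' closedCell m i := by
      ext t
      exact (hmem t i).symm
    rw [this]
    exact RelCWComplex.isClosed_closedCell.preimage σ.continuous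
  obtain ⟨i, hi⟩ := hσ (stdSimplex.vertex 0)
  have hop : IsOpen {t | σ t ∈ openCell m i} := by
    have : {t | σ t ∈ openCell m i} = (⋃ j ∈ {j | j ≠ i}, {t | σ t ∈ openCell m j})ᶜ := by
      ext t
      simp only [Set.mem_ofPred_eq, Set.mem_compl_iff, Set.mem_iUnion, exists_prop, not_exists,
        not_and]
      constructor
      · intro h j hj hj'
        exact hj (eq_of_mem_openCell hj' h)
      · intro h
        obtain ⟨j, hj⟩ := hσ t
        by_cases hji : j = i
        · rwa [hji] at hj
        · exact absurd hj (h j hji)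
    rw [this]
    exact ((Set.toFinite _).isClosed_biUnion fun j _ => hcl j).isOpen_compl
  refine ⟨i, fun t => ?_⟩
  have := IsClopen.eq_univ ⟨hcl i, hop⟩ ⟨_, hi⟩
  exact this.ge (Set.mem_univ t)

/-- Invariant cycles in a union of pieces of open cells that are permuted freely. -/
lemma boundsInv_iUnion_image_charMap {p : ℕ} (hp : p.Prime) (hr : r^[p] = id)
    (hρ : PermutesCells r ρ) {m : ℕ} (hρp : (ρ m)^[p] = id) (hfree : ∀ i, ρ m i ≠ i)
    {P : Set (Fin m → ℝ)} (hP : P ⊆ Metric.ball 0 1) {n : ℕ}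
    (h : BoundsInv (ContinuousMap.id (Fin m → ℝ)) 0 P (n + 2)) :
    BoundsInv r 0 (⋃ i : cell (Set.univ : Set X) m, charMap m i '' P) (n + 2) := by
  classical
  have := finite_cell (X := X) m
  have hPo : ∀ i : cell (Set.univ : Set X) m, charMap m i '' P ⊆ openCell m i := fun i =>
    Set.image_mono hP
  have hrP : ∀ (i : cell (Set.univ : Set X) m) x, x ∈ charMap m i '' P →
      r x ∈ charMap m (ρ m i) '' P := by
    rintro i _ ⟨y, hy, rfl⟩
    exact ⟨y, hy, hρ m i y (Metric.ball_subset_closedBall (hP hy))⟩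
  have hrPj : ∀ (i : cell (Set.univ : Set X) m) x (j : ℕ), x ∈ charMap m i '' P →
      r^[j] x ∈ charMap m ((ρ m)^[j] i) '' P := by
    intro i x j hx
    induction j with
    | zero => exact hx
    | succ j ih =>
      rw [Function.iterate_succ_apply', Function.iterate_succ_apply']
      exact hrP _ _ ih
  -- `D` represents the orbits of cells. A simplex in the union lies in a single cell by
  -- connectedness, so exactly one power of `r` carries it to the pieces of cells in `D`.
  obtain ⟨D, hD⟩ := exists_fundamental_set hp hρp
  have hfin : D.Finite := Set.toFinite D
  have hB := boundsInv_biUnion (fun i : cell (Set.univ : Set X) m => charMap m i '' P)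
    (fun i => closedCell m i) (fun i => RelCWComplex.isClosed_closedCell)
    (fun i => (hPo i).trans (RelCWComplex.openCell_subset_closedCell _ _))
    (fun i j hij => (disjoint_openCell_closedCell hij).mono_left (hPo i))
    (fun i => boundsInv_image_charMap i hP h) hfin.toFinset
  refine hB.of_free hp.pos hr ?_ ?_ ?_
  · intro x hx
    obtain ⟨i, hi⟩ := Set.mem_iUnion.1 hx
    exact Set.mem_iUnion.2 ⟨_, hrP i x hi⟩
  · exact Set.iUnion₂_subset fun i _ => Set.subset_iUnion (fun i => charMap m i '' P) i
  · intro k σ hσ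
    obtain ⟨i, hi⟩ := exists_forall_mem_openCell σ fun t => by
      obtain ⟨i, hi⟩ := Set.mem_iUnion.1 (hσ t)
      exact ⟨i, hPo i hi⟩
    have hiP : ∀ t, σ t ∈ charMap m i '' P := fun t => by
      obtain ⟨j, hj⟩ := Set.mem_iUnion.1 (hσ t)
      obtain rfl := eq_of_mem_openCell (hi t) (hPo j hj)
      exact hj
    have key : ∀ j, (∀ t, r^[j] (σ t) ∈ ⋃ i ∈ hfin.toFinset, charMap m i '' P) ↔
        (ρ m)^[j] i ∈ D := by
      intro j
      constructor
      · intro h1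
        obtain ⟨l, hl, hl'⟩ := Set.mem_iUnion₂.1 (h1 (stdSimplex.vertex 0))
        have := eq_of_mem_openCell (hPo _ hl') (hρ.iterate_mem_openCell (hi _) j)
        rw [← this]
        exact hfin.mem_toFinset.1 hl
      · intro h1 t
        exact Set.mem_iUnion₂.2 ⟨_, hfin.mem_toFinset.2 h1, hrPj i _ j (hiP t)⟩
    simp only [key]
    exact hD i (hfree i)

end Finite

end SingularChains

end

/-! ### Radial retraction onto skeleta; vanishing of invariant homology in high degrees. -/

noncomputable section

namespace SingularChains

open RelCWComplex (cell openCell closedCell cellFrontier skeletonLT)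

/-- Continuity can be checked after composing with a continuous map from a compact set. -/
lemma continuousOn_of_comp_isCompact {E Y Z : Type*} [TopologicalSpace E] [TopologicalSpace Y]
    [T2Space Y] [TopologicalSpace Z] {K : Set E} (hK : IsCompact K) {φ : E → Y}
    (hφ : ContinuousOn φ K) {W : Set Y} {f : Y → Z} (hf : ContinuousOn (f ∘ φ) (K ∩ φ ⁻¹' W)) :
    ContinuousOn f (W ∩ φ '' K) := by
  rw [continuousOn_iff_isClosed] at hf ⊢
  intro t ht
  obtain ⟨u, hu, hut⟩ := hf t ht
  refine ⟨φ '' (K ∩ u), ((hK.inter_right hu).image_of_continuousOn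
    (hφ.mono Set.inter_subset_left)).isClosed, ?_⟩
  ext y
  constructor
  · rintro ⟨hy, hyW, x, hxK, rfl⟩
    exact ⟨⟨x, ⟨hxK, (hut.le ⟨hy, hxK, hyW⟩).1⟩, rfl⟩, hyW, x, hxK, rfl⟩
  · rintro ⟨⟨x, ⟨hxK, hxu⟩, rfl⟩, hyW, h⟩
    exact ⟨(hut.ge ⟨hxu, hxK, hyW⟩).1, hyW, h⟩

variable {X : Type u} [TopologicalSpace X] [T2Space X] [CWComplex (Set.univ : Set X)]
variable {r : C(X, X)} {ρ : ∀ m, cell (Set.univ : Set X) m → cell (Set.univ : Set X) m}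

/-- The factor by which the radial homotopy scales a vector of the punctured unit ball. -/
def radialFactor {m : ℕ} (y : Fin m → ℝ) (t : unitInterval) : ℝ := (1 - t : ℝ) + t * ‖y‖⁻¹

lemma norm_radialFactor_smul {m : ℕ} {y : Fin m → ℝ} (hy : y ≠ 0) (t : unitInterval) :
    ‖radialFactor y t • y‖ = (1 - t : ℝ) * ‖y‖ + t := by
  have h1 : 0 < ‖y‖ := norm_pos_iff.2 hy
  have h2 : (0 : ℝ) ≤ t := t.2.1
  have h3 : (0 : ℝ) ≤ 1 - t := by linarith [t.2.2]
  have h4 : 0 ≤ radialFactor y t := by unfold radialFactor; positivity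
  rw [norm_smul, Real.norm_of_nonneg h4, radialFactor]
  field_simp

lemma norm_radialFactor_smul_le {m : ℕ} {y : Fin m → ℝ} (hy : y ≠ 0) (hy1 : ‖y‖ ≤ 1)
    (t : unitInterval) : ‖radialFactor y t • y‖ ≤ 1 := by
  rw [norm_radialFactor_smul hy]
  have h2 : (0 : ℝ) ≤ t := t.2.1
  have h3 : (t : ℝ) ≤ 1 := t.2.2
  nlinarith

lemma radialFactor_smul_ne_zero {m : ℕ} {y : Fin m → ℝ} (hy : y ≠ 0) (t : unitInterval) :
    radialFactor y t • y ≠ 0 := by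
  rw [← norm_pos_iff, norm_radialFactor_smul hy]
  have h1 : 0 < ‖y‖ := norm_pos_iff.2 hy
  have h2 : (0 : ℝ) ≤ t := t.2.1
  have h3 : (0 : ℝ) ≤ 1 - t := by linarith [t.2.2]
  rcases h2.eq_or_lt with h | h
  · simpa [← h] using hy
  · positivity

open Classical in
/-- The radial homotopy pushing the punctured cells of dimension `m` to their boundaries. -/
def radial (m : ℕ) (p : X × unitInterval) : X :=
  if h : ∃ i : cell (Set.univ : Set X) m, p.1 ∈ openCell m i then
    charMap m h.choose
      (radialFactor ((charMap m h.choose).symm p.1) p.2 • (charMap m h.choose).symm p.1)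
  else p.1

lemma radial_of_mem_skel {m : ℕ} {x : X} (hx : x ∈ skel X m) (t : unitInterval) :
    radial m (x, t) = x := by
  rw [radial, dif_neg]
  rintro ⟨i, hi⟩
  exact notMem_skel_of_mem_openCell hi hx

/-- The formula persists on the boundary sphere, where the factor is one. This makes the homotopy
accessible on whole closed cells and glues it to the constant homotopy on the lower skeleton. -/
lemma radial_charMap {m : ℕ} (i : cell (Set.univ : Set X) m) {y : Fin m → ℝ} (hy : ‖y‖ ≤ 1)
    (t : unitInterval) :
    radial m (charMap m i y, t) = charMap m i (radialFactor y t • y) := by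
  rcases hy.lt_or_eq with h | h
  · have h0 : ∃ j : cell (Set.univ : Set X) m, charMap m i y ∈ openCell m j :=
      ⟨i, charMap_mem_openCell i h⟩
    have hc : h0.choose = i := eq_of_mem_openCell h0.choose_spec (charMap_mem_openCell i h)
    have hs : (charMap m i).symm (charMap m i y) = y := (charMap m i).left_inv (by
      rw [RelCWComplex.source_eq]; simpa using h)
    rw [radial, dif_pos h0, hc]
    dsimp only
    rw [hs]
  · rw [radial_of_mem_skel (charMap_mem_skel i h), radialFactor, h]
    simp

lemma PermutesCells.radial (h : PermutesCells r ρ) {m : ℕ} {x : X} (hx : x ∈ skel X (m + 1))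
    (hx' : x ∉ centers X m) (t : unitInterval) : radial m (r x, t) = r (radial m (x, t)) := by
  rcases mem_skel_succ.1 hx with h1 | ⟨i, y, hy, rfl⟩
  · rw [radial_of_mem_skel h1, radial_of_mem_skel (h.mapsTo_skel m h1)]
  · have hy1 : ‖y‖ ≤ 1 := by simpa using Metric.ball_subset_closedBall hy
    have hy0 : y ≠ 0 := mt (charMap_mem_centers hy1).2 hx'
    rw [radial_charMap i hy1, ← h m i y (by simpa using hy1),
      ← h m i _ (by simpa using norm_radialFactor_smul_le hy0 hy1 t), radial_charMap _ hy1]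

lemma radial_mem {m : ℕ} {x : X} (hx : x ∈ skel X (m + 1)) (hx' : x ∉ centers X m)
    (t : unitInterval) : radial m (x, t) ∈ skel X (m + 1) ∩ (centers X m)ᶜ := by
  rcases mem_skel_succ.1 hx with h1 | ⟨i, y, hy, rfl⟩
  · rw [radial_of_mem_skel h1]
    exact ⟨hx, hx'⟩
  · have hy1 : ‖y‖ ≤ 1 := by simpa using Metric.ball_subset_closedBall hy
    have hy0 : y ≠ 0 := mt (charMap_mem_centers hy1).2 hx'
    have hn := norm_radialFactor_smul_le hy0 hy1 t
    rw [radial_charMap i hy1]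
    exact ⟨charMap_mem_skel_succ i hn,
      mt (charMap_mem_centers hn).1 (radialFactor_smul_ne_zero hy0 t)⟩

lemma radial_zero {m : ℕ} {x : X} (hx : x ∈ skel X (m + 1)) (hx' : x ∉ centers X m) :
    radial m (x, 0) = x := by
  rcases mem_skel_succ.1 hx with h1 | ⟨i, y, hy, rfl⟩
  · rw [radial_of_mem_skel h1]
  · have hy1 : ‖y‖ ≤ 1 := by simpa using Metric.ball_subset_closedBall hy
    rw [radial_charMap i hy1, radialFactor]
    simp

lemma radial_one_mem {m : ℕ} {x : X} (hx : x ∈ skel X (m + 1)) (hx' : x ∉ centers X m) :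
    radial m (x, 1) ∈ skel X m := by
  rcases mem_skel_succ.1 hx with h1 | ⟨i, y, hy, rfl⟩
  · rwa [radial_of_mem_skel h1]
  · have hy1 : ‖y‖ ≤ 1 := by simpa using Metric.ball_subset_closedBall hy
    have hy0 : y ≠ 0 := mt (charMap_mem_centers hy1).2 hx'
    rw [radial_charMap i hy1]
    exact charMap_mem_skel i (by rw [norm_radialFactor_smul hy0]; simp)

/-- The closed cell times the interval is the image of a compact product, so continuity may be
checked on the closed ball, where the homotopy is an explicit scaling. -/
lemma continuousOn_radial_closedCell {m : ℕ} (i : cell (Set.univ : Set X) m) :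
    ContinuousOn (radial m) (((centers X m)ᶜ ×ˢ Set.univ : Set (X × unitInterval)) ∩
      closedCell m i ×ˢ Set.univ) := by
  have hK : IsCompact (Metric.closedBall (0 : Fin m → ℝ) 1 ×ˢ (Set.univ : Set unitInterval)) :=
    (isCompact_closedBall _ _).prod isCompact_univ
  have hφ : ContinuousOn (Prod.map (charMap m i) (id : unitInterval → unitInterval))
      (Metric.closedBall (0 : Fin m → ℝ) 1 ×ˢ Set.univ) :=
    (RelCWComplex.continuousOn m i).prodMap continuousOn_id
  have himg : closedCell m i ×ˢ (Set.univ : Set unitInterval) =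
      Prod.map (charMap m i) id '' (Metric.closedBall (0 : Fin m → ℝ) 1 ×ˢ Set.univ) := by
    rw [Set.prodMap_image_prod, Set.image_id]
    rfl
  rw [himg]
  refine continuousOn_of_comp_isCompact hK hφ ?_
  have hne : ∀ p ∈ (Metric.closedBall (0 : Fin m → ℝ) 1 ×ˢ (Set.univ : Set unitInterval)) ∩
      Prod.map (charMap m i) id ⁻¹' ((centers X m)ᶜ ×ˢ Set.univ), ‖p.1‖ ≤ 1 ∧ p.1 ≠ 0 := by
    rintro ⟨y, t⟩ ⟨⟨hy, -⟩, hy', -⟩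
    have hy1 : ‖y‖ ≤ 1 := by simpa using hy
    exact ⟨hy1, mt (charMap_mem_centers hy1).2 hy'⟩
  refine ContinuousOn.congr (f := fun p : (Fin m → ℝ) × unitInterval =>
      charMap m i (radialFactor p.1 p.2 • p.1)) ?_
    fun p hp => radial_charMap i (hne p hp).1 p.2
  refine (RelCWComplex.continuousOn m i).comp ?_ fun p hp => by
    simpa using norm_radialFactor_smul_le (hne p hp).2 (hne p hp).1 p.2
  refine ContinuousOn.fun_smul ?_ continuousOn_fst
  have ht : Continuous fun p : (Fin m → ℝ) × unitInterval => (p.2 : ℝ) :=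
    continuous_subtype_val.comp continuous_snd
  exact (continuous_const.sub ht).continuousOn.add (ht.continuousOn.mul
    (continuousOn_fst.norm.inv₀ fun p hp => norm_ne_zero_iff.2 (hne p hp).2))

variable [CWComplex.Finite (Set.univ : Set X)]

/-- Gluing along a finite closed cover: the index `none` stands for the lower skeleton and `some i`
for the closed cell `i`. -/
lemma continuous_radial (m : ℕ) :
    Continuous fun p : (skel X (m + 1) ∩ (centers X m)ᶜ : Set X) × unitInterval =>
      radial m ((p.1 : X), p.2) := by
  have := finite_cell (X := X) m
  let ι : (skel X (m + 1) ∩ (centers X m)ᶜ : Set X) × unitInterval → X × unitInterval :=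
    Prod.map Subtype.val id
  have hι : Continuous ι := continuous_subtype_val.prodMap continuous_id
  let C : Option (cell (Set.univ : Set X) m) → Set X := fun o => o.elim (skel X m) (closedCell m)
  refine (locallyFinite_of_finite fun o => ι ⁻¹' (C o ×ˢ Set.univ)).continuous ?_ ?_ ?_
  · refine Set.eq_univ_of_forall ?_
    rintro ⟨⟨x, hx, hx'⟩, t⟩
    rcases mem_skel_succ.1 hx with h1 | ⟨i, hi⟩
    · exact Set.mem_iUnion.2 ⟨none, h1, trivial⟩
    · exact Set.mem_iUnion.2 ⟨some i, RelCWComplex.openCell_subset_closedCell _ _ hi, trivial⟩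
  · rintro (_ | i)
    · exact ((isClosed_skel m).prod isClosed_univ).preimage hι
    · exact (RelCWComplex.isClosed_closedCell.prod isClosed_univ).preimage hι
  · rintro (_ | i)
    · refine ContinuousOn.congr (f := fun p => (p.1 : X))
        (continuous_subtype_val.comp continuous_fst).continuousOn fun p hp => ?_
      exact radial_of_mem_skel hp.1 _
    · exact (continuousOn_radial_closedCell i).comp hι.continuousOn fun p hp =>
        ⟨⟨p.1.2.2, trivial⟩, hp⟩

/-- Once the centers are removed, the skeleton deforms radially onto the previous one. The
deformation is equivariant because `r` carries characteristic maps to characteristic maps without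
changing the disc coordinate. -/
lemma BoundsInv.skel_diff_centers (hρ : PermutesCells r ρ) {q : ℤ} {m n : ℕ}
    (h : BoundsInv r q (skel X m) n) :
    BoundsInv r q (skel X (m + 1) ∩ (centers X m)ᶜ) n := by
  have hA : Set.MapsTo r (skel X (m + 1) ∩ (centers X m)ᶜ) (skel X (m + 1) ∩ (centers X m)ᶜ) := by
    rintro x ⟨hx, hx'⟩
    refine ⟨hρ.mapsTo_skel _ hx, ?_⟩
    rcases mem_skel_succ.1 hx with h1 | ⟨i, y, hy, rfl⟩
    · exact notMem_centers_of_mem_skel (hρ.mapsTo_skel _ h1)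
    · have hy1 : ‖y‖ ≤ 1 := by simpa using Metric.ball_subset_closedBall hy
      have h2 := mt (charMap_mem_centers hy1).2 hx'
      rw [← hρ m i y (by simpa using hy1)]
      exact mt (charMap_mem_centers hy1).1 h2
  have hc := continuous_radial (X := X) m
  have hg : ∀ y : skel X m, (y : X) ∈ skel X (m + 1) ∩ (centers X m)ᶜ := fun y =>
    ⟨skel_subset_succ m y.2, notMem_centers_of_mem_skel y.2⟩
  have hf : ∀ x : (skel X (m + 1) ∩ (centers X m)ᶜ : Set X), radial m ((x : X), 1) ∈ skel X m :=
    fun x => radial_one_mem x.2.1 x.2.2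
  have hH : ∀ p : (skel X (m + 1) ∩ (centers X m)ᶜ : Set X) × unitInterval,
      radial m ((p.1 : X), p.2) ∈ skel X (m + 1) ∩ (centers X m)ᶜ :=
    fun p => radial_mem p.1.2.1 p.1.2.2 p.2
  exact BoundsInv.of_homotopyOn hA (hρ.mapsTo_skel m)
    ⟨fun x => ⟨_, hf x⟩,
      (hc.comp (continuous_id.prodMk continuous_const)).subtype_mk hf⟩
    ⟨fun y => ⟨y, hg y⟩, continuous_subtype_val.subtype_mk hg⟩
    ⟨fun p => ⟨_, hH p⟩, hc.subtype_mk hH⟩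
    (fun x => hρ.radial x.2.1 x.2.2 1) (fun _ => rfl) (fun x t => hρ.radial x.2.1 x.2.2 t)
    (fun x => Subtype.ext (radial_zero x.2.1 x.2.2)) (fun _ => rfl) h

/-- `skel X 1` consists of the cells of dimension less than one, and a simplex in it stays in a
single zero-cell by connectedness. -/
lemma allConst_skel_one : AllConst (skel X 1) := by
  intro n σ hσ s t
  cases n with
  | zero => exact absurd s.2 (by simp [stdSimplex])
  | succ n =>
    have h0 : ∀ x : X, x ∉ skel X 0 := by
      intro x hx
      simp only [skel, SetLike.mem_coe, CWComplex.mem_skeletonLT_iff] at hx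
      obtain ⟨k, hk, -⟩ := hx
      exact absurd hk (by simp)
    obtain ⟨i, hi⟩ := exists_forall_mem_openCell σ fun t =>
      (mem_skel_succ.1 (hσ t)).resolve_left (h0 _)
    obtain ⟨y, -, hy⟩ := hi s
    obtain ⟨z, -, hz⟩ := hi t
    rw [← hy, ← hz, Subsingleton.elim y z]

/-- The homology of the invariant chains of a skeleton vanishes in large degrees if the action is
free on the set of cells of positive dimension. -/
lemma boundsInv_skel {p : ℕ} (hp : p.Prime) (hr : r^[p] = id) (hρ : PermutesCells r ρ)
    (hρp : ∀ m, (ρ m)^[p] = id) (hfree : ∀ m i, ρ (m + 1) i ≠ i) (m : ℕ) :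
    ∀ n, m + 1 < n → BoundsInv r 0 (skel X (m + 1)) n := by
  induction m with
  | zero =>
    intro n hn
    obtain ⟨n, rfl⟩ := Nat.exists_eq_add_of_le' (show 2 ≤ n by omega)
    exact BoundsInv.of_allConst allConst_skel_one r 0 n
  | succ m ih =>
    intro n hn
    obtain ⟨n, rfl⟩ := Nat.exists_eq_add_of_le' (show 3 ≤ n by omega)
    have hcells : skel X (m + 2) ∩ (skel X (m + 1))ᶜ =
        ⋃ i : cell (Set.univ : Set X) (m + 1), charMap (m + 1) i '' Metric.ball 0 1 := by
      ext x
      rw [Set.mem_inter_iff, mem_skel_succ, Set.mem_compl_iff, Set.mem_iUnion]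
      constructor
      · rintro ⟨h1 | h1, h2⟩
        · exact absurd h1 h2
        · exact h1
      · rintro ⟨i, hi⟩
        exact ⟨Or.inr ⟨i, hi⟩, notMem_skel_of_mem_openCell hi⟩
    have hcells' : (skel X (m + 2) ∩ (skel X (m + 1))ᶜ) ∩
          (skel X (m + 2) ∩ (centers X (m + 1))ᶜ) =
        ⋃ i : cell (Set.univ : Set X) (m + 1), charMap (m + 1) i '' (Metric.ball 0 1 \ {0}) := by
      ext x
      rw [Set.mem_inter_iff, hcells, Set.mem_iUnion, Set.mem_iUnion]
      constructor
      · rintro ⟨⟨i, y, hy, rfl⟩, -, h⟩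
        have hy1 : ‖y‖ ≤ 1 := by simpa using Metric.ball_subset_closedBall hy
        exact ⟨i, y, ⟨hy, mt (charMap_mem_centers hy1).2 h⟩, rfl⟩
      · rintro ⟨i, y, ⟨hy, hy0⟩, rfl⟩
        have hy1 : ‖y‖ ≤ 1 := by simpa using Metric.ball_subset_closedBall hy
        exact ⟨⟨i, y, hy, rfl⟩, charMap_mem_skel_succ i hy1, mt (charMap_mem_centers hy1).1 hy0⟩
    -- One piece is the disjoint union of the open top cells, the other retracts onto the lower
    -- skeleton, and they meet in the punctured top cells.
    refine BoundsInv.mayerVietoris (A := (skel X (m + 1))ᶜ) (B := (centers X (m + 1))ᶜ)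
      (isClosed_skel _).isOpen_compl ?_ ?_ ?_ ?_ ?_ ?_
    · have := finite_cell (X := X) (m + 1)
      exact (Set.finite_range _).isClosed.isOpen_compl
    · intro x _
      by_cases hx : x ∈ skel X (m + 1)
      · exact Or.inr (notMem_centers_of_mem_skel hx)
      · exact Or.inl hx
    · refine preimage_eq_of_iterate_eq_id hp.pos hr ?_
      rw [hcells]
      intro x hx
      obtain ⟨i, hi⟩ := Set.mem_iUnion.1 hx
      exact Set.mem_iUnion.2 ⟨_, hρ.mem_openCell hi⟩
    · rw [hcells]
      exact boundsInv_iUnion_image_charMap hp hr hρ (hρp _) (hfree _) subset_rfl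
        (boundsInv_ball _ _)
    · exact (ih _ (by omega)).skel_diff_centers hρ
    -- A punctured ball of dimension `m + 1` has reduced homology only on cycles with `m + 1`
    -- vertices, whereas those arising here have `n + 2 > m + 1` vertices.
    · rw [hcells']
      exact boundsInv_iUnion_image_charMap hp hr hρ (hρp _) (hfree _) Set.sdiff_subset
        (boundsInv_ball_diff (by omega))

lemma exists_skel_eq_univ (X : Type u) [TopologicalSpace X] [T2Space X]
    [CWComplex (Set.univ : Set X)] [CWComplex.Finite (Set.univ : Set X)] :
    ∃ N, skel X (N + 1) = Set.univ := by
  obtain ⟨N, hN⟩ := Filter.eventually_atTop.1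
    (RelCWComplex.FiniteDimensional.eventually_isEmpty_cell (C := (Set.univ : Set X)) (D := ∅))
  refine ⟨N, Set.eq_univ_of_forall fun x => ?_⟩
  have hx : x ∈ ⋃ (n : ℕ) (j : cell (Set.univ : Set X) n), openCell n j := by
    rw [CWComplex.iUnion_openCell_eq_complex]
    trivial
  obtain ⟨n, j, hj⟩ := Set.mem_iUnion₂.1 hx
  simp only [skel, SetLike.mem_coe, CWComplex.mem_skeletonLT_iff]
  refine ⟨n, ?_, j, hj⟩
  by_contra h
  have h' : N + 1 ≤ n := by exact_mod_cast not_lt.1 h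
  exact (hN n (by omega)).false j

lemma exists_boundsInv_univ {p : ℕ} (hp : p.Prime) (hr : r^[p] = id) (hρ : PermutesCells r ρ)
    (hρp : ∀ m, (ρ m)^[p] = id) (hfree : ∀ m i, ρ (m + 1) i ≠ i) :
    ∃ N, ∀ n, N ≤ n → BoundsInv r 0 Set.univ n := by
  obtain ⟨N, hN⟩ := exists_skel_eq_univ X
  refine ⟨N + 2, fun n hn => ?_⟩
  rw [← hN]
  exact boundsInv_skel hp hr hρ hρp hfree N n (by omega)

end SingularChains

end

/-! ### The periodic resolution on singular chains. -/

noncomputable section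

namespace SingularChains

variable {X : Type*} [TopologicalSpace X] {p : ℕ} {r s : C(X, X)}

/-! ### Zigzags -/

/-- The maps of the periodic resolution of a cyclic group, on singular chains. -/
def periodicMap (p : ℕ) (r : C(X, X)) (j n : ℕ) : Module.End ℤ (Chain n X) :=
  if Even j then chainMap r n - 1 else chainNorm p r n

lemma periodicMap_of_even {j : ℕ} (hj : Even j) (n : ℕ) (c : Chain n X) :
    periodicMap p r j n c = chainMap r n c - c := by
  rw [periodicMap, if_pos hj]
  rfl

lemma periodicMap_of_odd {j : ℕ} (hj : ¬ Even j) (n : ℕ) (c : Chain n X) :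
    periodicMap p r j n c = chainNorm p r n c := by
  rw [periodicMap, if_neg hj]

lemma bd_periodicMap (p : ℕ) (r : C(X, X)) (j n : ℕ) (c : Chain (n + 1) X) :
    bd n (periodicMap p r j (n + 1) c) = periodicMap p r j n (bd n c) := by
  by_cases hj : Even j
  · rw [periodicMap_of_even hj, periodicMap_of_even hj, map_sub, bd_chainMap]
  · rw [periodicMap_of_odd hj, periodicMap_of_odd hj, bd_chainNorm]

lemma periodicMap_succ_periodicMap (hr : r^[p] = id) (j n : ℕ) (c : Chain n X) :
    periodicMap p r (j + 1) n (periodicMap p r j n c) = 0 := by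
  by_cases hj : Even j
  · rw [periodicMap_of_even hj, periodicMap_of_odd (by simpa [Nat.even_add_one] using hj), map_sub,
      chainNorm_chainMap hr, sub_self]
  · rw [periodicMap_of_odd hj, periodicMap_of_even (by simpa [Nat.even_add_one] using hj),
      chainMap_chainNorm hr, sub_self]

lemma periodicMap_add_two (j n : ℕ) : periodicMap p r (j + 2) n = periodicMap p r j n := by
  simp [periodicMap, Nat.even_add]

lemma fixed_iff_forall_mem {n : ℕ} {σ : Simp n X} :
    r.comp σ = σ ↔ ∀ t, σ t ∈ {x | r x = x} :=
  ⟨fun h t => congrArg (fun f : Simp n X => f t) h, fun h => ContinuousMap.ext h⟩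

lemma comp_ne_of_comp_ne (hp : 0 < p) (hr : r^[p] = id) {n : ℕ} {σ : Simp n X}
    (h : r.comp σ ≠ σ) : r.comp (r.comp σ) ≠ r.comp σ := by
  intro h'
  have hinj : Function.Injective fun σ : Simp n X => r.comp σ := by
    have h1 := iterate_comp_eq_id hr n
    obtain ⟨q, rfl⟩ := Nat.exists_eq_add_of_le' hp
    rw [Function.iterate_succ] at h1
    exact Function.LeftInverse.injective (congrFun h1)
  exact h (hinj h')

lemma mapsTo_fixed : Set.MapsTo r {x | r x = x} {x | r x = x} := fun _ hx => congrArg r hx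

lemma chainMap_mem_supported_moved (hp : 0 < p) (hr : r^[p] = id) {n : ℕ} {c : Chain n X}
    (hc : c ∈ Finsupp.supported ℤ ℤ {σ : Simp n X | r.comp σ ≠ σ}) :
    chainMap r n c ∈ Finsupp.supported ℤ ℤ {σ : Simp n X | r.comp σ ≠ σ} :=
  map_mem_of_mem_supported (chainMap r n) (fun σ hσ => by
    rw [chainMap_single]
    exact Finsupp.single_mem_supported ℤ _ (comp_ne_of_comp_ne hp hr hσ)) hc

lemma periodicMap_mem {n : ℕ} {M : Submodule ℤ (Chain n X)} (hM : ∀ c ∈ M, chainMap r n c ∈ M)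
    (j : ℕ) {c : Chain n X} (hc : c ∈ M) : periodicMap p r j n c ∈ M := by
  by_cases hj : Even j
  · rw [periodicMap_of_even hj]
    exact Submodule.sub_mem _ (hM _ hc) hc
  · rw [periodicMap_of_odd hj, chainNorm, normEnd, LinearMap.sum_apply]
    refine Submodule.sum_mem _ fun i hi => ?_
    clear hi
    induction i with
    | zero => exact hc
    | succ i ih =>
      rw [pow_succ', Module.End.mul_apply]
      exact hM _ ih

/-- Exactness of the periodic sequence modulo the chains of fixed simplices. -/
lemma exists_eq_periodicMap_add (hp : p.Prime) (hr : r^[p] = id) (j : ℕ) {n : ℕ} {x : Chain n X}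
    (hx : periodicMap p r j n x ∈ chainsIn {x | r x = x} n) :
    ∃ h, ∃ a ∈ chainsIn {x | r x = x} n, x = periodicMap p r (j + 1) n h + a := by
  obtain ⟨D, hD⟩ := exists_fundamental_set hp (iterate_comp_eq_id hr n)
  have hset : {σ : Simp n X | ∀ t, σ t ∈ {x | r x = x}} = {σ : Simp n X | r.comp σ ≠ σ}ᶜ := by
    ext σ
    simp only [Set.mem_compl_iff, Set.mem_ofPred_eq, not_not]
    exact fixed_iff_forall_mem.symm
  have hchains : chainsIn {x | r x = x} n =
      Finsupp.supported ℤ ℤ {σ : Simp n X | r.comp σ ≠ σ}ᶜ := by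
    rw [← hset]
    rfl
  set M := Finsupp.supported ℤ ℤ {σ : Simp n X | r.comp σ ≠ σ}
  -- Both the moved and the fixed simplices are preserved by `r`, so the moved part `y` has image
  -- zero. On it the group acts freely, and the periodic sequence is exact.
  set y := restrictTo {σ : Simp n X | r.comp σ ≠ σ} x
  have hy : y ∈ M := restrictTo_mem _ _
  have ha : x - y ∈ chainsIn {x | r x = x} n := by
    rw [hchains]
    exact sub_restrictTo_mem_compl _ _
  have hy0 : periodicMap p r j n y = 0 := by
    have h1 : periodicMap p r j n y ∈ M :=
      periodicMap_mem (fun c hc => chainMap_mem_supported_moved hp.pos hr hc) j hy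
    have h2 : periodicMap p r j n y ∈ chainsIn {x | r x = x} n := by
      have h3 : periodicMap p r j n y = periodicMap p r j n x - periodicMap p r j n (x - y) := by
        rw [map_sub, sub_sub_cancel]
      rw [h3]
      exact Submodule.sub_mem _ hx
        (periodicMap_mem (fun c hc => chainMap_mem_chainsIn mapsTo_fixed hc) j ha)
    rw [hchains] at h2
    exact (Submodule.disjoint_def.1 (Finsupp.disjoint_supported_supported
      disjoint_compl_right)) _ h1 h2
  obtain ⟨h, hh⟩ : ∃ h, periodicMap p r (j + 1) n h = y := by
    by_cases hj : Even j
    · rw [periodicMap_of_even hj, sub_eq_zero] at hy0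
      exact ⟨_, (periodicMap_of_odd (by simpa [Nat.even_add_one] using hj) _ _).trans
        (normEnd_restrictTo (iterate_comp_eq_id hr n) hD hy hy0)⟩
    · rw [periodicMap_of_odd hj] at hy0
      obtain ⟨h, hh⟩ := exists_sub_eq_of_normEnd_eq_zero (iterate_comp_eq_id hr n) hD hy hy0
      exact ⟨h, (periodicMap_of_even (by simpa [Nat.even_add_one] using hj) _ _).trans hh⟩
  exact ⟨h, x - y, ha, by rw [hh]; abel⟩

/-- The chain `c` is the end of a zigzag of length `j` that starts at `a`. -/
def Zigzag (p : ℕ) (r : C(X, X)) {n : ℕ} (a : Chain n X) : ∀ j, Chain (n + j + 1) X → Prop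
  | 0, c => bd n c = a
  | j + 1, c => ∃ c', Zigzag p r a j c' ∧ bd (n + j + 1) c = periodicMap p r j (n + j + 1) c'

variable {n : ℕ} {a b : Chain n X}

lemma Zigzag.add {j : ℕ} {c d : Chain (n + j + 1) X} (hc : Zigzag p r a j c)
    (hd : Zigzag p r b j d) : Zigzag p r (a + b) j (c + d) := by
  induction j with
  | zero =>
    change bd n _ = _
    rw [map_add, show bd n c = a from hc, show bd n d = b from hd]
  | succ j ih =>
    obtain ⟨c', hc', h1⟩ := hc
    obtain ⟨d', hd', h2⟩ := hd
    exact ⟨c' + d', ih hc' hd', by rw [map_add, map_add, h1, h2]⟩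

lemma Zigzag.sub_cycle {j : ℕ} {c z : Chain (n + j + 1) X} (hc : Zigzag p r a j c)
    (hz : bd (n + j) z = 0) : Zigzag p r a j (c - z) := by
  cases j with
  | zero =>
    change bd n _ = _
    rw [map_sub, show bd n c = a from hc, show bd n z = 0 from hz, sub_zero]
  | succ j =>
    obtain ⟨c', hc', h1⟩ := hc
    exact ⟨c', hc', by
      rw [map_sub, h1, show bd (n + j + 1) z = 0 from hz, sub_zero]⟩

/-- This cycle is the obstruction to prolonging the zigzag: the next chain exists exactly when it
bounds. -/
lemma Zigzag.bd_periodicMap (hr : r^[p] = id) (ha : chainMap r n a = a) {j : ℕ}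
    {c : Chain (n + j + 1) X} (hc : Zigzag p r a j c) :
    bd (n + j) (periodicMap p r j _ c) = 0 := by
  rw [SingularChains.bd_periodicMap]
  cases j with
  | zero =>
    rw [show bd (n + 0) c = a from hc, periodicMap_of_even Even.zero]
    exact sub_eq_zero.2 ha
  | succ j =>
    obtain ⟨c', hc', h1⟩ := hc
    rw [show bd (n + (j + 1)) c = _ from h1]
    exact periodicMap_succ_periodicMap hr _ _ _

/-- Uniqueness of zigzags. -/
lemma Zigzag.exists_cycle (hr : r^[p] = id) {j : ℕ} {d : Chain (n + j + 1) X}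
    (hd : Zigzag p r (0 : Chain n X) j d)
    (h : ∀ i < j, ∀ z : Chain (n + i + 1) X, bd (n + i) z = 0 → ∃ e, bd (n + i + 1) e = z) :
    ∃ z, bd (n + j) z = 0 ∧ periodicMap p r j _ z = periodicMap p r j _ d := by
  induction j with
  | zero => exact ⟨d, hd, rfl⟩
  | succ j ih =>
    obtain ⟨d', hd', h1⟩ := hd
    obtain ⟨z', hz', h2⟩ := ih hd' fun i hi => h i (hi.trans (Nat.lt_succ_self j))
    obtain ⟨e, he⟩ := h j (Nat.lt_succ_self j) z' hz'
    -- The previous term `d'` has the same image as the cycle `z' = ∂ e`. Subtracting the image of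
    -- `e` thus kills the boundary of `d`, and the following map of the resolution does not see this
    -- change.
    refine ⟨d - periodicMap p r j _ e, ?_, ?_⟩
    · change bd (n + j + 1) _ = 0
      rw [map_sub, h1, SingularChains.bd_periodicMap, he, h2, sub_self]
    · rw [map_sub, sub_eq_self]
      exact periodicMap_succ_periodicMap hr _ _ _

/-- The descent along a zigzag. -/
lemma Zigzag.descend (hp : p.Prime) (hr : r^[p] = id) {j : ℕ} {c : Chain (n + j + 1) X}
    (hc : Zigzag p r a j c) {f : Chain (n + j + 2) X} {g a' : Chain (n + j + 1) X}
    (ha' : a' ∈ chainsIn {x | r x = x} (n + j + 1))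
    (h : c = bd _ f + periodicMap p r (j + 1) _ g + a') :
    ∃ b, ∃ d ∈ chainsIn {x | r x = x} (n + 1), a = chainNorm p r n b + bd n d := by
  induction j with
  | zero =>
    refine ⟨bd n g, a', ha', ?_⟩
    have h1 : bd n c = a := hc
    rw [← h1, h, map_add, map_add, show bd n (bd (n + 0 + 1) f) = 0 from bd_bd n f, zero_add,
      ← bd_chainNorm, periodicMap_of_odd (by simp)]
  | succ j ih =>
    obtain ⟨c', hc', h1⟩ := hc
    have h' : @Eq (Chain (n + j + 1 + 1) X) c
      (bd (n + j + 1 + 1) f + periodicMap p r (j + 2) (n + j + 1 + 1) g + a') := h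
    rw [h', map_add, map_add, bd_bd, zero_add, periodicMap_add_two,
      SingularChains.bd_periodicMap] at h1
    -- Taking boundaries shows that the image of `c' - ∂ g` under the map of index `j` is `∂ a'`, a
    -- chain of fixed simplices. Exactness then puts `c'` in the same form as `c`, with `g` in the
    -- role of `f`.
    obtain ⟨g', a'', ha'', h2⟩ := exists_eq_periodicMap_add hp hr j
      (x := c' - bd (n + j + 1) g) (by
        rw [map_sub, ← h1, add_sub_cancel_left]
        exact bd_mem_chainsIn ha')
    exact ih hc' ha'' (f := g) (g := g')
      ((sub_eq_iff_eq_add'.1 h2).trans (add_assoc _ _ _).symm)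

/-- A long zigzag shows that its start is a norm up to chains of fixed simplices. -/
lemma Zigzag.exists_eq_chainNorm_add (hp : p.Prime) (hr : r^[p] = id) (ha : chainMap r n a = a)
    {j : ℕ} (hj : ¬ Even j) {c : Chain (n + j + 1) X} (hc : Zigzag p r a j c)
    (hb : BoundsInv r 0 Set.univ (n + j + 1)) :
    ∃ b, ∃ d ∈ chainsIn {x | r x = x} (n + 1), a = chainNorm p r n b + bd n d := by
  have h0 := hc.bd_periodicMap hr ha
  rw [periodicMap_of_odd hj] at h0
  -- The norm of `c` is an invariant cycle, hence `∂ e` with `e` invariant. Such an `e` is a norm `N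
  -- f` up to fixed simplices, so `N (c - ∂ f)` consists of fixed simplices, and exactness gives the
  -- form of `c` from which the descent starts.
  obtain ⟨e, he, hbe⟩ := hb.exists_bd (c := chainNorm p r _ c)
    ⟨mem_chainsIn_univ _, chainMap_chainNorm hr _ _⟩ h0
  have hodd : Even (j + 1) := by simpa [Nat.even_add_one] using hj
  obtain ⟨f, a', ha', h1⟩ := exists_eq_periodicMap_add hp hr (j + 1) (x := e) (by
    rw [periodicMap_of_even hodd, (mem_invIn.1 he).2, sub_self]
    exact Submodule.zero_mem _)
  rw [periodicMap_add_two, periodicMap_of_odd hj] at h1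
  obtain ⟨g, a'', ha'', h2⟩ := exists_eq_periodicMap_add hp hr j (x := c - bd _ f) (by
    rw [map_sub, periodicMap_of_odd hj, periodicMap_of_odd hj, ← bd_chainNorm, ← hbe, ← map_sub, h1,
      add_sub_cancel_left]
    exact bd_mem_chainsIn ha')
  exact hc.descend hp hr ha'' (f := f) (g := g)
    ((sub_eq_iff_eq_add'.1 h2).trans (add_assoc _ _ _).symm)

/-- The powers of `r` do not change the coefficient at a fixed simplex, so the norm adds up `p`
equal terms. The final contradictions are read off from this divisibility. -/
lemma chainNorm_apply_of_fixed (hp : 0 < p) (hr : r^[p] = id) {σ : Simp n X} (hσ : r.comp σ = σ)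
    (b : Chain n X) : chainNorm p r n b σ = p * b σ := by
  have hinj : Function.Injective fun σ : Simp n X => r.comp σ := by
    have h1 := iterate_comp_eq_id hr n
    obtain ⟨q, rfl⟩ := Nat.exists_eq_add_of_le' hp
    rw [Function.iterate_succ] at h1
    exact Function.LeftInverse.injective (congrFun h1)
  have h1 : ∀ c : Chain n X, chainMap r n c σ = c σ := by
    intro c
    have := Finsupp.mapDomain_apply hinj c σ
    change (Finsupp.mapDomain _ c) (r.comp σ) = _ at this
    rwa [hσ] at this
  have h2 : ∀ j : ℕ, ((chainMap r n : Module.End ℤ (Chain n X)) ^ j) b σ = b σ := by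
    intro j
    induction j with
    | zero => rfl
    | succ j ih => rw [pow_succ', Module.End.mul_apply, h1, ih]
  rw [chainNorm, normEnd, LinearMap.sum_apply, Finsupp.finsetSum_apply]
  simp [h2]

/-! ### Maps acting trivially on homology -/

/-- The map `r` acts trivially on the homology represented by cycles with `n` vertices. -/
def ActsTrivially (r : C(X, X)) (n : ℕ) : Prop :=
  ∀ z : Chain n X, IsCycle z → ∃ e, bd n e = chainMap r n z - z

lemma ActsTrivially.chainNorm (h : ActsTrivially r n) {z : Chain n X} (hz : IsCycle z) :
    ∃ e, bd n e = chainNorm p r n z - (p : ℤ) • z := by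
  have h1 : ∀ j : ℕ, IsCycle (((chainMap r n : Module.End ℤ (Chain n X)) ^ j) z) ∧
      ∃ e, bd n e = ((chainMap r n : Module.End ℤ (Chain n X)) ^ j) z - z := by
    intro j
    induction j with
    | zero => exact ⟨hz, 0, by simp⟩
    | succ j ih =>
      obtain ⟨h2, e, he⟩ := ih
      rw [pow_succ', Module.End.mul_apply]
      obtain ⟨e', he'⟩ := h _ h2
      exact ⟨isCycle_chainMap r h2, e' + e, by rw [map_add, he, he', sub_add_sub_cancel]⟩
  choose e he using fun j => (h1 j).2
  refine ⟨∑ j ∈ Finset.range p, e j, ?_⟩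
  rw [map_sum, SingularChains.chainNorm, normEnd, LinearMap.sum_apply]
  simp [he]

/-! ### Zigzags and reflections -/

lemma chainMap_chainMap_chainMap (hrs : r.comp (s.comp r) = s) (n : ℕ) (c : Chain n X) :
    chainMap r n (chainMap s n (chainMap r n c)) = chainMap s n c := by
  rw [← chainMap_comp, ← chainMap_comp, ContinuousMap.comp_assoc, hrs]

/-- Iterating `r s r = s` gives `r^j s = s r^(-j)`, and the norm is symmetric under inversion of the
exponents. -/
lemma chainNorm_chainMap_reflection (hr : r^[p] = id) (hrs : r.comp (s.comp r) = s) (n : ℕ)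
    (c : Chain n X) : chainNorm p r n (chainMap s n c) = chainMap s n (chainNorm p r n c) := by
  set R : Module.End ℤ (Chain n X) := chainMap r n
  set S : Module.End ℤ (Chain n X) := chainMap s n
  have hR : R ^ p = 1 := chainMap_pow_eq_one hr n
  have h1 : ∀ j : ℕ, R ^ j * S * R ^ j = S := by
    intro j
    induction j with
    | zero => simp
    | succ j ih =>
      have h2 : R * S * R = S := LinearMap.ext (chainMap_chainMap_chainMap hrs n)
      calc R ^ (j + 1) * S * R ^ (j + 1) = R ^ j * (R * S * R) * R ^ j := by
            rw [show R ^ (j + 1) * S * R ^ (j + 1) = (R ^ j * R) * S * (R * R ^ j) by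
              rw [← pow_succ, ← pow_succ']]
            simp only [mul_assoc]
        _ = S := by rw [h2, ih]
  have h3 : normEnd p R * S = S * normEnd p R := by
    conv_rhs => rw [← sum_pow_sub R hR]
    rw [normEnd, Finset.sum_mul, Finset.mul_sum]
    refine Finset.sum_congr rfl fun j hj => ?_
    have h4 : R ^ j * R ^ (p - j) = 1 := by
      rw [← pow_add, Nat.add_sub_cancel' (Finset.mem_range.1 hj).le, hR]
    calc R ^ j * S = R ^ j * S * (R ^ j * R ^ (p - j)) := by rw [h4, mul_one]
      _ = S * R ^ (p - j) := by rw [← mul_assoc, h1]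
  exact LinearMap.congr_fun h3 c

/-- Since `r s (r - 1) = s - r s = -(r - 1) s`, a reflected zigzag must acquire a factor `r` and a
sign at each step with `r - 1`. -/
lemma bd_reflect_of_even (hrs : r.comp (s.comp r) = s) {j : ℕ} (hj : Even j) {c : Chain (n + 1) X}
    {c' : Chain n X} (h : bd n c = periodicMap p r j n c') (ε : ℤ) :
    bd n ((ε * -1) • chainMap r _ (chainMap s _ c)) =
      periodicMap p r j n (ε • chainMap s n c') := by
  rw [map_smul, bd_chainMap, bd_chainMap, h, periodicMap_of_even hj, periodicMap_of_even hj,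
    map_sub, map_sub, chainMap_chainMap_chainMap hrs, map_smul, ← smul_sub, mul_smul, neg_one_smul,
    neg_sub]

/-- At a step with the norm the additional factor `r` is absorbed and no sign arises. The sign of a
reflected zigzag therefore counts the even indices below `j`, of which there are `(j + 1) / 2`. -/
lemma bd_reflect_of_odd (hr : r^[p] = id) (hrs : r.comp (s.comp r) = s) {j : ℕ} (hj : ¬ Even j)
    {c : Chain (n + 1) X} {c' : Chain n X} (h : bd n c = periodicMap p r j n c') (ε : ℤ) :
    bd n (ε • chainMap s _ c) = periodicMap p r j n (ε • chainMap r n (chainMap s n c')) := by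
  rw [map_smul, bd_chainMap, h, periodicMap_of_odd hj, periodicMap_of_odd hj, map_smul,
    chainNorm_chainMap hr, chainNorm_chainMap_reflection hr hrs]

/-- The image of a zigzag under a reflection. -/
lemma Zigzag.reflect (hr : r^[p] = id) (hrs : r.comp (s.comp r) = s) {j : ℕ}
    {c : Chain (n + j + 1) X} (hc : Zigzag p r a j c) :
    Zigzag p r (chainMap s n a) j ((-1 : ℤ) ^ ((j + 1) / 2) •
      if Even j then chainMap s _ c else chainMap r _ (chainMap s _ c)) := by
  induction j with
  | zero =>
    rw [if_pos Even.zero]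
    change bd n _ = _
    rw [show (0 + 1) / 2 = 0 from rfl, pow_zero, one_smul, ← show bd n c = a from hc]
    exact bd_chainMap s n c
  | succ j ih =>
    obtain ⟨c', hc', h1⟩ := hc
    refine ⟨_, ih hc', ?_⟩
    by_cases hj : Even j
    · have h2 : (j + 1 + 1) / 2 = (j + 1) / 2 + 1 := by
        obtain ⟨i, rfl⟩ := hj
        omega
      rw [if_pos hj, if_neg (by simpa [Nat.even_add_one] using hj), h2, pow_succ]
      exact bd_reflect_of_even hrs hj h1 _
    · have h2 : (j + 1 + 1) / 2 = (j + 1) / 2 := by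
        obtain ⟨i, rfl⟩ := Nat.not_even_iff_odd.1 hj
        omega
      rw [if_neg hj, if_pos (by simpa [Nat.even_add_one] using hj), h2]
      exact bd_reflect_of_odd hr hrs hj h1 _

/-- A zigzag can be extended past a degree whose homology is acted on trivially. -/
lemma Zigzag.exists_bd_chainNorm_eq (hr : r^[p] = id) (hrs : r.comp (s.comp r) = s)
    (ha : chainMap r n a = a) (hsa : chainMap s n a = -a) {q : ℕ} (hpq : p = 2 * q + 1)
    {j : ℕ} (hj : ¬ Even j) (hj' : Even ((j + 1) / 2)) {c : Chain (n + j + 1) X}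
    (hc : Zigzag p r a j c)
    (h : ∀ l < j, ∀ z : Chain (n + l + 1) X, bd (n + l) z = 0 →
      ∃ e, bd (n + l + 1) e = z)
    (htr : ActsTrivially r (n + j + 1)) (hts : ActsTrivially s (n + j + 1)) :
    ∃ c', Zigzag p r a j c' ∧ ∃ e, bd _ e = chainNorm p r _ c' := by
  -- As `(j + 1) / 2` is even, the reflection `r s c` ends a zigzag from `-a` without sign. Adding
  -- `c` gives a zigzag from zero, so uniqueness provides a cycle `z` with `N z = N c + s N c`.
  have h1 := hc.reflect hr hrs
  rw [hj'.neg_one_pow, one_smul, hsa, if_neg hj] at h1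
  have h2 := hc.add h1
  rw [add_neg_cancel] at h2
  obtain ⟨z, hz, hzd⟩ := h2.exists_cycle hr h
  rw [periodicMap_of_odd hj, periodicMap_of_odd hj, map_add, chainNorm_chainMap hr,
    chainNorm_chainMap_reflection hr hrs] at hzd
  have hw := hc.bd_periodicMap hr ha
  rw [periodicMap_of_odd hj] at hw
  set w := chainNorm p r _ c
  obtain ⟨e1, he1⟩ := hts w hw
  obtain ⟨e2, he2⟩ := htr.chainNorm (p := p) (z := z) hz
  have hzc : bd (n + j) (w - (q : ℤ) • z) = 0 := by
    rw [map_sub, map_smul, hz, hw, smul_zero, sub_zero]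
  obtain ⟨e3, he3⟩ := htr.chainNorm (p := p) (z := w - (q : ℤ) • z) hzc
  -- Up to boundaries `2 w = w + s w = N z = p z`, and so `N (w - q z) = p w - q p z = (p - 2 q) w =
  -- w`. Subtracting this cycle makes the norm of the new end a boundary.
  refine ⟨c - (w - (q : ℤ) • z), hc.sub_cycle hzc, -e3 - (q : ℤ) • (e2 - e1), ?_⟩
  have hp' : (p : ℤ) = 2 * q + 1 := by exact_mod_cast hpq
  rw [map_sub, map_neg, map_smul, map_sub, he1, he2, he3, map_sub (chainNorm p r _) c, hzd, hp']
  change _ = w - _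
  module

end SingularChains

end

/-! ### Fixed points from trivial action on homology. -/

noncomputable section

namespace SingularChains

variable {X : Type*} [TopologicalSpace X] {p : ℕ} {r s : C(X, X)}

/-! ### Actions on acyclic complexes -/

lemma mem_invIn_id_univ {n : ℕ} (c : Chain n X) : c ∈ invIn (ContinuousMap.id X) Set.univ n :=
  mem_invIn.2 ⟨mem_chainsIn_univ _, chainMap_id _ _⟩

lemma BoundsInv.exists_bd_eq {q : ℤ} {n : ℕ} (h : BoundsInv (ContinuousMap.id X) q Set.univ n)
    {c : Chain n X} (hc : IsCycle c) (e : Chain (n + 1) X) (he : bd n e = q • c) :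
    ∃ e, bd n e = c := by
  obtain ⟨e', -, he'⟩ := h c (mem_invIn_id_univ _) hc ⟨e, mem_invIn_id_univ _, he⟩
  exact ⟨e', he'⟩

lemma Zigzag.exists_succ (hr : r^[p] = id) {n : ℕ} {a : Chain n X} (ha : chainMap r n a = a) {j : ℕ}
    {c : Chain (n + j + 1) X} (hc : Zigzag p r a j c)
    (h : BoundsInv (ContinuousMap.id X) 0 Set.univ (n + j + 1)) :
    ∃ c', Zigzag p r a (j + 1) c' := by
  obtain ⟨c', hc'⟩ := h.exists_bd_eq (c := periodicMap p r j _ c) (hc.bd_periodicMap hr ha) 0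
    (by simp)
  exact ⟨c', c, hc, hc'⟩

/-- A space with the homology of a sphere of even dimension `2 * k` has no free action of a cyclic
group of odd order that is trivial on homology. -/
lemma exists_fixed_of_actsTrivially (hp : p.Prime) (hr : r^[p] = id) (k : ℕ) [Nonempty X]
    (hX : ∀ (q : ℤ) n, (n = 2 * k + 1 → q ≠ 0) → BoundsInv (ContinuousMap.id X) q Set.univ n)
    (hN : ∃ N, ∀ n, N ≤ n → BoundsInv r 0 Set.univ n) (htr : ActsTrivially r (2 * k + 1)) :
    ∃ x, r x = x := by
  by_contra! hF
  have hF' : {x | r x = x} = ∅ := Set.eq_empty_of_forall_notMem hF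
  set a : Chain 0 X := Finsupp.single (emptySimp X) 1
  have ha : chainMap r 0 a = a := chainMap_zero_eq _ _
  have hex : ∀ j, ∃ c, Zigzag p r a j c := by
    intro j
    induction j with
    | zero =>
      obtain ⟨c, hc⟩ := (hX 0 0 (by simp)).exists_bd_eq (c := a) trivial 0 (by simp)
      exact ⟨c, hc⟩
    | succ j ih =>
      obtain ⟨c, hc⟩ := ih
      by_cases hj : 0 + j + 1 = 2 * k + 1
      -- The critical degree. The obstruction is killed by the norm, which is multiplication by `p`
      -- on homology, so `p` times it bounds. Absence of torsion then removes the obstruction.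
      · have hz := hc.bd_periodicMap hr ha
        rw [← hj] at htr
        obtain ⟨e, he⟩ := htr.chainNorm (p := p) (z := periodicMap p r j _ c) hz
        have hj2 : Even j := ⟨k, by omega⟩
        rw [← periodicMap_of_odd (j := j + 1) (by simpa [Nat.even_add_one] using hj2),
          periodicMap_succ_periodicMap hr, zero_sub] at he
        obtain ⟨c', hc'⟩ := (hX p _ fun _ => by exact_mod_cast hp.ne_zero).exists_bd_eq
          (c := periodicMap p r j _ c) hz (-e) (by rw [map_neg, he, neg_neg])
        exact ⟨c', c, hc, hc'⟩
      · exact hc.exists_succ hr ha (hX _ _ fun h => absurd h hj)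
  obtain ⟨N, hN⟩ := hN
  -- An odd length beyond `N`: the last map of the resolution must be the norm, and its cycle must
  -- lie in the range where invariant homology vanishes.
  obtain ⟨c, hc⟩ := hex (2 * N + 1)
  obtain ⟨b, d, hd, h⟩ := hc.exists_eq_chainNorm_add hp hr ha (by simp) (hN _ (by omega))
  rw [hF'] at hd
  rw [eq_zero_of_mem_chainsIn_empty hd, map_zero, add_zero] at h
  have h1 := congrArg (fun c : Chain 0 X => c (emptySimp X)) h
  simp only [chainNorm_apply_of_fixed hp.pos hr (subsingleton_simp_zero.elim _ (emptySimp X)), a,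
    Finsupp.single_eq_same] at h1
  exact hp.one_lt.ne' (by exact_mod_cast Int.eq_one_of_dvd_one (by positivity) ⟨_, h1⟩)

/-- The zigzag starts at the difference of two distinct fixed points exchanged by the reflection.
Evenness of `k` gives the reflected zigzag the right sign in degree `2k`; without the obstruction
the coefficient `1` at `x` would be a multiple of `p`. -/
lemma false_of_actsTrivially_of_fixed (hp : p.Prime) {q : ℕ} (hpq : p = 2 * q + 1)
    (hr : r^[p] = id) (hrs : r.comp (s.comp r) = s) (hss : ∀ x, s (s x) = x) {k : ℕ} (hk0 : 0 < k)
    (hk : Even k)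
    (hX : ∀ n, n ≠ 2 * k + 1 → BoundsInv (ContinuousMap.id X) 0 Set.univ n)
    (hN : ∃ N, ∀ n, N ≤ n → BoundsInv r 0 Set.univ n)
    (htr : ActsTrivially r (2 * k + 1)) (hts : ActsTrivially s (2 * k + 1))
    (hF : AllConst {x | r x = x}) {x : X} (hx : r x = x) (hsx : s x ≠ x) : False := by
  have hrsx : r (s x) = s x := by
    have := congrArg (fun f : C(X, X) => f x) hrs
    simpa [hx] using this
  set a : Chain 1 X := Finsupp.single (ContinuousMap.const _ x) 1 -
    Finsupp.single (ContinuousMap.const _ (s x)) 1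
  have ha : chainMap r 1 a = a := by
    simp only [a, map_sub, chainMap_single, ContinuousMap.comp_const, hx, hrsx]
  have hsa : chainMap s 1 a = -a := by
    simp only [a, map_sub, chainMap_single, ContinuousMap.comp_const, hss, neg_sub]
  have hex : ∀ j, ∃ c, Zigzag p r a j c := by
    intro j
    induction j with
    | zero =>
      have ha0 : bd 0 a = 0 := by
        simp only [a, map_sub, bd_single, sub_eq_zero]
        congr 1
        refine Finset.sum_congr rfl fun i _ => ?_
        congr 2
        exact subsingleton_simp_zero.elim _ _
      obtain ⟨c, hc⟩ := (hX 1 (by omega)).exists_bd_eq (c := a) ha0 0 (by simp)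
      exact ⟨c, hc⟩
    | succ j ih =>
      obtain ⟨c, hc⟩ := ih
      by_cases hj : 1 + j + 1 = 2 * k + 1
      -- In the critical degree `j = 2k - 1` is odd and `(j + 1) / 2 = k` is even. Only the last
      -- term of the zigzag has to be changed before it can be prolonged.
      · rw [← hj] at htr hts
        have hj1 : ¬ Even j := by
          rw [Nat.even_iff]
          omega
        obtain ⟨c', hc', e, he⟩ := hc.exists_bd_chainNorm_eq hr hrs ha hsa hpq hj1
          (by rwa [show (j + 1) / 2 = k by omega])
          (fun l hl z hz => (hX (1 + l + 1) (by omega)).exists_bd_eq hz 0 (by simp)) htr hts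
        exact ⟨e, c', hc', he.trans (periodicMap_of_odd hj1 _ _).symm⟩
      · exact hc.exists_succ hr ha (hX _ hj)
  obtain ⟨N, hN⟩ := hN
  obtain ⟨c, hc⟩ := hex (2 * N + 1)
  obtain ⟨b, d, hd, h⟩ := hc.exists_eq_chainNorm_add hp hr ha (by simp) (hN _ (by omega))
  -- The two endpoints of a constant path cancel, so the chain of fixed simplices contributes
  -- nothing.
  rw [bd_eq_of_allConst hF hd, if_neg (by simp), add_zero] at h
  have hσ : r.comp (ContinuousMap.const (stdSimplex ℝ (Fin 1)) x) = ContinuousMap.const _ x := by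
    rw [ContinuousMap.comp_const, hx]
  have hne : ContinuousMap.const (stdSimplex ℝ (Fin 1)) (s x) ≠ ContinuousMap.const _ x :=
    fun h => hsx (congrArg (fun f : C(stdSimplex ℝ (Fin 1), X) => f (stdSimplex.vertex 0)) h)
  have h1 := congrArg (fun c : Chain 1 X => c (ContinuousMap.const _ x)) h
  simp only [chainNorm_apply_of_fixed hp.pos hr hσ, a, Finsupp.sub_apply, Finsupp.single_eq_same,
    Finsupp.single_eq_of_ne' hne, sub_zero] at h1
  exact hp.one_lt.ne' (by exact_mod_cast Int.eq_one_of_dvd_one (by positivity) ⟨_, h1⟩)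

end SingularChains

end

/-! ### Transfer of triviality on homology to explicit chains. -/

noncomputable section

namespace SingularChains

open CategoryTheory AlgebraicTopology

open scoped Simplicial

variable (X : Type u) [TopologicalSpace X]

/-! ### Comparison with singular homology in Mathlib -/

/-- The simplicial set of singular simplices. -/
abbrev singularSSet : SSet.{u} := TopCat.toSSet.obj (TopCat.of X)

/-- The coefficient module of integral homology. -/
abbrev coeff : ModuleCat.{u} ℤ := ModuleCat.of ℤ (ULift.{u} ℤ)

variable {X}

/-- Singular simplices as elements of the singular simplicial set. -/
def simpEquiv (n : ℕ) : (singularSSet X) _⦋n⦌ ≃ Simp (n + 1) X :=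
  TopCat.toSSetObjEquiv (TopCat.of X) (.op ⦋n⦌)

lemma simpEquiv_δ {n : ℕ} (x : (singularSSet X) _⦋n + 1⦌) (i : Fin (n + 2)) :
    simpEquiv n ((singularSSet X).δ i x) = (simpEquiv (n + 1) x).comp (faceMap i) := rfl

/-- Evaluation at the generator of the coefficient module. -/
def evalOne (M : ModuleCat.{u} ℤ) : (coeff.{u} ⟶ M) →+ M :=
  AddMonoidHom.mk' (fun φ => φ.hom (ULift.up 1)) fun _ _ => rfl

lemma hom_evalOne {M N : ModuleCat.{u} ℤ} (φ : coeff.{u} ⟶ M) (f : M ⟶ N) :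
    f.hom (evalOne M φ) = evalOne N (φ ≫ f) := rfl

/-- The comparison map to the singular chain complex. -/
def toSingular (n : ℕ) : Chain (n + 1) X →+ ((singularSSet X).chainComplex coeff.{u}).X n :=
  Finsupp.liftAddHom fun σ => zmultiplesHom _
    (evalOne _ ((singularSSet X).ιChainComplex (R := coeff.{u}) ((simpEquiv n).symm σ)))

lemma toSingular_single {n : ℕ} (σ : Simp (n + 1) X) :
    toSingular n (Finsupp.single σ 1) =
      evalOne _ ((singularSSet X).ιChainComplex (R := coeff.{u}) ((simpEquiv n).symm σ)) := by
  simp [toSingular]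

lemma chain_addHom_ext {n : ℕ} {A : Type*} [AddGroup A] {f g : Chain n X →+ A}
    (h : ∀ σ, f (Finsupp.single σ 1) = g (Finsupp.single σ 1)) (c : Chain n X) : f c = g c := by
  refine DFunLike.congr_fun (Finsupp.addHom_ext' fun σ => AddMonoidHom.ext_int ?_) c
  exact h σ

/-- The comparison map from the singular chain complex. -/
def ofSingular (n : ℕ) :
    ((singularSSet X).chainComplex coeff.{u}).X n ⟶ ModuleCat.of.{u} ℤ (Chain (n + 1) X) :=
  Limits.Cofan.IsColimit.desc ((singularSSet X).isColimitChainComplexXCofan coeff.{u} n) fun x =>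
    ModuleCat.ofHom ((Finsupp.lsingle (simpEquiv n x)).comp
      (ULift.moduleEquiv : ULift.{u} ℤ ≃ₗ[ℤ] ℤ).toLinearMap)

lemma ι_ofSingular {n : ℕ} (x : (singularSSet X) _⦋n⦌) :
    (singularSSet X).ιChainComplex (R := coeff.{u}) x ≫ ofSingular n =
      ModuleCat.ofHom ((Finsupp.lsingle (simpEquiv n x)).comp
        (ULift.moduleEquiv : ULift.{u} ℤ ≃ₗ[ℤ] ℤ).toLinearMap) :=
  Limits.Cofan.IsColimit.fac ((singularSSet X).isColimitChainComplexXCofan coeff.{u} n) _ _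

lemma evalOne_ι_ofSingular {n : ℕ} (x : (singularSSet X) _⦋n⦌) :
    evalOne _ ((singularSSet X).ιChainComplex (R := coeff.{u}) x ≫ ofSingular n) =
      (Finsupp.single (simpEquiv n x) 1 : Chain (n + 1) X) := by
  rw [ι_ofSingular]
  rfl

lemma evalOne_injective (M : ModuleCat.{u} ℤ) : Function.Injective (evalOne M) := by
  intro φ ψ h
  refine ModuleCat.hom_ext (LinearMap.ext fun t => ?_)
  have h1 : t = t.down • (ULift.up 1 : coeff.{u}) := ULift.ext _ _ (mul_one _).symm
  have h2 : ∀ χ : coeff.{u} ⟶ M, χ.hom t = t.down • evalOne M χ := fun χ =>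
    (congrArg χ.hom h1).trans (map_zsmul χ.hom t.down _)
  rw [h2, h2, h]

/-- This one-sided identity suffices: cycles are sent to the categorical complex, the bounding chain
is found there, and it is brought back. -/
lemma ofSingular_toSingular {n : ℕ} (c : Chain (n + 1) X) :
    (ofSingular n).hom (toSingular n c) = c := by
  refine chain_addHom_ext (f := (ofSingular n).hom.toAddMonoidHom.comp (toSingular n))
    (g := AddMonoidHom.id _) (fun σ => ?_) c
  change (ofSingular n).hom (toSingular n (Finsupp.single σ 1)) = Finsupp.single σ 1
  rw [toSingular_single, hom_evalOne, evalOne_ι_ofSingular, Equiv.apply_symm_apply]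

lemma d_toSingular {n : ℕ} (c : Chain (n + 2) X) :
    (((singularSSet X).chainComplex coeff.{u}).d (n + 1) n).hom (toSingular (n + 1) c) =
      toSingular n (bd (n + 1) c) := by
  refine chain_addHom_ext
    (f := (((singularSSet X).chainComplex coeff.{u}).d (n + 1) n).hom.toAddMonoidHom.comp
      (toSingular (n + 1)))
    (g := (toSingular n).comp (bd (n + 1)).toAddMonoidHom) (fun σ => ?_) c
  change (((singularSSet X).chainComplex coeff.{u}).d (n + 1) n).hom
    (toSingular (n + 1) (Finsupp.single σ 1)) = toSingular n (bd (n + 1) (Finsupp.single σ 1))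
  rw [toSingular_single, hom_evalOne, SSet.ιChainComplex_d, bd_single, one_smul, map_sum, map_sum]
  refine Finset.sum_congr rfl fun i _ => ?_
  rw [map_zsmul, map_zsmul, toSingular_single]
  congr 3

lemma bd_ofSingular {n : ℕ} (x : ((singularSSet X).chainComplex coeff.{u}).X (n + 1)) :
    bd (n + 1) ((ofSingular (n + 1)).hom x) =
      (ofSingular n).hom ((((singularSSet X).chainComplex coeff.{u}).d (n + 1) n).hom x) := by
  have h : ofSingular (n + 1) ≫ ModuleCat.ofHom (bd (n + 1)) =
      ((singularSSet X).chainComplex coeff.{u}).d (n + 1) n ≫ ofSingular n := by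
    refine SSet.chainComplex_hom_ext fun x => evalOne_injective _ ?_
    rw [← Category.assoc, ← Category.assoc, ← hom_evalOne, evalOne_ι_ofSingular,
      SSet.ιChainComplex_d, ← hom_evalOne, map_sum, map_sum]
    refine (bd_single _ _).trans ?_
    rw [one_smul]
    refine Finset.sum_congr rfl fun i _ => ?_
    rw [map_zsmul, map_zsmul, hom_evalOne, evalOne_ι_ofSingular, simpEquiv_δ]
  exact LinearMap.congr_fun (congrArg ModuleCat.Hom.hom h) x

lemma map_toSingular (f : C(X, X)) {n : ℕ} (c : Chain (n + 1) X) :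
    ((SSet.chainComplexMap (TopCat.toSSet.map (TopCat.ofHom f)) coeff.{u}).f n).hom
      (toSingular n c) = toSingular n (chainMap f (n + 1) c) := by
  refine chain_addHom_ext
    (f := ((SSet.chainComplexMap (TopCat.toSSet.map (TopCat.ofHom f))
      coeff.{u}).f n).hom.toAddMonoidHom.comp (toSingular n))
    (g := (toSingular n).comp (chainMap f (n + 1)).toAddMonoidHom) (fun σ => ?_) c
  change ((SSet.chainComplexMap (TopCat.toSSet.map (TopCat.ofHom f)) coeff.{u}).f n).hom
    (toSingular n (Finsupp.single σ 1)) = toSingular n (chainMap f (n + 1) (Finsupp.single σ 1))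
  rw [toSingular_single, hom_evalOne, SSet.ι_chainComplexMap_f, chainMap_single, toSingular_single]
  congr 2

/-- A chain map inducing the identity on homology moves cycles by boundaries. -/
lemma exists_d_eq_of_homologyMap_eq_id {K : ChainComplex (ModuleCat.{u} ℤ) ℕ} (f : K ⟶ K) {n : ℕ}
    (hf : HomologicalComplex.homologyMap f (n + 1) = 𝟙 _) (z : K.X (n + 1))
    (hz : (K.d (n + 1) n).hom z = 0) :
    ∃ y, (K.d (n + 2) (n + 1)).hom y = (f.f (n + 1)).hom z - z := by
  -- The element `z` is encoded as a morphism from the coefficient module, so that it can be lifted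
  -- to the object of cycles.
  let φ : coeff.{u} ⟶ K.X (n + 1) := ModuleCat.ofHom ((LinearMap.toSpanSingleton ℤ _ z).comp
    (ULift.moduleEquiv : ULift.{u} ℤ ≃ₗ[ℤ] ℤ).toLinearMap)
  have hφ : evalOne _ φ = z := LinearMap.toSpanSingleton_apply_one ℤ _ z
  have hφd : φ ≫ K.d (n + 1) n = 0 := evalOne_injective _ (by
    rw [← hom_evalOne, hφ, hz, map_zero])
  let k := K.liftCycles φ n (by simp) hφd
  have hk : (k ≫ HomologicalComplex.cyclesMap f (n + 1) - k) ≫ K.homologyπ (n + 1) = 0 := by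
    rw [Preadditive.sub_comp, Category.assoc, ← HomologicalComplex.homologyπ_naturality, hf,
      Category.comp_id, sub_self]
  have hex : (ShortComplex.mk (K.toCycles (n + 2) (n + 1)) (K.homologyπ (n + 1))
      (K.toCycles_comp_homologyπ _ _)).Exact :=
    ShortComplex.exact_of_g_is_cokernel _ (K.homologyIsCokernel (n + 2) (n + 1) (by simp))
  obtain ⟨y, hy⟩ := (ShortComplex.moduleCat_exact_iff _).1 hex
    (evalOne _ (k ≫ HomologicalComplex.cyclesMap f (n + 1) - k)) (by
      refine (hom_evalOne _ _).trans ?_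
      rw [hk, map_zero])
  refine ⟨y, ?_⟩
  have h1 : (K.iCycles (n + 1)).hom ((K.toCycles (n + 2) (n + 1)).hom y) =
      (K.d (n + 2) (n + 1)).hom y :=
    LinearMap.congr_fun (congrArg ModuleCat.Hom.hom (K.toCycles_i (n + 2) (n + 1))) y
  have h2 : (k ≫ HomologicalComplex.cyclesMap f (n + 1) - k) ≫ K.iCycles (n + 1) =
      φ ≫ f.f (n + 1) - φ := by
    rw [Preadditive.sub_comp, Category.assoc, HomologicalComplex.cyclesMap_i,
      HomologicalComplex.liftCycles_i_assoc, HomologicalComplex.liftCycles_i]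
  rw [← h1, show (K.toCycles (n + 2) (n + 1)).hom y = _ from hy, hom_evalOne, h2, map_sub, hφ,
    ← hom_evalOne, hφ]

/-- Homological degree `n + 1` corresponds to simplices with `n + 2` vertices. In positive degrees
the augmentation plays no role, so the cycles on both sides agree. -/
lemma actsTrivially_of_homologyMap_eq_id (f : C(X, X)) {n : ℕ}
    (hf : HomologicalComplex.homologyMap
      (SSet.chainComplexMap (TopCat.toSSet.map (TopCat.ofHom f)) coeff.{u}) (n + 1) = 𝟙 _) :
    ActsTrivially f (n + 2) := by
  intro z hz
  obtain ⟨y, hy⟩ := exists_d_eq_of_homologyMap_eq_id _ hf (toSingular (n + 1) z) (by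
    rw [d_toSingular, show bd (n + 1) z = 0 from hz, map_zero])
  refine ⟨(ofSingular (n + 2)).hom y, ?_⟩
  rw [bd_ofSingular, hy, map_toSingular, ← map_sub, ofSingular_toSingular]

end SingularChains

end

/-! ### Pseudofree actions on `G`-CW complexes. -/

noncomputable section

namespace SingularChains

open RelCWComplex (cell openCell closedCell cellFrontier skeletonLT)

/-- Standard simplices are connected, and a map from a connected space to a discrete one is
constant. -/
lemma allConst_of_isDiscrete {X : Type*} [TopologicalSpace X] {A : Set X} (hA : IsDiscrete A) :
    AllConst A := by
  intro n σ hσ s t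
  have := hA.to_subtype
  let τ : stdSimplex ℝ (Fin n) → A := fun t => ⟨σ t, hσ t⟩
  have hτ : Continuous τ := σ.continuous.subtype_mk _
  have : PreconnectedSpace (stdSimplex ℝ (Fin n)) :=
    Subtype.preconnectedSpace (convex_stdSimplex ℝ (Fin n)).isPreconnected
  exact congrArg Subtype.val (PreconnectedSpace.constant ‹_› hτ)

variable {X : Type u} [TopologicalSpace X] [T2Space X] [CWComplex (Set.univ : Set X)]

/-- A map fixing an open cell of positive dimension pointwise has a non-discrete fixed set. -/
lemma not_subset_of_isDiscrete {m : ℕ} (i : cell (Set.univ : Set X) (m + 1)) {A : Set X}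
    (hA : IsDiscrete A) : ¬ openCell (m + 1) i ⊆ A := by
  intro h
  have hA' : IsDiscrete (openCell (m + 1) i) := hA.mono h
  have := hA'.to_subtype
  have hc : IsPreconnected (openCell (m + 1) i) :=
    (convex_ball (0 : Fin (m + 1) → ℝ) 1).isPreconnected.image _
      ((RelCWComplex.continuousOn (m + 1) i).mono Metric.ball_subset_closedBall)
  have : PreconnectedSpace (openCell (m + 1) i) := Subtype.preconnectedSpace hc
  have h0 : (0 : Fin (m + 1) → ℝ) ∈ Metric.ball (0 : Fin (m + 1) → ℝ) 1 := by simp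
  have h1 : (fun _ => 2⁻¹ : Fin (m + 1) → ℝ) ∈ Metric.ball (0 : Fin (m + 1) → ℝ) 1 := by
    rw [mem_ball_zero_iff, pi_norm_const]
    norm_num
  have hsub := PreconnectedSpace.constant (f := (id : openCell (m + 1) i → openCell (m + 1) i))
    ‹_› continuous_id (x := ⟨_, _, h0, rfl⟩) (y := ⟨_, _, h1, rfl⟩)
  have h2 := congrFun (charMap_injOn i h0 h1 (congrArg Subtype.val hsub)) 0
  norm_num at h2

section GCW

variable {G : Type*} [Group G] [MulAction G X] [ContinuousConstSMul G X]

/-- The continuous map given by the action of a group element. -/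
def actMap (g : G) : C(X, X) := ⟨fun x => g • x, continuous_const_smul g⟩

lemma iterate_actMap (g : G) (n : ℕ) : (actMap g : C(X, X))^[n] = fun x => g ^ n • x :=
  smul_iterate g n

variable [GCWComplex G X]

/-- The action of a group element on the cells. -/
def cellMap (g : G) (m : ℕ) (i : cell (Set.univ : Set X) m) : cell (Set.univ : Set X) m :=
  letI := GCWComplex.cellAction (G := G) (X := X) m
  g • i

lemma permutesCells_actMap (g : G) : PermutesCells (actMap g : C(X, X)) (cellMap g) :=
  fun m i x hx => GCWComplex.map_smul m g i x hx

lemma iterate_cellMap (g : G) {n : ℕ} (hg : g ^ n = 1) (m : ℕ) :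
    (cellMap g m : cell (Set.univ : Set X) m → _)^[n] = id := by
  let _ := GCWComplex.cellAction (G := G) (X := X) m
  change (fun i : cell (Set.univ : Set X) m => g • i)^[n] = id
  rw [smul_iterate, hg]
  funext i
  exact one_smul G i

/-- The group acts trivially on the disc coordinate, so an element that stabilizes a cell fixes it
pointwise. A whole open cell of positive dimension would then lie in the discrete singular set. -/
lemma cellMap_ne (h : IsPseudofree G X) {g : G} (hg : g ≠ 1) (m : ℕ)
    (i : cell (Set.univ : Set X) (m + 1)) : cellMap g (m + 1) i ≠ i := by
  intro hi
  refine not_subset_of_isDiscrete i h ?_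
  rintro _ ⟨y, hy, rfl⟩
  have := permutesCells_actMap (X := X) g (m + 1) i y (Metric.ball_subset_closedBall hy)
  rw [hi] at this
  exact ⟨g, hg, this.symm⟩

end GCW

lemma actsTrivially_actMap {X : Type u} [TopologicalSpace X] {G : Type*} [Group G] [MulAction G X]
    [ContinuousConstSMul G X] (h : ActsTriviallyOnHomology G X) (g : G) (n : ℕ) :
    ActsTrivially (actMap g : C(X, X)) (n + 2) :=
  actsTrivially_of_homologyMap_eq_id _ (h g (n + 1))

end SingularChains

end

/-! ### The theorem for dihedral groups. -/

open SingularChains in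
theorem mainTheorem2 (p : ℕ) [Fact p.Prime] (hp : p ≠ 2) (k : ℕ) (hk0 : 0 < k) (hk : Even k)
    (X : Type u) [TopologicalSpace X] [T2Space X]
    [MulAction (DihedralGroup p) X] [ContinuousConstSMul (DihedralGroup p) X]
    [CWComplex (Set.univ : Set X)] [CWComplex.Finite (Set.univ : Set X)]
    [GCWComplex (DihedralGroup p) X]
    (hX : Nonempty (ContinuousMap.HomotopyEquiv X
      (Metric.sphere (0 : EuclideanSpace ℝ (Fin (2 * k + 1))) 1))) :
    ¬ (FaithfulSMul (DihedralGroup p) X ∧ IsPseudofree (DihedralGroup p) X ∧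
        MulAction.fixedPoints (DihedralGroup p) X = ∅ ∧
        ActsTriviallyOnHomology (DihedralGroup p) X) := by
  rintro ⟨-, hfree, hfix, htriv⟩
  obtain ⟨e⟩ := hX
  have hpp : p.Prime := Fact.out
  obtain ⟨q, hq⟩ : ∃ q, p = 2 * q + 1 := hpp.odd_of_ne_two hp
  have hr1 : (DihedralGroup.r 1 : DihedralGroup p) ≠ 1 := by
    rw [← DihedralGroup.r_zero]
    intro h
    have : Fact (1 < p) := ⟨hpp.one_lt⟩
    exact one_ne_zero (DihedralGroup.r.inj h)
  have hrp : (DihedralGroup.r 1 : DihedralGroup p) ^ p = 1 := by simp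
  have hr : (actMap (DihedralGroup.r 1 : DihedralGroup p) : C(X, X))^[p] = id := by
    rw [iterate_actMap, hrp]
    funext x
    exact one_smul _ x
  have hrs : (actMap (DihedralGroup.r 1 : DihedralGroup p) : C(X, X)).comp
      ((actMap (DihedralGroup.sr 0 : DihedralGroup p)).comp
        (actMap (DihedralGroup.r 1 : DihedralGroup p))) =
        actMap (DihedralGroup.sr 0 : DihedralGroup p) := by
    ext1 x
    change (DihedralGroup.r 1 : DihedralGroup p) • (DihedralGroup.sr 0 : DihedralGroup p) •
      (DihedralGroup.r 1 : DihedralGroup p) • x = (DihedralGroup.sr 0 : DihedralGroup p) • x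
    rw [smul_smul, smul_smul]
    simp
  have hss : ∀ x : X, (actMap (DihedralGroup.sr 0 : DihedralGroup p) : C(X, X))
      (actMap (DihedralGroup.sr 0 : DihedralGroup p) x) = x := by
    intro x
    change (DihedralGroup.sr 0 : DihedralGroup p) • (DihedralGroup.sr 0 : DihedralGroup p) • x = x
    rw [smul_smul]
    simp
  -- Degree `2 * k` means `2 * k + 1` vertices; positivity of `k` makes this at least two, where the
  -- comparison with singular homology applies.
  obtain ⟨l, hl⟩ : ∃ l, 2 * k + 1 = l + 2 := ⟨2 * k - 1, by omega⟩
  have htr : ActsTrivially (actMap (DihedralGroup.r 1 : DihedralGroup p) : C(X, X)) (2 * k + 1) := by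
    rw [hl]
    exact actsTrivially_actMap htriv _ _
  have hts : ActsTrivially (actMap (DihedralGroup.sr 0 : DihedralGroup p) : C(X, X))
      (2 * k + 1) := by
    rw [hl]
    exact actsTrivially_actMap htriv _ _
  have hN := exists_boundsInv_univ hpp hr (permutesCells_actMap (DihedralGroup.r 1 : DihedralGroup p))
    (iterate_cellMap _ hrp) (cellMap_ne hfree hr1)
  have hne : Nonempty X := by
    have : Nonempty (Metric.sphere (0 : EuclideanSpace ℝ (Fin (2 * k + 1))) 1) :=
      (NormedSpace.sphere_nonempty.2 zero_le_one).to_subtype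
    exact this.map e.invFun
  have hsphere := boundsInv_of_homotopyEquiv_sphere (2 * k + 1) e
  obtain ⟨x, hx⟩ := exists_fixed_of_actsTrivially hpp hr k hsphere hN htr
  refine false_of_actsTrivially_of_fixed hpp hq hr hrs hss hk0 hk
    (fun n hn => hsphere 0 n fun h => absurd h hn) hN htr hts ?_ hx ?_
  · exact allConst_of_isDiscrete (hfree.mono fun y hy => ⟨_, hr1, hy⟩)
  -- If the reflection also fixes `x`, then so does the whole group, since `r 1` and `sr 0` generate
  -- it; this contradicts the absence of global fixed points.
  · intro hsx
    refine Set.eq_empty_iff_forall_notMem.1 hfix x ?_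
    have hrx : ∀ j : ℕ, (DihedralGroup.r j : DihedralGroup p) • x = x := by
      intro j
      rw [← DihedralGroup.r_one_pow]
      have h := congrFun (iterate_actMap (X := X) (DihedralGroup.r 1 : DihedralGroup p) j) x
      rw [← h]
      exact Function.iterate_fixed hx j
    have : NeZero p := ⟨hpp.ne_zero⟩
    rintro (j | j)
    · rw [← ZMod.natCast_zmod_val j]
      exact hrx _
    · have h : (DihedralGroup.sr j : DihedralGroup p) =
          DihedralGroup.sr 0 * DihedralGroup.r j := by simp
      rw [h, mul_smul, ← ZMod.natCast_zmod_val j, hrx]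
      exact hsx
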